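/- Let $R$ be a commutative ring and let $D$ be a (planar, unoriented) link diagram with $N$ crossings. Let $V=\langle v_+,v_-\rangle$ be the free graded $R$-module with $\deg v_\pm=\pm1$ and Khovanov's Frobenius algebra structure ($v_+v_+=v_+$, $v_+v_-=v_-v_+=v_-$, $v_-v_-=0$; $\Delta v_+=v_+\otimes v_-+v_-\otimes v_+$, $\Delta v_-=v_-\otimes v_-$). The unnormalised Khovanov homology $\overline{KH}_{i,j}(D)$ is the homology, in homological degree $i$ and quantum degree $j$, of the complex $$\overline{C}_{i,*}(D)=\bigoplus_{\mathrm{rk}(\alpha)=N-i}V^{\otimes k_\alpha}[\mathrm{rk}(\alpha)],$$ where $\alpha$ runs over the complete smoothings of $D$, $\mathrm{rk}(\alpha)$ is the number of 1-smoothings in $\alpha$, $k_\alpha$ is the number of circles of $\alpha$, $(W[a])_j=W_{j-a}$, and the differential $\overline{C}_{i,*}\to\overline{C}_{i-1,*}$ is the usual signed sum of the multiplications and comultiplications along the edges of the cube of smoothings (0-smoothing to 1-smoothing). Let $c_1,\dots,c_k$ be distinct crossings of $D$ (the fixed crossings), and let $\ell=N-k$ be the number of the other (free) crossings. For a vertex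 $x$ of the Boolean lattice $\mathbf{B}_\ell$ of subsets of the free crossings, let $D_x$ be the diagram with $k$ crossings obtained from $D$ by 1-smoothing the free crossings in $x$ and 0-smoothing the other free crossings, let $\mathrm{rk}(x)$ be the cardinality of $x$, and put $V_{q,j}(x)=\overline{KH}_{q,\,j-\mathrm{rk}(x)}(D_x)$. An edge from $x$ to $x'$ of $\mathbf{B}_\ell$ induces, through the saddle chain map $\overline{C}_{*,*}(D_x)\to\overline{C}_{*,*}(D_{x'})$ of bidegree $(0,-1)$ given by the multiplication and comultiplication, a map $\delta_x^{x'}\colon V_{*,*}(x)\to V_{*,*}(x')$ of bidegree $(0,0)$. The Khovanov homology with respect to the fixed crossings, $\overline{KH}_{p,q,j}(D;c_1,\dots,c_k)$, is the homology in degree $p$ of the complex $$\overline{\mathcal K}_{p,q,j}=\bigoplus_{\mathrm{rk}(x)=\ell-p}V_{q,j}(x),$$ whose differential $\overline{\mathcal K}_{p,q,j}\to\overline{\mathcal K}_{p-1,q,j}$ is the sum of the maps $\delta_x^{x'}$ with the usual signs of the Khovanov cube. Then these are indeed complexes and chain maps, and for each $i$ there is a spectral sequence of $R$-modules $$E^2_{p,q}=\overline{KH}_{p,q,i}(D;c_1,\dots,c_k)\Longrightarrow\overline{KH}_{p+q,i}(D),$$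 whose $r$-th differential has bidegree $(-r,r-1)$: for all $p,q$ the terms $E^r_{p,q}$ are stationary for large $r$, and each $\overline{KH}_{n,i}(D)$ has a finite filtration whose subquotients $\mathrm{Fil}_p\,\overline{KH}_{p+q,i}(D)/\mathrm{Fil}_{p-1}\,\overline{KH}_{p+q,i}(D)$ are isomorphic to $E^\infty_{p,q}$. -/

import Mathlib

open CategoryTheory CategoryTheory.Limits

universe u

/-! ## Link diagrams -/

/-- The relation generating the connected components of a 4-valent graph given by its ends
`Fin N × Fin 4` at the vertices and the involution `arc`: two ends are related when they lie on
the same arc, or are neighbouring ends at the same vertex. -/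
def ComponentRel {N : ℕ} (arc : Fin N × Fin 4 → Fin N × Fin 4) (d e : Fin N × Fin 4) : Prop :=
  e = arc d ∨ e = (d.1, d.2 + 1)

/-- The relation generating the faces of a 4-valent graph with a cyclic order of the ends at each
vertex: walk along the arc, then turn to the next end at the vertex that is reached. -/
def FaceRel {N : ℕ} (arc : Fin N × Fin 4 → Fin N × Fin 4) (d e : Fin N × Fin 4) : Prop :=
  e = ((arc d).1, (arc d).2 + 1)

/-- An (unoriented) link diagram, as a planar diagram: there are `N` crossings, and the four ends
at a crossing `c` are `(c, 0), (c, 1), (c, 2), (c, 3)` in counterclockwise order, where `(c, 0)` and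
`(c, 2)` belong to the understrand and `(c, 1)` and `(c, 3)` to the overstrand. The ends are joined
in pairs by the arcs of the diagram; `loops` is the number of components that are simple closed
curves without any crossing. The diagram is drawn in the plane: by Euler's formula
`V - E + F = 2 * C` for the 4-valent graph with `V = N` vertices, `E = 2 * N` edges, `F` faces
(boundary cycles) and `C` connected components. -/
structure LinkDiagram where
  /-- the number of crossings -/
  N : ℕ
  /-- the other end of the arc that starts at a given end -/
  arc : Fin N × Fin 4 → Fin N × Fin 4
  arc_arc : ∀ d, arc (arc d) = d
  arc_ne : ∀ d, arc d ≠ d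
  /-- the number of components without crossings -/
  loops : ℕ
  planar : Nat.card (Quot (FaceRel arc)) = N + 2 * Nat.card (Quot (ComponentRel arc))

/-- The integral matrix `M` as a linear map between free `R`-modules: the basis element `a` goes to
`∑ b, M a b • b`. -/
noncomputable def matrixMap (R : Type u) [CommRing R] {A B : Type} [Finite B] (M : A → B → ℤ) :
    (A →₀ R) →ₗ[R] (B →₀ R) :=
  Finsupp.linearCombination R fun a => Finsupp.equivFunOnFinite.symm fun b => (M a b : R)

/-- The usual sign of an edge of the cube of subsets of an ordered set: the edge from `x` to
`y = insert c x` has the sign `(-1) ^ #{b ∈ x | b < c}`. -/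
def edgeSign {N : ℕ} (x y : Finset (Fin N)) : ℤ :=
  ∏ c ∈ y \ x, (-1) ^ (x.filter (· < c)).card

/-- The multiplication of `V = ⟨v₊, v₋⟩` (`v₊` is `true`): the coefficient of `c` in `m(a ⊗ b)`,
where `v₊v₊ = v₊`, `v₊v₋ = v₋v₊ = v₋` and `v₋v₋ = 0`. -/
def mulCoeff : Bool → Bool → Bool → ℤ
  | true, true, true => 1
  | true, false, false => 1
  | false, true, false => 1
  | _, _, _ => 0

/-- The comultiplication of `V`: the coefficient of `b ⊗ c` in `Δ(a)`, where
`Δ(v₊) = v₊ ⊗ v₋ + v₋ ⊗ v₊` and `Δ(v₋) = v₋ ⊗ v₋`. -/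
def comulCoeff : Bool → Bool → Bool → ℤ
  | true, true, false => 1
  | true, false, true => 1
  | false, false, false => 1
  | _, _, _ => 0

namespace LinkDiagram

/-! ## Smoothings and enhanced states -/

/-- A set `α` of crossings is the complete smoothing with a 1-smoothing at the crossings in `α` and
a 0-smoothing at the others. The 0-smoothing of a crossing joins the end 0 to 1 and 2 to 3,
the 1-smoothing joins 0 to 3 and 1 to 2. -/
def joined (D : LinkDiagram) (α : Finset (Fin D.N)) (d : Fin D.N × Fin 4) : Fin D.N × Fin 4 :=
  if d.1 ∈ α then (d.1, ![3, 2, 1, 0] d.2) else (d.1, ![1, 0, 3, 2] d.2)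

/-- The circles of the complete smoothing `α`. -/
abbrev Circle (D : LinkDiagram) (α : Finset (Fin D.N)) : Type :=
  Quot (fun d e : Fin D.N × Fin 4 => e = D.arc d ∨ e = D.joined α d) ⊕ Fin D.loops

/-- The circle of the smoothing `α` that passes through a given end. -/
def circleOf (D : LinkDiagram) (α : Finset (Fin D.N)) (d : Fin D.N × Fin 4) : D.Circle α :=
  Sum.inl (Quot.mk _ d)

/-- An enhanced state: a complete smoothing with a label `v₊` (`true`) or `v₋` (`false`) on each
circle. The enhanced states on a smoothing `α` are the standard basis of the tensor power
`V^{⊗ k}`, where `k` is the number of circles of `α`. -/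
structure EnhancedState (D : LinkDiagram) where
  ones : Finset (Fin D.N)
  label : D.Circle ones → Bool

instance (D : LinkDiagram) : Finite D.EnhancedState :=
  Finite.of_injective
    (fun S => (⟨S.ones, S.label⟩ : Σ α : Finset (Fin D.N), (D.Circle α → Bool)))
    (by rintro ⟨a, f⟩ ⟨b, g⟩ h; cases h; rfl)

/-- The degree of an enhanced state in `V^{⊗ k}`, where `v₊` has degree `1` and `v₋` degree `-1`. -/
noncomputable def EnhancedState.deg {D : LinkDiagram} (S : D.EnhancedState) : ℤ :=
  (Nat.card {γ // S.label γ = true} : ℤ) - Nat.card {γ // S.label γ = false}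

open Classical in
/-- The coefficient of `T` in the image of `S` under the saddle map at the crossing `c`, where `c`
is 0-smoothed in `S` and 1-smoothed in `T`, and they agree at the other crossings: the
multiplication is used where two circles merge, the comultiplication where a circle splits, and the
labels of the circles away from `c` do not change. -/
noncomputable def saddleCoeff (D : LinkDiagram) (c : Fin D.N) (S T : D.EnhancedState) : ℤ :=
  let a := D.circleOf S.ones (c, 0)
  let b := D.circleOf S.ones (c, 2)
  let a' := D.circleOf T.ones (c, 0)
  let b' := D.circleOf T.ones (c, 2)
  if (∀ d, D.circleOf S.ones d ≠ a → D.circleOf S.ones d ≠ b →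
        S.label (D.circleOf S.ones d) = T.label (D.circleOf T.ones d)) ∧
      (∀ t : Fin D.loops, S.label (Sum.inr t) = T.label (Sum.inr t)) then
    if a ≠ b ∧ a' = b' then mulCoeff (S.label a) (S.label b) (T.label a')
    else if a = b ∧ a' ≠ b' then comulCoeff (S.label a) (T.label a') (T.label b')
    else 0
  else 0

open Classical in
/-- The unsigned incidence number of two enhanced states: `saddleCoeff` at `c`, if `T` arises from
`S` by changing the 0-smoothing of one crossing `c` to a 1-smoothing, and `0` otherwise. -/
noncomputable def incidence (D : LinkDiagram) (S T : D.EnhancedState) : ℤ :=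
  ∑ c : Fin D.N, if c ∉ S.ones ∧ T.ones = insert c S.ones then D.saddleCoeff c S T else 0

/-! ## The Khovanov complex of a partially resolved diagram

For disjoint sets `F` and `x` of crossings, the diagram obtained from `D` by keeping the crossings
in `F`, 1-smoothing those in `x`, and 0-smoothing all others, is referred to as `D_{F,x}`.
Its complete smoothings are the complete smoothings `α` of `D` with `α \ F = x`, and the rank of
such a smoothing is the cardinality of `α ∩ F`. The diagram `D` is `D_{univ,∅}`. -/

/-- The standard basis of the unnormalised Khovanov complex of `D_{F,x}` in homological degree `i`
and quantum degree `j`: the enhanced states with smoothing of rank `#F - i` whose degree, shifted by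
the rank, is `j`. -/
abbrev Gen (D : LinkDiagram) (F x : Finset (Fin D.N)) (i j : ℤ) : Type :=
  {S : D.EnhancedState // S.ones \ F = x ∧ ((S.ones ∩ F).card : ℤ) = F.card - i ∧
    S.deg + (S.ones ∩ F).card = j}

variable (R : Type u) [CommRing R]

/-- The Khovanov differential of `D_{F,x}`, from homological degree `i` to `i'`
(it vanishes unless `i' = i - 1`). -/
noncomputable def khD (D : LinkDiagram) (F x : Finset (Fin D.N)) (j i i' : ℤ) :
    (D.Gen F x i j →₀ R) →ₗ[R] (D.Gen F x i' j →₀ R) :=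
  matrixMap R fun S T =>
    edgeSign (S.1.ones ∩ F) (T.1.ones ∩ F) * D.incidence S.1 T.1

open Classical in
/-- The saddle map from the Khovanov complex of `D_{F,x}` in quantum degree `j` to that of `D_{F,y}`
in quantum degree `j'`, in homological degree `i`, where `y` consists of `x` and one further crossing
(it vanishes unless `j' = j - 1`). -/
noncomputable def saddle (D : LinkDiagram) (F x y : Finset (Fin D.N)) (j j' i : ℤ) :
    (D.Gen F x i j →₀ R) →ₗ[R] (D.Gen F y i j' →₀ R) :=
  matrixMap R fun S T => if x ⋖ y then D.incidence S.1 T.1 else 0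

/-- The Khovanov differentials square to zero, the saddle maps are chain maps, and
the saddle maps around a square commute. -/
structure IsKhovanovCube (D : LinkDiagram) : Prop where
  d_comp_d : ∀ F x j i i' i'', D.khD R F x j i' i'' ∘ₗ D.khD R F x j i i' = 0
  saddle_comp_d : ∀ F x y j j' i i',
    D.saddle R F x y j j' i' ∘ₗ D.khD R F x j i i' =
      D.khD R F y j' i i' ∘ₗ D.saddle R F x y j j' i
  saddle_comp_saddle : ∀ F x y y' z j j' j'' i, x ⋖ y → y ⋖ z → x ⋖ y' → y' ⋖ z →
    D.saddle R F y z j' j'' i ∘ₗ D.saddle R F x y j j' i =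
      D.saddle R F y' z j' j'' i ∘ₗ D.saddle R F x y' j j' i

variable {R} {D : LinkDiagram}

lemma exists_of_incidence_ne_zero {S T : D.EnhancedState} (h : D.incidence S T ≠ 0) :
    ∃ c, c ∉ S.ones ∧ T.ones = insert c S.ones := by
  by_contra! hc
  refine h (Finset.sum_eq_zero fun c _ => ?_)
  rw [if_neg]
  rintro ⟨h1, h2⟩
  exact hc c h1 h2

lemma khD_eq_zero (F x : Finset (Fin D.N)) (j i i' : ℤ) (h : i' + 1 ≠ i) :
    D.khD R F x j i i' = 0 := by
  have : (fun (S : D.Gen F x i j) (T : D.Gen F x i' j) =>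
      edgeSign (S.1.ones ∩ F) (T.1.ones ∩ F) * D.incidence S.1 T.1) = fun _ _ => 0 := by
    funext S T
    obtain ⟨S, hS1, hS2, -⟩ := S
    obtain ⟨T, hT1, hT2, -⟩ := T
    by_contra hne
    obtain ⟨c, hc, hT⟩ := exists_of_incidence_ne_zero (right_ne_zero_of_mul hne)
    have hcF : c ∈ F := by
      by_contra hcF
      have : c ∈ S.ones \ F := by
        rw [hS1, ← hT1, hT]; simp [hcF]
      exact hc (Finset.mem_sdiff.1 this).1
    rw [hT, Finset.insert_inter_of_mem hcF,
      Finset.card_insert_of_notMem (fun h => hc (Finset.mem_inter.1 h).1)] at hT2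
    push_cast at hT2
    omega
  rw [khD, this]
  ext a b
  simp [matrixMap]

namespace IsKhovanovCube

/-- The unnormalised Khovanov complex of `D_{F,x}` in quantum degree `j`. -/
noncomputable def complex (h : D.IsKhovanovCube R) (F x : Finset (Fin D.N)) (j : ℤ) :
    ChainComplex (ModuleCat.{u} R) ℤ where
  X i := ModuleCat.of R (D.Gen F x i j →₀ R)
  d i i' := ModuleCat.ofHom (D.khD R F x j i i')
  shape i i' hi := by rw [khD_eq_zero F x j i i' hi]; rfl
  d_comp_d' i i' i'' _ _ := by
    rw [← ModuleCat.ofHom_comp, h.d_comp_d]; rfl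

/-- The unnormalised Khovanov homology of `D_{F,x}` in homological degree `i` and quantum
degree `j`. -/
noncomputable def homology (h : D.IsKhovanovCube R) (F x : Finset (Fin D.N)) (i j : ℤ) :
    ModuleCat.{u} R :=
  (h.complex F x j).homology i

/-- The unnormalised Khovanov homology of `D`. -/
noncomputable def KH (h : D.IsKhovanovCube R) (i j : ℤ) : ModuleCat.{u} R :=
  h.homology Finset.univ ∅ i j

/-- The saddle map as a map of complexes. -/
noncomputable def saddleHom (h : D.IsKhovanovCube R) (F x y : Finset (Fin D.N)) (j j' : ℤ) :
    h.complex F x j ⟶ h.complex F y j' where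
  f i := ModuleCat.ofHom (D.saddle R F x y j j' i)
  comm' i i' _ := by
    change ModuleCat.ofHom _ ≫ ModuleCat.ofHom _ = ModuleCat.ofHom _ ≫ ModuleCat.ofHom _
    rw [← ModuleCat.ofHom_comp, ← ModuleCat.ofHom_comp, h.saddle_comp_d]

/-! ## Khovanov homology with respect to fixed crossings -/

/-- The bigraded module `V_{*,*}(x)` at the vertex `x` of the cube of the free crossings
(those not in `F`): the Khovanov homology of `D_{F,x}`, with the quantum degree shifted by the
rank of `x`. -/
noncomputable def vertex (h : D.IsKhovanovCube R) (F x : Finset (Fin D.N)) (q j : ℤ) :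
    ModuleCat.{u} R :=
  h.homology F x q (j - x.card)

/-- The map `V_{*,*}(x) ⟶ V_{*,*}(y)` induced by the saddle map, for an edge from `x` to `y` of the
cube of the free crossings (and zero if there is no such edge). -/
noncomputable def edge (h : D.IsKhovanovCube R) (F x y : Finset (Fin D.N)) (q j : ℤ) :
    h.vertex F x q j ⟶ h.vertex F y q j :=
  HomologicalComplex.homologyMap (h.saddleHom F x y (j - x.card) (j - y.card)) q

lemma edge_eq_zero (h : D.IsKhovanovCube R) (F x y : Finset (Fin D.N)) (q j : ℤ)
    (hxy : ¬ x ⋖ y) : h.edge F x y q j = 0 := by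
  have : h.saddleHom F x y (j - x.card) (j - y.card) = 0 := by
    ext i : 1
    change ModuleCat.ofHom (D.saddle R F x y (j - x.card) (j - y.card) i) = 0
    have h0 : D.saddle R F x y (j - x.card) (j - y.card) i = 0 := by
      ext a b
      simp [saddle, matrixMap, hxy]
    rw [h0]; rfl
  rw [edge, this]
  exact HomologicalComplex.homologyMap_zero _ _ _

lemma saddleHom_comp (h : D.IsKhovanovCube R) (F : Finset (Fin D.N)) {x y y' z : Finset (Fin D.N)}
    (h1 : x ⋖ y) (h2 : y ⋖ z) (h3 : x ⋖ y') (h4 : y' ⋖ z) (j j₁ j₂ j' : ℤ) (hj : j₁ = j₂) :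
    h.saddleHom F x y j j₁ ≫ h.saddleHom F y z j₁ j' =
      h.saddleHom F x y' j j₂ ≫ h.saddleHom F y' z j₂ j' := by
  subst hj
  ext i : 1
  change ModuleCat.ofHom _ ≫ ModuleCat.ofHom _ = ModuleCat.ofHom _ ≫ ModuleCat.ofHom _
  rw [← ModuleCat.ofHom_comp, ← ModuleCat.ofHom_comp, h.saddle_comp_saddle F x y y' z _ _ _ _ h1 h2 h3 h4]

lemma edge_comp_edge (h : D.IsKhovanovCube R) (F : Finset (Fin D.N)) {x y y' z : Finset (Fin D.N)}
    (q j : ℤ) (h1 : x ⋖ y) (h2 : y ⋖ z) (h3 : x ⋖ y') (h4 : y' ⋖ z) (hc : y.card = y'.card) :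
    h.edge F x y q j ≫ h.edge F y z q j = h.edge F x y' q j ≫ h.edge F y' z q j := by
  have e1 : h.edge F x y q j ≫ h.edge F y z q j = HomologicalComplex.homologyMap
      (h.saddleHom F x y (j - x.card) (j - y.card) ≫
        h.saddleHom F y z (j - y.card) (j - z.card)) q :=
    (HomologicalComplex.homologyMap_comp _ _ _).symm
  have e2 : h.edge F x y' q j ≫ h.edge F y' z q j = HomologicalComplex.homologyMap
      (h.saddleHom F x y' (j - x.card) (j - y'.card) ≫
        h.saddleHom F y' z (j - y'.card) (j - z.card)) q :=
    (HomologicalComplex.homologyMap_comp _ _ _).symm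
  rw [e1, e2, h.saddleHom_comp F h1 h2 h3 h4 _ _ _ _ (by rw [hc])]

/-- The vertices of the cube of the free crossings that contribute to homological degree `p`:
those of rank `ℓ - p`, where `ℓ` is the number of free crossings. -/
abbrev Vertex (F : Finset (Fin D.N)) (p : ℤ) : Type :=
  {x : Finset (Fin D.N) // Disjoint x F ∧ (x.card : ℤ) = (Fᶜ.card : ℤ) - p}

/-- The differential from degree `p` to `p'` of the complex built from the modules `V_{q,j}(x)`: the
signed sum of the maps along the edges of the cube of the free crossings. -/
noncomputable def kbarD (h : D.IsKhovanovCube R) (F : Finset (Fin D.N)) (q j p p' : ℤ) :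
    (⨁ fun x : Vertex F p => h.vertex F x.1 q j) ⟶ ⨁ fun x : Vertex F p' => h.vertex F x.1 q j :=
  biproduct.matrix fun x y => edgeSign x.1 y.1 • h.edge F x.1 y.1 q j

lemma kbarD_eq_zero (h : D.IsKhovanovCube R) (F : Finset (Fin D.N)) (q j p p' : ℤ)
    (hp : p' + 1 ≠ p) : h.kbarD F q j p p' = 0 := by
  unfold kbarD
  refine biproduct.hom_ext' _ _ fun x => biproduct.hom_ext _ _ fun y => ?_
  obtain ⟨x, -, hx⟩ := x
  obtain ⟨y, -, hy⟩ := y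
  have : ¬ x ⋖ y := by
    intro hxy
    obtain ⟨c, hc, rfl⟩ := Finset.covBy_iff_exists_insert.1 hxy
    rw [Finset.card_insert_of_notMem hc] at hy
    push_cast at hy
    omega
  simp [edge_eq_zero, this]

lemma edgeSign_insert {N : ℕ} {x : Finset (Fin N)} {c : Fin N} (hc : c ∉ x) :
    edgeSign x (insert c x) = (-1) ^ (x.filter (· < c)).card := by
  have : insert c x \ x = {c} := by
    ext a; simp only [Finset.mem_sdiff, Finset.mem_insert, Finset.mem_singleton]
    constructor
    · rintro ⟨rfl | h1, h2⟩
      · rfl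
      · exact absurd h1 h2
    · rintro rfl; exact ⟨Or.inl rfl, hc⟩
  simp [edgeSign, this]

lemma edgeSign_square_aux {N : ℕ} {x : Finset (Fin N)} {a b : Fin N} (ha : a ∉ x) (hb : b ∉ x)
    (hab : a < b) :
    edgeSign x (insert a x) * edgeSign (insert a x) (insert b (insert a x)) +
      edgeSign x (insert b x) * edgeSign (insert b x) (insert a (insert b x)) = 0 := by
  rw [edgeSign_insert ha, edgeSign_insert hb,
    edgeSign_insert (by simp [hb, hab.ne']), edgeSign_insert (by simp [ha, hab.ne]),
    Finset.filter_insert, Finset.filter_insert, if_pos hab, if_neg hab.not_gt,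
    Finset.card_insert_of_notMem (by simp [ha])]
  ring

lemma edgeSign_square {N : ℕ} {x : Finset (Fin N)} {a b : Fin N} (ha : a ∉ x) (hb : b ∉ x)
    (hab : a ≠ b) :
    edgeSign x (insert a x) * edgeSign (insert a x) (insert b (insert a x)) +
      edgeSign x (insert b x) * edgeSign (insert b x) (insert a (insert b x)) = 0 := by
  rcases lt_or_gt_of_ne hab with h | h
  · exact edgeSign_square_aux ha hb h
  · rw [add_comm]; exact edgeSign_square_aux hb ha h

lemma kbarD_comp_kbarD (h : D.IsKhovanovCube R) (F : Finset (Fin D.N)) (q j p p' p'' : ℤ) :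
    h.kbarD F q j p p' ≫ h.kbarD F q j p' p'' = 0 := by
  classical
  unfold kbarD
  refine biproduct.hom_ext' _ _ fun x => biproduct.hom_ext _ _ fun z => ?_
  rw [Category.assoc, Category.assoc, biproduct.ι_matrix_assoc, biproduct.matrix_π,
    biproduct.lift_desc]
  simp only [zero_comp, comp_zero, Preadditive.zsmul_comp, Preadditive.comp_zsmul, smul_smul]
  obtain ⟨x, hxF, hx⟩ := x
  obtain ⟨z, hzF, hz⟩ := z
  -- the two ways around a square cancel
  by_cases hsq : ∃ y : Vertex F p', x ⋖ y.1 ∧ y.1 ⋖ z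
  swap
  · refine Finset.sum_eq_zero fun y _ => ?_
    by_cases h1 : x ⋖ y.1
    · have h2 : ¬ y.1 ⋖ z := fun h2 => hsq ⟨y, h1, h2⟩
      simp [edge_eq_zero, h2]
    · simp [edge_eq_zero, h1]
  obtain ⟨⟨y, hyF, hy⟩, h1, h2⟩ := hsq
  obtain ⟨a, ha, rfl⟩ := Finset.covBy_iff_exists_insert.1 h1
  obtain ⟨b, hb, rfl⟩ := Finset.covBy_iff_exists_insert.1 h2
  simp only [Finset.mem_insert, not_or] at hb
  have h3 : x ⋖ insert b x := Finset.covBy_iff_exists_insert.2 ⟨b, hb.2, rfl⟩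
  have h4 : insert b x ⋖ insert b (insert a x) := Finset.covBy_iff_exists_insert.2
    ⟨a, by simp [ha, Ne.symm hb.1], Finset.insert_comm _ _ _⟩
  have hcard : (insert b x).card = (insert a x).card := by
    rw [Finset.card_insert_of_notMem hb.2, Finset.card_insert_of_notMem ha]
  let y' : Vertex F p' := ⟨insert b x, Disjoint.mono_left h4.le hzF, by rw [hcard, hy]⟩
  have hne : (⟨insert a x, hyF, hy⟩ : Vertex F p') ≠ y' := by
    intro e
    have e' : insert a x = insert b x := congrArg Subtype.val e
    have : b ∈ insert a x := e' ▸ Finset.mem_insert_self b x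
    simp [hb.1, hb.2] at this
  rw [← Finset.sum_subset (Finset.subset_univ {⟨insert a x, hyF, hy⟩, y'}), Finset.sum_pair hne]
  · change (_ : ℤ) • (h.edge F x (insert a x) q j ≫ h.edge F (insert a x) _ q j) +
      (_ : ℤ) • (h.edge F x (insert b x) q j ≫ h.edge F (insert b x) _ q j) = 0
    rw [h.edge_comp_edge F q j h3 h4 h1 h2 hcard, ← add_smul]
    have := edgeSign_square ha hb.2 (Ne.symm hb.1)
    rw [Finset.insert_comm a b x, mul_comm, mul_comm (edgeSign x (insert b x))] at this
    rw [this, zero_smul]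
  · rintro ⟨w, hwF, hw⟩ - hwn
    by_cases hw1 : x ⋖ w
    · by_cases hw2 : w ⋖ insert b (insert a x)
      · exfalso
        obtain ⟨c, hc, rfl⟩ := Finset.covBy_iff_exists_insert.1 hw1
        have : c ∈ insert b (insert a x) := hw2.le (Finset.mem_insert_self c x)
        simp only [Finset.mem_insert] at this
        rcases this with rfl | rfl | h5
        · exact hwn (by simp [y'])
        · exact hwn (by simp)
        · exact hc h5
      · simp [edge_eq_zero, hw2]
    · simp [edge_eq_zero, hw1]

/-- The complex built from the modules `V_{q,j}(x)`, for fixed `q` and `j`, by the construction of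
the Khovanov complex: in degree `p` it is the direct sum of the `V_{q,j}(x)` over the vertices `x`
of rank `ℓ - p` of the cube of the free crossings. -/
noncomputable def kbar (h : D.IsKhovanovCube R) (F : Finset (Fin D.N)) (q j : ℤ) :
    ChainComplex (ModuleCat.{u} R) ℤ where
  X p := ⨁ fun x : Vertex F p => h.vertex F x.1 q j
  d p p' := h.kbarD F q j p p'
  shape p p' hp := h.kbarD_eq_zero F q j p p' hp
  d_comp_d' p p' p'' _ _ := h.kbarD_comp_kbarD F q j p p' p''

/-- The Khovanov homology of `D` with respect to the set `F` of fixed crossings. -/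
noncomputable def fixedKH (h : D.IsKhovanovCube R) (F : Finset (Fin D.N)) (p q j : ℤ) :
    ModuleCat.{u} R :=
  (h.kbar F q j).homology p

end IsKhovanovCube
end LinkDiagram

/-! ## Spectral sequences -/

/-- Homological spectral sequences of `R`-modules that start at the second page; the differential of
the page `r` has bidegree `(-r, r - 1)`. -/
abbrev HomologicalSpectralSequence (R : Type u) [CommRing R] :=
  SpectralSequence (ModuleCat.{u} R) (fun r => ComplexShape.up' ((-r, r - 1) : ℤ × ℤ)) 2

/-- The spectral sequence `E` converges to the graded module `H`: each `H n` has a finite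
increasing filtration `Fil n`, and for each `(p, q)` there is a page from which on all differentials
into and out of the position `(p, q)` vanish, and the (then stationary) module `E^r_{p,q} = E^∞_{p,q}`
is isomorphic to the subquotient `Fil_p H_{p+q} / Fil_{p-1} H_{p+q}`. -/
def HomologicalSpectralSequence.ConvergesTo {R : Type u} [CommRing R]
    (E : HomologicalSpectralSequence R) (H : ℤ → ModuleCat.{u} R) : Prop :=
  ∃ Fil : ∀ n : ℤ, ℤ → Submodule R (H n),
    (∀ n, Monotone (Fil n)) ∧
    (∀ n, ∃ a, Fil n a = ⊥) ∧ (∀ n, ∃ b, Fil n b = ⊤) ∧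
    ∀ p q : ℤ, ∃ r₀ : ℤ, 2 ≤ r₀ ∧ ∀ (r : ℤ) (hr : 2 ≤ r), r₀ ≤ r →
      (∀ s, (E.page r hr).d s (p, q) = 0) ∧ (∀ s, (E.page r hr).d (p, q) s = 0) ∧
      Nonempty ((E.page r hr).X (p, q) ≃ₗ[R]
        (Fil (p + q) p) ⧸ (Fil (p + q) (p - 1)).submoduleOf (Fil (p + q) p))

/-! Filter the Khovanov complex of `D` by the number `p` of free crossings that are 0-smoothed. The
differential turns 0-smoothings into 1-smoothings, so it respects this filtration, and `p` runs only
from `0` to the number of free crossings. The `p`-th graded piece is the direct sum of the complexes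
of the `D_{F,x}` over the vertices `x` of rank `ℓ - p`. Hence the first page consists of the sums of
the modules `V_{q,i}(x)`, its differential is induced by the saddle maps, and the second page is the
homology of `kbar`. A finite filtration gives convergence. The map `toKbar` carries the comparison
on the first page (`toKbar_eq_zero_iff`, `toKbar_surjective`, `kbarD_toKbar`), and
`nonempty_equiv_homology` passes to the second.

Signs: the edge signs of the full cube are not those of the cubes of the fixed and of the free
crossings. Rescaling each state by `shuffleSign` makes them agree up to the factor `(-1) ^ (#F - q)`
on the free edges. That factor is constant along a row of the first page, so it does not change the
homology.

The cube itself: that the squares commute depends on planarity, because on other surfaces a change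
of smoothing can turn one circle into one circle. Euler's formula makes the mod 2 complex of faces,
arcs and crossings exact at the arcs, so the faces have a checkerboard colouring. The colouring
orients the arcs so that every smoothing joins sources to sinks. Circles are then cycles of a
permutation, a change of smoothing multiplies it by a transposition, and so two circles merge or one
splits (`merges_or_merges`).

For squares of saddles, `V^{⊗ k}` is a cyclic module over the algebra generated by the
multiplications by `v₋` at points of the diagram, and the saddle maps are linear over it. It is
enough to compare the images of `1`: a merge sends `1` to `1`, a split sends it to the sum of the
two `v₋`-multiplications applied to `1` (`saddleMatrix_mul_saddleMatrix`). -/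

/-! ## Colouring the faces of a planar diagram -/

namespace LinkDiagram

/-- The two ends of an arc are identified. -/
def arcSetoid (D : LinkDiagram) : Setoid (Fin D.N × Fin 4) where
  r d e := e = d ∨ e = D.arc d
  iseqv :=
    { refl := fun _ => Or.inl rfl
      symm := by
        rintro d e (rfl | rfl)
        · exact Or.inl rfl
        · exact Or.inr (D.arc_arc d).symm
      trans := by
        rintro d e f (rfl | rfl) (rfl | rfl)
        · exact Or.inl rfl
        · exact Or.inr rfl
        · exact Or.inr rfl
        · exact Or.inl (D.arc_arc d) }

/-- The arcs of a diagram. -/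
abbrev Arc (D : LinkDiagram) : Type := Quotient D.arcSetoid

noncomputable instance (D : LinkDiagram) : Fintype D.Arc := Fintype.ofFinite _

lemma arc_mk_eq_iff (D : LinkDiagram) (d e : Fin D.N × Fin 4) :
    (Quotient.mk D.arcSetoid e = Quotient.mk D.arcSetoid d) ↔ e = d ∨ e = D.arc d := by
  rw [eq_comm, Quotient.eq]
  rfl

open Classical in
lemma sum_arc_mk_eq (D : LinkDiagram) {M : Type*} [AddCommMonoid M]
    (f : Fin D.N × Fin 4 → M) (d : Fin D.N × Fin 4) :
    (∑ e, if Quotient.mk D.arcSetoid e = Quotient.mk D.arcSetoid d then f e else 0) =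
      f d + f (D.arc d) := by
  rw [← Finset.sum_filter, ← Finset.sum_pair (D.arc_ne d).symm]
  refine Finset.sum_congr ?_ fun _ _ => rfl
  ext e
  simp [arc_mk_eq_iff]

lemma card_arc (D : LinkDiagram) : Nat.card D.Arc = 2 * D.N := by
  classical
  have h1 : ∑ q : D.Arc, ∑ e : Fin D.N × Fin 4,
      (if Quotient.mk D.arcSetoid e = q then 1 else 0) = 4 * D.N := by
    rw [Finset.sum_comm]
    simp [mul_comm]
  have h2 : ∀ q : D.Arc, ∑ e : Fin D.N × Fin 4,
      (if Quotient.mk D.arcSetoid e = q then 1 else 0) = 2 := by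
    intro q
    induction q using Quotient.inductionOn with
    | h d => exact D.sum_arc_mk_eq (fun _ => 1) d
  simp only [h2] at h1
  simp only [Finset.sum_const, Finset.card_univ, smul_eq_mul] at h1
  rw [Nat.card_eq_fintype_card]
  omega

lemma face_mk_arc (D : LinkDiagram) (d : Fin D.N × Fin 4) :
    Quot.mk (FaceRel D.arc) (D.arc d) = Quot.mk (FaceRel D.arc) (d.1, d.2 + 1) :=
  Quot.sound (by simp [FaceRel, D.arc_arc])

/-- The sum of the values of a mod 2 function on the two faces at an arc. -/
def faceBoundary (D : LinkDiagram) :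
    (Quot (FaceRel D.arc) → ZMod 2) →ₗ[ZMod 2] (D.Arc → ZMod 2) where
  toFun f := Quotient.lift (fun d => f (Quot.mk _ d) + f (Quot.mk _ (D.arc d))) (by
    rintro d e (rfl | rfl)
    · rfl
    · rw [D.arc_arc, add_comm])
  map_add' f g := by
    ext q
    induction q using Quotient.inductionOn with
    | h d => simp only [Quotient.lift_mk, Pi.add_apply]; ring
  map_smul' a f := by
    ext q
    induction q using Quotient.inductionOn with
    | h d => simp only [Quotient.lift_mk, Pi.smul_apply, smul_eq_mul, RingHom.id_apply]; ring

lemma faceBoundary_mk (D : LinkDiagram) (f : Quot (FaceRel D.arc) → ZMod 2)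
    (d : Fin D.N × Fin 4) :
    D.faceBoundary f (Quotient.mk _ d) = f (Quot.mk _ d) + f (Quot.mk _ (D.arc d)) := rfl

open Classical in
/-- The mod 2 incidence matrix of the underlying 4-valent graph. -/
noncomputable def arcIncidence (D : LinkDiagram) : Matrix (Fin D.N) D.Arc (ZMod 2) :=
  fun c q => ∑ k : Fin 4, if Quotient.mk D.arcSetoid (c, k) = q then 1 else 0

lemma arcIncidence_mulVec (D : LinkDiagram) (g : D.Arc → ZMod 2) (c : Fin D.N) :
    D.arcIncidence.mulVec g c = ∑ k : Fin 4, g (Quotient.mk _ (c, k)) := by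
  classical
  simp only [Matrix.mulVec, dotProduct, arcIncidence, Finset.sum_mul]
  rw [Finset.sum_comm]
  simp

lemma arcIncidence_transpose_mulVec (D : LinkDiagram) (h : Fin D.N → ZMod 2)
    (d : Fin D.N × Fin 4) :
    D.arcIncidence.transpose.mulVec h (Quotient.mk _ d) = h d.1 + h (D.arc d).1 := by
  classical
  rw [← D.sum_arc_mk_eq (fun e => h e.1) d, Fintype.sum_prod_type]
  simp only [Matrix.mulVec, dotProduct, arcIncidence, Finset.sum_mul, Matrix.transpose_apply,
    ite_mul, one_mul, zero_mul]

lemma zmod_two_add_eq_zero {a b : ZMod 2} : a + b = 0 ↔ a = b := by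
  revert a b; decide

/-- A function in the kernel takes equal values on the two sides of every arc. Neighbouring corners
at a crossing are separated by an arc, so the function is constant on connected components. -/
lemma finrank_ker_faceBoundary_le (D : LinkDiagram) :
    Module.finrank (ZMod 2) (LinearMap.ker D.faceBoundary) ≤
      Nat.card (Quot (ComponentRel D.arc)) := by
  classical
  have : Fintype (Quot (ComponentRel D.arc)) := Fintype.ofFinite _
  have hcomp : ∀ d e, FaceRel D.arc d e →
      Quot.mk (ComponentRel D.arc) d = Quot.mk (ComponentRel D.arc) e := by
    rintro d e h
    have h1 : ComponentRel D.arc d (D.arc d) := Or.inl rfl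
    have h2 : ComponentRel D.arc (D.arc d) e := Or.inr h
    exact (Quot.sound h1).trans (Quot.sound h2)
  let P : (Quot (ComponentRel D.arc) → ZMod 2) →ₗ[ZMod 2] (Quot (FaceRel D.arc) → ZMod 2) :=
    LinearMap.funLeft _ _ (Quot.lift (Quot.mk _) hcomp)
  have hP : LinearMap.ker D.faceBoundary ≤ LinearMap.range P := by
    intro f hf
    have h1 : ∀ d, f (Quot.mk _ d) = f (Quot.mk _ (D.arc d)) := fun d =>
      zmod_two_add_eq_zero.1 (by rw [← faceBoundary_mk, LinearMap.mem_ker.1 hf]; rfl)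
    refine ⟨Quot.lift (fun d => f (Quot.mk _ d)) ?_, ?_⟩
    · rintro d e (rfl | rfl)
      · exact h1 d
      · exact (h1 d).trans (congrArg f (D.face_mk_arc d))
    · ext q
      induction q using Quot.inductionOn with
      | h d => rfl
  calc _ ≤ Module.finrank (ZMod 2) (LinearMap.range P) := Submodule.finrank_mono hP
    _ ≤ Module.finrank (ZMod 2) (Quot (ComponentRel D.arc) → ZMod 2) := LinearMap.finrank_range_le P
    _ = _ := by rw [Module.finrank_fintype_fun_eq_card, Nat.card_eq_fintype_card]

/-- A function in the kernel agrees at the two crossings of each arc, so it factors through the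
connected components. -/
lemma finrank_ker_arcIncidence_transpose_le (D : LinkDiagram) :
    Module.finrank (ZMod 2) (LinearMap.ker D.arcIncidence.transpose.mulVecLin) ≤
      Nat.card (Quot (ComponentRel D.arc)) := by
  classical
  have : Fintype (Quot (ComponentRel D.arc)) := Fintype.ofFinite _
  let P : (Quot (ComponentRel D.arc) → ZMod 2) →ₗ[ZMod 2] (Fin D.N → ZMod 2) :=
    LinearMap.funLeft _ _ (fun c => Quot.mk _ (c, 0))
  have hP : LinearMap.ker D.arcIncidence.transpose.mulVecLin ≤ LinearMap.range P := by
    intro f hf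
    have h1 : ∀ d, f d.1 = f (D.arc d).1 := fun d =>
      zmod_two_add_eq_zero.1 (by
        rw [← arcIncidence_transpose_mulVec]
        exact congrFun (LinearMap.mem_ker.1 hf) _)
    refine ⟨Quot.lift (fun d => f d.1) ?_, rfl⟩
    rintro d e (rfl | rfl)
    · exact h1 d
    · rfl
  calc _ ≤ Module.finrank (ZMod 2) (LinearMap.range P) := Submodule.finrank_mono hP
    _ ≤ Module.finrank (ZMod 2) (Quot (ComponentRel D.arc) → ZMod 2) := LinearMap.finrank_range_le P
    _ = _ := by rw [Module.finrank_fintype_fun_eq_card, Nat.card_eq_fintype_card]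

/-- This is the vanishing of the first mod 2 homology of the sphere, deduced from Euler's formula by
counting dimensions. -/
lemma range_faceBoundary (D : LinkDiagram) :
    LinearMap.range D.faceBoundary = LinearMap.ker D.arcIncidence.mulVecLin := by
  classical
  have : Fintype (Quot (FaceRel D.arc)) := Fintype.ofFinite _
  apply Submodule.eq_of_le_of_finrank_le
  · rintro _ ⟨f, rfl⟩
    rw [LinearMap.mem_ker]
    ext c
    rw [Matrix.mulVecLin_apply, arcIncidence_mulVec]
    -- The arc at `(c, k)` separates the faces of `(c, k)` and `(c, k + 1)`; going around `c`, each
    -- corner is counted twice.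
    simp only [faceBoundary_mk, face_mk_arc, Fin.sum_univ_four, Pi.zero_apply]
    have h2 : ∀ a b c d : ZMod 2, a + b + (b + c) + (c + d) + (d + a) = 0 := by decide
    exact h2 _ _ _ _
  -- With `C` components the image has dimension at least `(N + 2C) - C = N + C`. The incidence
  -- matrix has rank at least `N - C`, so its kernel has dimension at most `2N - (N - C) = N + C`.
  · have h1 := LinearMap.finrank_range_add_finrank_ker D.faceBoundary
    have h2 := LinearMap.finrank_range_add_finrank_ker D.arcIncidence.mulVecLin
    have h3 := LinearMap.finrank_range_add_finrank_ker D.arcIncidence.transpose.mulVecLin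
    have h4 : Module.finrank (ZMod 2) (LinearMap.range D.arcIncidence.transpose.mulVecLin) =
        Module.finrank (ZMod 2) (LinearMap.range D.arcIncidence.mulVecLin) :=
      Matrix.rank_transpose _
    have h5 := D.finrank_ker_faceBoundary_le
    have h6 := D.finrank_ker_arcIncidence_transpose_le
    have h7 := D.planar
    have h8 := D.card_arc
    rw [Nat.card_eq_fintype_card] at h7 h8
    rw [Module.finrank_fintype_fun_eq_card] at h1 h2 h3
    rw [Fintype.card_fin] at h3
    omega

/-- The ends of a planar diagram have a source-sink orientation: each arc runs from a source end to
a sink end, and sources and sinks alternate around each crossing. -/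
theorem exists_orientation (D : LinkDiagram) :
    ∃ s : Fin D.N × Fin 4 → ZMod 2, (∀ d, s (D.arc d) = s d + 1) ∧
      ∀ d, s (d.1, d.2 + 1) = s d + 1 := by
  -- Every crossing has an even number of ends, so the sum of all arcs is a cycle. A function on the
  -- faces with this boundary is a checkerboard colouring.
  have h : (fun _ => 1 : D.Arc → ZMod 2) ∈ LinearMap.range D.faceBoundary := by
    rw [range_faceBoundary, LinearMap.mem_ker]
    ext c
    rw [Matrix.mulVecLin_apply, arcIncidence_mulVec]
    simp only [Finset.sum_const, Finset.card_univ, Fintype.card_fin, Pi.zero_apply]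
    exact (by decide : (4 : ℕ) • (1 : ZMod 2) = 0)
  obtain ⟨f, hf⟩ := h
  have h1 : ∀ d, f (Quot.mk _ (D.arc d)) = f (Quot.mk _ d) + 1 := by
    intro d
    have h2 : f (Quot.mk _ d) + f (Quot.mk _ (D.arc d)) = 1 := by
      rw [← faceBoundary_mk, hf]
    have h3 : ∀ a b : ZMod 2, a + b = 1 → b = a + 1 := by decide
    exact h3 _ _ h2
  exact ⟨fun d => f (Quot.mk _ d), h1, fun d => (congrArg f (D.face_mk_arc d)).symm.trans (h1 d)⟩

end LinkDiagram

/-! ## Merging two circles -/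

namespace Equiv.Perm

/-- The orbit of `p` closes up after `j` steps, so exponents may be reduced modulo `j`. -/
lemma not_sameCycle_of_pow_eq {X : Type*} [Finite X] {σ : Perm X} {p q : X} {j : ℕ} (hj : 0 < j) (hp : (σ ^ j) p = p)
    (hq : ∀ i < j, (σ ^ i) p ≠ q) : ¬ σ.SameCycle p q := by
  intro h
  obtain ⟨i, hi⟩ := h.exists_nat_pow_eq
  refine hq (i % j) (Nat.mod_lt _ hj) ?_
  have h2 : ∀ m : ℕ, ((σ ^ j) ^ m) p = p := fun m => by
    induction m with
    | zero => rfl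
    | succ m ih => rw [pow_succ, Perm.mul_apply, hp, ih]
  rw [← hi]
  conv_rhs => rw [← Nat.mod_add_div i j, pow_add, pow_mul, Perm.mul_apply, h2]

/-- Multiplication by a transposition splits a cycle or joins two cycles. -/
lemma sameCycle_swap_mul_iff {X : Type*} [Finite X] [DecidableEq X] (σ : Perm X) {p q : X} (hpq : p ≠ q) :
    (Equiv.swap p q * σ).SameCycle p q ↔ ¬ σ.SameCycle p q := by
  classical
  -- The least such `j` is the first time at which `σ` brings `p` back to `{p, q}`. Until then both
  -- permutations follow the same path from `p`; at time `j` the transposition exchanges the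
  -- outcomes `p` and `q`.
  have hex : ∃ j, 0 < j ∧ ((σ ^ j) p = p ∨ (σ ^ j) p = q) := by
    obtain ⟨n, hn, h⟩ := (isOfFinOrder_of_finite σ).exists_pow_eq_one
    exact ⟨n, hn, Or.inl (by rw [h]; rfl)⟩
  obtain ⟨hj0, hj⟩ := Nat.find_spec hex
  set j := Nat.find hex
  have hmin : ∀ i < j, 0 < i → (σ ^ i) p ≠ p ∧ (σ ^ i) p ≠ q := fun i hi h0 => by
    have := Nat.find_min hex hi
    tauto
  have hpow : ∀ i < j, ((Equiv.swap p q * σ) ^ i) p = (σ ^ i) p := by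
    intro i
    induction i with
    | zero => intro _; rfl
    | succ i ih =>
      intro hi
      obtain ⟨h1, h2⟩ := hmin (i + 1) hi (Nat.succ_pos _)
      rw [pow_succ', Perm.mul_apply, ih (by omega), Perm.mul_apply, ← Perm.mul_apply σ,
        ← pow_succ', Equiv.swap_apply_of_ne_of_ne h1 h2]
  have hpowj : ((Equiv.swap p q * σ) ^ j) p = Equiv.swap p q ((σ ^ j) p) := by
    obtain ⟨i, hi⟩ : ∃ i, j = i + 1 := ⟨j - 1, by omega⟩
    rw [hi, pow_succ', Perm.mul_apply, hpow i (by omega), Perm.mul_apply, ← Perm.mul_apply σ,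
      ← pow_succ']
  have hlt : ∀ i < j, (σ ^ i) p ≠ q := fun i hi => by
    rcases Nat.eq_zero_or_pos i with rfl | h0
    · exact hpq
    · exact (hmin i hi h0).2
  rcases hj with h | h
  · refine iff_of_true ⟨j, ?_⟩ (not_sameCycle_of_pow_eq hj0 h hlt)
    rw [zpow_natCast, hpowj, h, Equiv.swap_apply_left]
  · refine iff_of_false (not_sameCycle_of_pow_eq hj0 ?_ fun i hi => ?_) (not_not.2 ⟨j, ?_⟩)
    · rw [hpowj, h, Equiv.swap_apply_right]
    · rw [hpow i hi]; exact hlt i hi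
    · rw [zpow_natCast, h]

end Equiv.Perm

/-- The points `y` and `z` have the same image under `π` once the images of `p` and `q` are
identified. -/
def JoinRel {Y C : Type*} (π : Y → C) (p q y z : Y) : Prop :=
  π y = π z ∨ ((π y = π p ∨ π y = π q) ∧ (π z = π p ∨ π z = π q))

lemma JoinRel.equivalence {Y C : Type*} (π : Y → C) (p q : Y) : Equivalence (JoinRel π p q) where
  refl _ := Or.inl rfl
  symm := by
    rintro y z (h | ⟨h1, h2⟩)
    · exact Or.inl h.symm
    · exact Or.inr ⟨h2, h1⟩
  trans := by
    rintro x y z (h | ⟨h1, h2⟩) (h' | ⟨h3, h4⟩)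
    · exact Or.inl (h.trans h')
    · exact Or.inr ⟨by rwa [h], h4⟩
    · exact Or.inr ⟨h1, by rwa [← h']⟩
    · exact Or.inr ⟨h1, h4⟩

lemma joinRel_left_iff {Y C : Type*} {π : Y → C} {p q y : Y} :
    JoinRel π p q y p ↔ π y = π p ∨ π y = π q := by
  unfold JoinRel; tauto

lemma joinRel_right_iff {Y C : Type*} {π : Y → C} {p q y : Y} :
    JoinRel π p q y q ↔ π y = π p ∨ π y = π q := by
  unfold JoinRel; tauto

/-- The map `π'` is obtained from `π` by identifying the distinct images of `p` and `q`. -/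
structure Merges {Y C C' : Type*} (π : Y → C) (π' : Y → C') (p q : Y) : Prop where
  ne : π p ≠ π q
  eq_iff : ∀ y z, π' y = π' z ↔ JoinRel π p q y z

lemma Merges.eq {Y C C' : Type*} {π : Y → C} {π' : Y → C'} {p q : Y} (h : Merges π π' p q) :
    π' p = π' q := (h.eq_iff p q).2 (Or.inr ⟨Or.inl rfl, Or.inr rfl⟩)

lemma Merges.eq_of_eq {Y C C' : Type*} {π : Y → C} {π' : Y → C'} {p q : Y} (h : Merges π π' p q)
    {y z : Y} (e : π y = π z) : π' y = π' z := (h.eq_iff y z).2 (Or.inl e)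

namespace LinkDiagram

/-- The ends of the arcs and the components without crossings. -/
abbrev Point (D : LinkDiagram) : Type := (Fin D.N × Fin 4) ⊕ Fin D.loops

/-- The circle of the smoothing `α` through a point. -/
def circleAt (D : LinkDiagram) (α : Finset (Fin D.N)) : D.Point → D.Circle α :=
  Sum.map (Quot.mk _) id

lemma circleAt_surjective (D : LinkDiagram) (α : Finset (Fin D.N)) :
    Function.Surjective (D.circleAt α) :=
  Sum.map_surjective.2 ⟨Quot.mk_surjective, Function.surjective_id⟩

lemma circleAt_arc (D : LinkDiagram) (α : Finset (Fin D.N)) (d : Fin D.N × Fin 4) :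
    D.circleAt α (Sum.inl (D.arc d)) = D.circleAt α (Sum.inl d) := by
  refine congrArg Sum.inl (Eq.symm (Quot.sound ?_))
  exact Or.inl rfl

lemma circleAt_joined (D : LinkDiagram) (α : Finset (Fin D.N)) (d : Fin D.N × Fin 4) :
    D.circleAt α (Sum.inl (D.joined α d)) = D.circleAt α (Sum.inl d) := by
  refine congrArg Sum.inl (Eq.symm (Quot.sound ?_))
  exact Or.inr rfl

lemma joined_joined (D : LinkDiagram) (α : Finset (Fin D.N)) (d : Fin D.N × Fin 4) :
    D.joined α (D.joined α d) = d := by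
  obtain ⟨c, k⟩ := d
  by_cases h : c ∈ α <;> fin_cases k <;> simp [joined, h]

/-- No smoothing joins the ends 0 and 2 to each other, so each of the other two ends is joined to
one of them. -/
lemma circleAt_crossing (D : LinkDiagram) (α : Finset (Fin D.N)) (c : Fin D.N) (k : Fin 4) :
    D.circleAt α (Sum.inl (c, k)) = D.circleAt α (Sum.inl (c, 0)) ∨
      D.circleAt α (Sum.inl (c, k)) = D.circleAt α (Sum.inl (c, 2)) := by
  have h0 := D.circleAt_joined α (c, 0)
  have h2 := D.circleAt_joined α (c, 2)
  by_cases h : c ∈ α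
  · simp only [joined, h, if_true] at h0 h2
    fin_cases k
    · exact Or.inl rfl
    · exact Or.inr h2
    · exact Or.inr rfl
    · exact Or.inl h0
  · simp only [joined, h, if_false] at h0 h2
    fin_cases k
    · exact Or.inl rfl
    · exact Or.inl h0
    · exact Or.inr rfl
    · exact Or.inr h2

/-- The smoothings differ only in the pairing at `c`, and all four ends at `c` lie on the circles
through `(c, 0)` and `(c, 2)`. Once these circles are identified the pairing at `c` is immaterial.
-/
lemma joinRel_of_circleAt_eq (D : LinkDiagram) {α β : Finset (Fin D.N)} {c : Fin D.N}
    (h : ∀ b, b ≠ c → (b ∈ α ↔ b ∈ β)) {y z : D.Point} (hyz : D.circleAt β y = D.circleAt β z) :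
    JoinRel (D.circleAt α) (Sum.inl (c, 0)) (Sum.inl (c, 2)) y z := by
  have heq := JoinRel.equivalence (D.circleAt α) (Sum.inl (c, 0)) (Sum.inl (c, 2))
  rcases y with y | y <;> rcases z with z | z
  · have h1 := Quot.eqvGen_exact (Sum.inl.inj hyz)
    clear hyz
    induction h1 with
    | rel d e h =>
      rcases h with rfl | rfl
      · exact Or.inl (D.circleAt_arc α d).symm
      · obtain ⟨b, k⟩ := d
        by_cases hb : b = c
        · subst hb
          have h1 : (D.joined β (b, k)).1 = b := by unfold joined; split_ifs <;> rfl
          have h2 := D.circleAt_crossing α b (D.joined β (b, k)).2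
          rw [← show D.joined β (b, k) = (b, (D.joined β (b, k)).2) from Prod.ext h1 rfl] at h2
          exact Or.inr ⟨D.circleAt_crossing α b k, h2⟩
        · have : D.joined β (b, k) = D.joined α (b, k) := by simp [joined, h b hb]
          rw [this]
          exact Or.inl (D.circleAt_joined α _).symm
    | refl d => exact heq.refl _
    | symm d e _ ih => exact heq.symm (ih)
    | trans d e f _ _ ih1 ih2 => exact heq.trans ih1 ih2
  · simp [circleAt] at hyz
  · simp [circleAt] at hyz
  · simp only [circleAt, Sum.map_inr, id, Sum.inr.injEq] at hyz
    subst hyz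
    exact heq.refl _

lemma joinRel_congr (D : LinkDiagram) {α β : Finset (Fin D.N)} {c : Fin D.N}
    (h : ∀ b, b ≠ c → (b ∈ α ↔ b ∈ β)) {y z : D.Point}
    (hyz : JoinRel (D.circleAt β) (Sum.inl (c, 0)) (Sum.inl (c, 2)) y z) :
    JoinRel (D.circleAt α) (Sum.inl (c, 0)) (Sum.inl (c, 2)) y z := by
  have ht : ∀ y, (D.circleAt β y = D.circleAt β (Sum.inl (c, 0)) ∨
      D.circleAt β y = D.circleAt β (Sum.inl (c, 2))) →
      (D.circleAt α y = D.circleAt α (Sum.inl (c, 0)) ∨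
        D.circleAt α y = D.circleAt α (Sum.inl (c, 2))) := by
    rintro y (hy | hy)
    · exact joinRel_left_iff.1 (D.joinRel_of_circleAt_eq h hy)
    · exact joinRel_right_iff.1 (D.joinRel_of_circleAt_eq h hy)
  rcases hyz with hyz | ⟨h1, h2⟩
  · exact D.joinRel_of_circleAt_eq h hyz
  · exact Or.inr ⟨ht _ h1, ht _ h2⟩

/-- A source-sink orientation: the ends with value `0` are sources, the others are sinks. -/
structure IsOrientation (D : LinkDiagram) (s : Fin D.N × Fin 4 → ZMod 2) : Prop where
  arc : ∀ d, s (D.arc d) = s d + 1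
  next : ∀ c k, s (c, k + 1) = s (c, k) + 1

lemma zmod_two_ne_zero_iff {a : ZMod 2} : a ≠ 0 ↔ a + 1 = 0 := by
  revert a; decide

lemma zmod_two_one_add_one : (1 : ZMod 2) + 1 = 0 := by decide

lemma zmod_two_add_one_add_one (a : ZMod 2) : a + 1 + 1 = a := by
  revert a; decide

namespace IsOrientation

variable {D : LinkDiagram} {s : Fin D.N × Fin 4 → ZMod 2}

/-- Both smoothings pair cyclically neighbouring ends, and these have opposite types. -/
lemma joined (hs : D.IsOrientation s) (α : Finset (Fin D.N)) (d : Fin D.N × Fin 4) :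
    s (D.joined α d) = s d + 1 := by
  obtain ⟨c, k⟩ := d
  have h1 : s (c, 1) = s (c, 0) + 1 := hs.next c 0
  have h2 : s (c, 2) = s (c, 1) + 1 := hs.next c 1
  have h3 : s (c, 3) = s (c, 2) + 1 := hs.next c 2
  by_cases h : c ∈ α <;> fin_cases k <;>
    simp [LinkDiagram.joined, h, h1, h2, h3, zmod_two_add_one_add_one]

/-- The permutation that sends a source to the next source on its circle, and fixes the sinks. -/
def walk (hs : D.IsOrientation s) (α : Finset (Fin D.N)) : Equiv.Perm (Fin D.N × Fin 4) where
  toFun d := if s d = 0 then D.joined α (D.arc d) else d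
  invFun d := if s d = 0 then D.arc (D.joined α d) else d
  left_inv d := by
    by_cases h : s d = 0
    · simp [h, hs.joined, hs.arc, zmod_two_one_add_one, joined_joined, D.arc_arc]
    · simp [h]
  right_inv d := by
    by_cases h : s d = 0
    · simp [h, hs.joined, hs.arc, zmod_two_one_add_one, joined_joined, D.arc_arc]
    · simp [h]

lemma walk_apply (hs : D.IsOrientation s) (α : Finset (Fin D.N)) (d : Fin D.N × Fin 4) :
    hs.walk α d = if s d = 0 then D.joined α (D.arc d) else d := rfl

end IsOrientation

/-- The source on the arc at `d`. -/
def source (D : LinkDiagram) (s : Fin D.N × Fin 4 → ZMod 2) (d : Fin D.N × Fin 4) :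
    Fin D.N × Fin 4 :=
  if s d = 0 then d else D.arc d

lemma circleAt_source (D : LinkDiagram) (s : Fin D.N × Fin 4 → ZMod 2) (α : Finset (Fin D.N))
    (d : Fin D.N × Fin 4) :
    D.circleAt α (Sum.inl (D.source s d)) = D.circleAt α (Sum.inl d) := by
  unfold source
  split_ifs
  · rfl
  · exact D.circleAt_arc α d

namespace IsOrientation

variable {D : LinkDiagram} {s : Fin D.N × Fin 4 → ZMod 2}

lemma source_arc (hs : D.IsOrientation s) (d : Fin D.N × Fin 4) :
    D.source s (D.arc d) = D.source s d := by
  by_cases h : s d = 0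
  · simp [source, hs.arc, h, D.arc_arc]
  · have h' := zmod_two_ne_zero_iff.1 h
    simp [source, hs.arc, h, h']

lemma circleAt_walk (hs : D.IsOrientation s) (α : Finset (Fin D.N)) (d : Fin D.N × Fin 4) :
    D.circleAt α (Sum.inl (hs.walk α d)) = D.circleAt α (Sum.inl d) := by
  rw [walk_apply]
  split_ifs
  · rw [circleAt_joined, circleAt_arc]
  · rfl

lemma circleAt_walk_pow (hs : D.IsOrientation s) (α : Finset (Fin D.N)) (i : ℕ)
    (d : Fin D.N × Fin 4) :
    D.circleAt α (Sum.inl ((hs.walk α ^ i) d)) = D.circleAt α (Sum.inl d) := by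
  induction i with
  | zero => rfl
  | succ i ih => rw [pow_succ', Equiv.Perm.mul_apply, circleAt_walk, ih]

/-- The circles of a smoothing are the cycles of the walk on the sources. -/
lemma circleAt_eq_iff (hs : D.IsOrientation s) (α : Finset (Fin D.N)) (d e : Fin D.N × Fin 4) :
    D.circleAt α (Sum.inl d) = D.circleAt α (Sum.inl e) ↔
      (hs.walk α).SameCycle (D.source s d) (D.source s e) := by
  constructor
  · intro h
    have h1 := Quot.eqvGen_exact (Sum.inl.inj h)
    clear h
    induction h1 with
    | rel d e h =>
      rcases h with rfl | rfl
      · rw [hs.source_arc]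
      -- One of `d` and `joined d` is a source and the other a sink. The walk goes from the source
      -- on the arc of the sink to the other one.
      · by_cases h : s d = 0
        · have : hs.walk α (D.source s (D.joined α d)) = D.source s d := by
            simp [walk_apply, source, hs.joined, h, hs.arc, zmod_two_one_add_one, joined_joined,
              D.arc_arc]
          rw [← this]
          exact Equiv.Perm.sameCycle_apply_left.2 (Equiv.Perm.SameCycle.refl _ _)
        · have h' := zmod_two_ne_zero_iff.1 h
          have : hs.walk α (D.source s d) = D.source s (D.joined α d) := by
            simp [walk_apply, source, hs.joined, h, hs.arc, h', D.arc_arc]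
          rw [← this]
          exact Equiv.Perm.sameCycle_apply_right.2 (Equiv.Perm.SameCycle.refl _ _)
    | refl d => exact Equiv.Perm.SameCycle.refl _ _
    | symm d e _ ih => exact ih.symm
    | trans d e f _ _ ih1 ih2 => exact ih1.trans ih2
  · intro h
    obtain ⟨i, hi⟩ := h.exists_nat_pow_eq
    rw [← D.circleAt_source s α d, ← D.circleAt_source s α e, ← hi, circleAt_walk_pow]

lemma circleAt_eq_iff_of_source (hs : D.IsOrientation s) (α : Finset (Fin D.N))
    {d e : Fin D.N × Fin 4} (hd : s d = 0) (he : s e = 0) :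
    D.circleAt α (Sum.inl d) = D.circleAt α (Sum.inl e) ↔ (hs.walk α).SameCycle d e := by
  rw [hs.circleAt_eq_iff, source, source, if_pos hd, if_pos he]

/-- The sources at `c` are `(c, k)` and `(c, k + 2)`. The two smoothings send the two sinks at `c`
to them in opposite ways and agree everywhere else. -/
lemma walk_insert (hs : D.IsOrientation s) {α : Finset (Fin D.N)} {c : Fin D.N} (hc : c ∉ α)
    {k : Fin 4} (hk : s (c, k) = 0) :
    hs.walk (insert c α) = Equiv.swap (c, k) (c, k + 2) * hs.walk α := by
  have hk1 : s (c, k + 1) = 1 := by rw [hs.next, hk]; rfl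
  have hk2 : s (c, k + 2) = 0 := by
    have := hs.next c (k + 1)
    rw [hk1, add_assoc] at this
    exact this
  have hk3 : s (c, k + 3) = 1 := by
    have := hs.next c (k + 2)
    rw [hk2, add_assoc] at this
    exact this
  ext1 d
  rw [Equiv.Perm.mul_apply, walk_apply, walk_apply]
  split_ifs with h
  · have he : s (D.arc d) ≠ 0 := by rw [hs.arc, h]; decide
    generalize D.arc d = e at he
    obtain ⟨b, l⟩ := e
    by_cases hb : b = c
    · subst hb
      have hl : l = k + 1 ∨ l = k + 3 := by
        have h4 : ∀ k l : Fin 4, l = k ∨ l = k + 1 ∨ l = k + 2 ∨ l = k + 3 := by decide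
        rcases h4 k l with rfl | h | rfl | h
        · exact absurd hk he
        · exact Or.inl h
        · exact absurd hk2 he
        · exact Or.inr h
      have hj1 : D.joined (insert b α) (b, l) = (b, ![3, 2, 1, 0] l) := by
        simp [LinkDiagram.joined]
      have hj2 : D.joined α (b, l) = (b, ![1, 0, 3, 2] l) := by
        simp [LinkDiagram.joined, hc]
      rw [hj1, hj2]
      have hperm : ∀ k l : Fin 4, l = k + 1 ∨ l = k + 3 →
          ((![1, 0, 3, 2] : Fin 4 → Fin 4) l = k ∧ (![3, 2, 1, 0] : Fin 4 → Fin 4) l = k + 2) ∨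
          ((![1, 0, 3, 2] : Fin 4 → Fin 4) l = k + 2 ∧
            (![3, 2, 1, 0] : Fin 4 → Fin 4) l = k) := by decide
      rcases hperm k l hl with ⟨h1, h2⟩ | ⟨h1, h2⟩ <;> rw [h1, h2]
      · rw [Equiv.swap_apply_left]
      · rw [Equiv.swap_apply_right]
    · have hj : D.joined (insert c α) (b, l) = D.joined α (b, l) := by
        simp [LinkDiagram.joined, hb]
      have hj1 : (D.joined α (b, l)).1 = b := by unfold LinkDiagram.joined; split_ifs <;> rfl
      rw [hj, Equiv.swap_apply_of_ne_of_ne]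
      · intro h; rw [h] at hj1; exact hb hj1.symm
      · intro h; rw [h] at hj1; exact hb hj1.symm
  · rw [Equiv.swap_apply_of_ne_of_ne]
    · rintro rfl; exact h hk
    · rintro rfl; exact h hk2

/-- Changing a smoothing either splits a circle or merges two circles. -/
lemma circleAt_insert_eq_iff (hs : D.IsOrientation s) {α : Finset (Fin D.N)} {c : Fin D.N}
    (hc : c ∉ α) :
    D.circleAt (insert c α) (Sum.inl (c, 0)) = D.circleAt (insert c α) (Sum.inl (c, 2)) ↔
      D.circleAt α (Sum.inl (c, 0)) ≠ D.circleAt α (Sum.inl (c, 2)) := by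
  by_cases h0 : s (c, 0) = 0
  · have h2 : s (c, 2) = 0 := by
      rw [show s (c, 2) = s (c, 1) + 1 from hs.next c 1,
        show s (c, 1) = s (c, 0) + 1 from hs.next c 0, h0]
      decide
    rw [hs.circleAt_eq_iff_of_source _ h0 h2, Ne, hs.circleAt_eq_iff_of_source _ h0 h2,
      hs.walk_insert hc h0]
    exact Equiv.Perm.sameCycle_swap_mul_iff _ (by simp)
  -- Here `(c, 0)` and `(c, 2)` are sinks, so they are replaced by the sources they are joined to: 1
  -- and 3 for the 0-smoothing, 3 and 1 for the 1-smoothing.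
  · have h1 : s (c, 1) = 0 := by
      rw [show s (c, 1) = s (c, 0) + 1 from hs.next c 0]
      exact zmod_two_ne_zero_iff.1 h0
    have h3 : s (c, 3) = 0 := by
      rw [show s (c, 3) = s (c, 2) + 1 from hs.next c 2,
        show s (c, 2) = s (c, 1) + 1 from hs.next c 1, h1]
      decide
    have e0 := D.circleAt_joined α (c, 0)
    have e2 := D.circleAt_joined α (c, 2)
    have e0' := D.circleAt_joined (insert c α) (c, 0)
    have e2' := D.circleAt_joined (insert c α) (c, 2)
    simp only [LinkDiagram.joined, hc, Finset.mem_insert_self, if_true, if_false] at e0 e2 e0' e2'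
    change D.circleAt α (Sum.inl (c, 1)) = _ at e0
    change D.circleAt α (Sum.inl (c, 3)) = _ at e2
    change D.circleAt _ (Sum.inl (c, 3)) = _ at e0'
    change D.circleAt _ (Sum.inl (c, 1)) = _ at e2'
    rw [← e0, ← e2, ← e0', ← e2', Ne, eq_comm, hs.circleAt_eq_iff_of_source _ h1 h3,
      hs.circleAt_eq_iff_of_source _ h1 h3, hs.walk_insert hc h1]
    exact Equiv.Perm.sameCycle_swap_mul_iff _ (by simp)

end IsOrientation

/-- In a planar diagram, a change of smoothing merges two circles or splits a circle. -/
theorem merges_or_merges (D : LinkDiagram) {α : Finset (Fin D.N)} {c : Fin D.N} (hc : c ∉ α) :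
    Merges (D.circleAt α) (D.circleAt (insert c α)) (Sum.inl (c, 0)) (Sum.inl (c, 2)) ∨
      Merges (D.circleAt (insert c α)) (D.circleAt α) (Sum.inl (c, 0)) (Sum.inl (c, 2)) := by
  obtain ⟨s, hs1, hs2⟩ := D.exists_orientation
  have hs : D.IsOrientation s := ⟨hs1, fun c k => hs2 (c, k)⟩
  have key : ∀ {α β : Finset (Fin D.N)}, (∀ b, b ≠ c → (b ∈ α ↔ b ∈ β)) →
      D.circleAt α (Sum.inl (c, 0)) ≠ D.circleAt α (Sum.inl (c, 2)) →
      D.circleAt β (Sum.inl (c, 0)) = D.circleAt β (Sum.inl (c, 2)) →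
      Merges (D.circleAt α) (D.circleAt β) (Sum.inl (c, 0)) (Sum.inl (c, 2)) := by
    intro α β h hne heq
    refine ⟨hne, fun y z => ⟨D.joinRel_of_circleAt_eq h, fun hyz => ?_⟩⟩
    rcases D.joinRel_congr (fun b hb => (h b hb).symm) hyz with h1 | ⟨h1, h2⟩
    · exact h1
    · rw [← heq, or_self] at h1 h2
      exact h1.trans h2.symm
  have hins := hs.circleAt_insert_eq_iff hc
  by_cases h : D.circleAt α (Sum.inl (c, 0)) = D.circleAt α (Sum.inl (c, 2))
  · exact Or.inr (key (fun b hb => by simp [hb]) (fun h' => hins.1 h' h) h)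
  · exact Or.inl (key (fun b hb => by simp [hb]) h (hins.2 h))

end LinkDiagram

/-! ## The saddle maps around a square commute -/

section Labels

variable {Y C C' : Type*} {π : Y → C} {π' : Y → C'} {p q : Y}

/-- This form is symmetric in `π` and `π'`, which lets merges and splits share the lemmas on circles
away from the saddle. -/
lemma Merges.joinRel_iff (h : Merges π π' p q) (y z : Y) :
    JoinRel π' p q y z ↔ JoinRel π p q y z := by
  rw [← h.eq_iff]
  constructor
  · rintro (h1 | ⟨h1, h2⟩)
    · exact h1
    · rw [← h.eq, or_self] at h1 h2
      exact h1.trans h2.symm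
  · exact Or.inl

lemma touch_iff (h : ∀ y z, JoinRel π' p q y z ↔ JoinRel π p q y z) (y : Y) :
    (π' y = π' p ∨ π' y = π' q) ↔ (π y = π p ∨ π y = π q) := by
  rw [← joinRel_left_iff, h, joinRel_left_iff]

lemma eq_iff_of_not_touch (h : ∀ y z, JoinRel π' p q y z ↔ JoinRel π p q y z) {y : Y}
    (hy : ¬ (π y = π p ∨ π y = π q)) (z : Y) : π' y = π' z ↔ π y = π z := by
  have h1 := h y z
  unfold JoinRel at h1
  rw [touch_iff h y] at h1
  tauto

/-- The labellings `l` and `m` agree away from `p` and `q`. -/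
def AgreeAway (π : Y → C) (π' : Y → C') (p q : Y) (l : C → Bool) (m : C' → Bool) : Prop :=
  ∀ y, π y ≠ π p → π y ≠ π q → l (π y) = m (π' y)

open Classical in
/-- The coefficients of the saddle map that joins or separates the circles through `p` and `q`. -/
noncomputable def saddleMatrix (π : Y → C) (π' : Y → C') (p q : Y) :
    Matrix (C → Bool) (C' → Bool) ℤ := fun l m =>
  if AgreeAway π π' p q l m then
    if π p ≠ π q ∧ π' p = π' q then mulCoeff (l (π p)) (l (π q)) (m (π' p))
    else if π p = π q ∧ π' p ≠ π' q then comulCoeff (l (π p)) (m (π' p)) (m (π' q))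
    else 0
  else 0

open Classical in
/-- The multiplication by `v₋` in the tensor factor `γ`. -/
noncomputable def dotMatrix (γ : C) : Matrix (C → Bool) (C → Bool) ℤ := fun l m =>
  if l γ = true ∧ m = Function.update l γ false then 1 else 0

open Classical in
lemma saddleMatrix_of_merges (h : Merges π π' p q) (l : C → Bool) (m : C' → Bool) :
    saddleMatrix π π' p q l m =
      if AgreeAway π π' p q l m then mulCoeff (l (π p)) (l (π q)) (m (π' p)) else 0 := by
  simp [saddleMatrix, h.ne, h.eq]

open Classical in
lemma saddleMatrix_of_merges' (h : Merges π' π p q) (l : C → Bool) (m : C' → Bool) :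
    saddleMatrix π π' p q l m =
      if AgreeAway π π' p q l m then comulCoeff (l (π p)) (m (π' p)) (m (π' q)) else 0 := by
  simp [saddleMatrix, h.ne, h.eq]

open Classical in
lemma dotMatrix_mul [Fintype C] {ν : Type*} (γ : C) (A : Matrix (C → Bool) ν ℤ)
    (l : C → Bool) (m : ν) :
    (dotMatrix γ * A) l m = if l γ = true then A (Function.update l γ false) m else 0 := by
  simp only [Matrix.mul_apply, dotMatrix, ite_mul, one_mul, zero_mul]
  split_ifs with h <;> simp [h]

open Classical in
lemma mul_dotMatrix [Fintype C] {ν : Type*} (γ : C) (A : Matrix ν (C → Bool) ℤ)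
    (l : ν) (m : C → Bool) :
    (A * dotMatrix γ) l m = if m γ = false then A l (Function.update m γ true) else 0 := by
  simp only [Matrix.mul_apply, dotMatrix, mul_ite, mul_one, mul_zero]
  split_ifs with h
  · rw [Finset.sum_eq_single (Function.update m γ true)]
    · simp [← h]
    · intro n _ hn
      rw [if_neg]
      rintro ⟨h1, rfl⟩
      simp [← h1] at hn
    · simp
  · refine Finset.sum_eq_zero fun n _ => ?_
    rw [if_neg]
    rintro ⟨h1, rfl⟩
    simp at h

open Classical in
lemma dotMatrix_comm [Fintype C] (γ δ : C) : dotMatrix γ * dotMatrix δ = dotMatrix δ * dotMatrix γ := by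
  ext l m
  rw [dotMatrix_mul, dotMatrix_mul]
  by_cases h : γ = δ
  · rw [h]
  · have h' : δ ≠ γ := Ne.symm h
    simp only [dotMatrix, Function.update_of_ne h, Function.update_of_ne h',
      Function.update_comm h']
    split_ifs <;> simp_all

open Classical in
lemma agreeAway_update_of_not_touch (h : ∀ y z, JoinRel π' p q y z ↔ JoinRel π p q y z) {y : Y}
    (hy : ¬ (π y = π p ∨ π y = π q)) (l : C → Bool) (m : C' → Bool) :
    (l (π y) = true ∧ AgreeAway π π' p q (Function.update l (π y) false) m) ↔
      (m (π' y) = false ∧ AgreeAway π π' p q l (Function.update m (π' y) true)) := by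
  have hz : ∀ z, π' z = π' y ↔ π z = π y := fun z => by
    rw [eq_comm, eq_iff_of_not_touch h hy, eq_comm]
  have hy' := not_or.1 hy
  constructor
  · rintro ⟨h1, h2⟩
    refine ⟨?_, fun z hz1 hz2 => ?_⟩
    · rw [← h2 y hy'.1 hy'.2, Function.update_self]
    · by_cases e : π z = π y
      · rw [e, h1, (hz z).2 e, Function.update_self]
      · rw [Function.update_of_ne (fun e' => e ((hz z).1 e')), ← h2 z hz1 hz2,
          Function.update_of_ne e]
  · rintro ⟨h1, h2⟩
    refine ⟨?_, fun z hz1 hz2 => ?_⟩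
    · rw [h2 y hy'.1 hy'.2, Function.update_self]
    · by_cases e : π z = π y
      · rw [e, (hz z).2 e, h1, Function.update_self]
      · rw [Function.update_of_ne e, h2 z hz1 hz2,
          Function.update_of_ne (fun e' => e ((hz z).1 e'))]

open Classical in
lemma agreeAway_update_left {y : Y} (hy : π y = π p ∨ π y = π q) (l : C → Bool) (m : C' → Bool)
    (b : Bool) : AgreeAway π π' p q (Function.update l (π y) b) m ↔ AgreeAway π π' p q l m := by
  refine forall_congr' fun z => forall_congr' fun h1 => forall_congr' fun h2 => ?_
  rw [Function.update_of_ne]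
  rcases hy with hy | hy <;> rwa [hy]

open Classical in
lemma agreeAway_update_right (h : ∀ y z, JoinRel π' p q y z ↔ JoinRel π p q y z) {y : Y}
    (hy : π y = π p ∨ π y = π q) (l : C → Bool) (m : C' → Bool)
    (b : Bool) : AgreeAway π π' p q l (Function.update m (π' y) b) ↔ AgreeAway π π' p q l m := by
  refine forall_congr' fun z => forall_congr' fun h1 => forall_congr' fun h2 => ?_
  rw [Function.update_of_ne]
  intro e
  have hz := (touch_iff h z).not.2 (not_or.2 ⟨h1, h2⟩)
  rw [e] at hz
  exact hz ((touch_iff h y).2 hy)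

-- Multiplication is linear over the action of `v₋` on either factor: `v₋ · m(a ⊗ b) = m(v₋a ⊗ b) =
-- m(a ⊗ v₋b)`. Away from the saddle both sides relabel the same circle.
open Classical in
lemma dotMatrix_mul_saddleMatrix_of_merges [Fintype C] [Fintype C'] (h : Merges π π' p q) (y : Y) :
    dotMatrix (π y) * saddleMatrix π π' p q = saddleMatrix π π' p q * dotMatrix (π' y) := by
  have hJ := h.joinRel_iff
  ext l m
  rw [dotMatrix_mul, mul_dotMatrix, saddleMatrix_of_merges h, saddleMatrix_of_merges h]
  by_cases hy : π y = π p ∨ π y = π q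
  · rw [agreeAway_update_left hy, agreeAway_update_right hJ hy]
    have hy' : π' y = π' p := by
      rcases (touch_iff hJ y).2 hy with h' | h'
      · exact h'
      · exact h'.trans h.eq.symm
    rw [hy', Function.update_self]
    rcases hy with hy | hy
    · rw [hy, Function.update_self, Function.update_of_ne h.ne.symm]
      cases l (π p) <;> cases l (π q) <;> cases m (π' p) <;> simp [mulCoeff]
    · rw [hy, Function.update_self, Function.update_of_ne h.ne]
      cases l (π p) <;> cases l (π q) <;> cases m (π' p) <;> simp [mulCoeff]
  · have hA := agreeAway_update_of_not_touch hJ hy l m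
    obtain ⟨h1, h2⟩ := not_or.1 hy
    obtain ⟨h3, -⟩ := not_or.1 ((touch_iff hJ y).not.2 hy)
    rw [Function.update_of_ne (Ne.symm h1), Function.update_of_ne (Ne.symm h2),
      Function.update_of_ne (Ne.symm h3), ← ite_and, ← ite_and]
    exact if_congr hA rfl rfl

-- Comultiplication is a bimodule map: `Δ(v₋a)` is `Δ(a)` multiplied by `v₋` in either factor.
open Classical in
lemma dotMatrix_mul_saddleMatrix_of_merges' [Fintype C] [Fintype C'] (h : Merges π' π p q) (y : Y) :
    dotMatrix (π y) * saddleMatrix π π' p q = saddleMatrix π π' p q * dotMatrix (π' y) := by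
  have hJ : ∀ y z, JoinRel π' p q y z ↔ JoinRel π p q y z := fun y z => (h.joinRel_iff y z).symm
  ext l m
  rw [dotMatrix_mul, mul_dotMatrix, saddleMatrix_of_merges' h, saddleMatrix_of_merges' h]
  by_cases hy : π y = π p ∨ π y = π q
  · rw [agreeAway_update_left hy, agreeAway_update_right hJ hy]
    have hy' : π y = π p := by
      rcases hy with h' | h'
      · exact h'
      · exact h'.trans h.eq.symm
    rw [hy', Function.update_self]
    rcases (touch_iff hJ y).2 hy with hy | hy
    · rw [hy, Function.update_self, Function.update_of_ne h.ne.symm]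
      cases l (π p) <;> cases m (π' q) <;> cases m (π' p) <;> simp [comulCoeff]
    · rw [hy, Function.update_self, Function.update_of_ne h.ne]
      cases l (π p) <;> cases m (π' q) <;> cases m (π' p) <;> simp [comulCoeff]
  · have hA := agreeAway_update_of_not_touch hJ hy l m
    obtain ⟨h1, h2⟩ := not_or.1 hy
    obtain ⟨h3, h4⟩ := not_or.1 ((touch_iff hJ y).not.2 hy)
    rw [Function.update_of_ne (Ne.symm h1),
      Function.update_of_ne (Ne.symm h3), Function.update_of_ne (Ne.symm h4), ← ite_and, ← ite_and]
    exact if_congr hA rfl rfl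

open Classical in
lemma dotMatrix_mul_saddleMatrix [Fintype C] [Fintype C']
    (h : Merges π π' p q ∨ Merges π' π p q) (y : Y) :
    dotMatrix (π y) * saddleMatrix π π' p q = saddleMatrix π π' p q * dotMatrix (π' y) :=
  h.elim (dotMatrix_mul_saddleMatrix_of_merges · y) (dotMatrix_mul_saddleMatrix_of_merges' · y)

open Classical in
/-- The matrix of the multiplication by the image of `1` under the saddle map. -/
noncomputable def unitMatrix [Fintype C'] (π : Y → C) (π' : Y → C') (p q : Y) :
    Matrix (C' → Bool) (C' → Bool) ℤ :=
  if π p = π q then dotMatrix (π' p) + dotMatrix (π' q) else 1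

-- The row at the constant labelling `true` is the image of `1`. It reflects `m(1 ⊗ 1) = 1` and
-- `Δ(1) = v₊ ⊗ v₋ + v₋ ⊗ v₊`.
open Classical in
lemma saddleMatrix_true [Fintype C'] (hπ' : Function.Surjective π') (h : Merges π π' p q ∨ Merges π' π p q) :
    saddleMatrix π π' p q (fun _ => true) = unitMatrix π π' p q (fun _ => true) := by
  funext m
  rcases h with h | h
  · rw [saddleMatrix_of_merges h, unitMatrix, if_neg h.ne, Matrix.one_apply]
    by_cases hm : (fun _ => true) = m
    · subst hm
      simp [AgreeAway, mulCoeff]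
    · rw [if_neg hm]
      split_ifs with h1
      · cases hp : m (π' p)
        · rfl
        · refine absurd (funext fun γ => ?_) hm
          obtain ⟨y, rfl⟩ := hπ' γ
          by_cases hy : π y = π p ∨ π y = π q
          · rcases (touch_iff h.joinRel_iff y).2 hy with h' | h'
            · rw [h', hp]
            · rw [h', ← h.eq, hp]
          · exact h1 y (not_or.1 hy).1 (not_or.1 hy).2
      · rfl
  · have hJ : ∀ y z, JoinRel π' p q y z ↔ JoinRel π p q y z := fun y z => (h.joinRel_iff y z).symm
    rw [saddleMatrix_of_merges' h, unitMatrix, if_pos h.eq, Matrix.add_apply]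
    simp only [dotMatrix, true_and]
    -- A labelling that is `v₊` away from the saddle is determined by its values on the two new
    -- circles.
    have e : ∀ b b' : Bool, (AgreeAway π π' p q (fun _ => true) m ∧ m (π' p) = b ∧ m (π' q) = b') ↔
        m = Function.update (Function.update (fun _ => true) (π' q) b') (π' p) b := by
      intro b b'
      constructor
      · rintro ⟨h1, h2, h3⟩
        funext γ
        obtain ⟨y, rfl⟩ := hπ' γ
        by_cases hyp : π' y = π' p
        · rw [hyp, Function.update_self, h2]
        · rw [Function.update_of_ne hyp]
          by_cases hyq : π' y = π' q
          · rw [hyq, Function.update_self, h3]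
          · rw [Function.update_of_ne hyq]
            have hy := (touch_iff hJ y).not.1 (not_or.2 ⟨hyp, hyq⟩)
            exact (h1 y (not_or.1 hy).1 (not_or.1 hy).2).symm
      · rintro rfl
        refine ⟨fun y h1 h2 => ?_, ?_, ?_⟩
        · have hy := (touch_iff hJ y).not.2 (not_or.2 ⟨h1, h2⟩)
          rw [Function.update_of_ne (not_or.1 hy).1, Function.update_of_ne (not_or.1 hy).2]
        · rw [Function.update_self]
        · rw [Function.update_of_ne h.ne.symm, Function.update_self]
    have e1 := e true false
    have e2 := e false true
    have u : ∀ γ : C', Function.update (fun _ : C' => true) γ true = fun _ => true := fun γ =>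
      Function.update_eq_self γ _
    rw [u] at e2
    rw [Function.update_comm h.ne.symm, u] at e1
    rw [← if_congr e1 rfl rfl, ← if_congr e2 rfl rfl]
    by_cases h1 : AgreeAway π π' p q (fun _ => true) m
    · simp only [h1, if_true, true_and]
      cases m (π' p) <;> cases m (π' q) <;> simp [comulCoeff]
    · simp [h1]

open Classical in
/-- A matrix that intertwines the multiplications by `v₋` is determined by its value on `1`. -/
lemma eq_of_dotMatrix_mul [Fintype C] {ν : Type*} [Fintype ν] (hπ : Function.Surjective π)
    {A B : Matrix (C → Bool) ν ℤ} (N : Y → Matrix ν ν ℤ)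
    (hA : ∀ y, dotMatrix (π y) * A = A * N y) (hB : ∀ y, dotMatrix (π y) * B = B * N y)
    (h : A (fun _ => true) = B (fun _ => true)) : A = B := by
  -- Induction on the number of labels `v₋`: a labelling with a `v₋` on the circle of `y` is the
  -- `v₋`-multiple at `y` of a labelling with one fewer.
  have key : ∀ (n : ℕ) (l : C → Bool), (Finset.univ.filter (l · = false)).card = n → A l = B l := by
    intro n
    induction n with
    | zero =>
      intro l hl
      rw [Finset.card_eq_zero, Finset.filter_eq_empty_iff] at hl
      have : l = fun _ => true := funext fun γ => by simpa using hl (Finset.mem_univ γ)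
      rw [this, h]
    | succ n ih =>
      intro l hl
      obtain ⟨γ, hγ⟩ := Finset.card_pos.1 (lt_of_lt_of_eq (Nat.succ_pos n) hl.symm)
      rw [Finset.mem_filter] at hγ
      obtain ⟨y, rfl⟩ := hπ γ
      have hl' : (Finset.univ.filter (Function.update l (π y) true · = false)).card = n := by
        have e : Finset.univ.filter (Function.update l (π y) true · = false) =
            (Finset.univ.filter (l · = false)).erase (π y) := by
          ext δ
          by_cases hδ : δ = π y
          · subst hδ; simp
          · simp [hδ]
        rw [e, Finset.card_erase_of_mem (by simp [hγ.2]), hl]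
        rfl
      have row : ∀ M : Matrix (C → Bool) ν ℤ, dotMatrix (π y) * M = M * N y →
          ∀ j, M l j = ∑ i, M (Function.update l (π y) true) i * N y i j := by
        intro M hM j
        have h1 := congrFun (congrFun hM (Function.update l (π y) true)) j
        rw [dotMatrix_mul, Function.update_self, if_pos rfl, Function.update_idem, ← hγ.2,
          Function.update_eq_self, Matrix.mul_apply] at h1
        exact h1
      funext j
      rw [row A (hA y), row B (hB y), ih _ hl']
  funext l
  exact key _ l rfl

end Labels

section Square

variable {Y C₀ C₁ C₂ C₃ : Type*} [Fintype C₀] [Fintype C₁] [Fintype C₂] [Fintype C₃]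
  {π₀ : Y → C₀} {π₁ : Y → C₁} {π₂ : Y → C₂} {π₃ : Y → C₃} {p q r s : Y}

-- The factor produced by the first saddle is moved to the end of the second, where it is
-- multiplication at the same points `p` and `q`.
omit [Fintype C₀] in
open Classical in
lemma unitMatrix_mul_saddleMatrix (h : Merges π₁ π₃ r s ∨ Merges π₃ π₁ r s) :
    unitMatrix π₀ π₁ p q * saddleMatrix π₁ π₃ r s =
      saddleMatrix π₁ π₃ r s * unitMatrix π₀ π₃ p q := by
  unfold unitMatrix
  split_ifs
  · rw [Matrix.add_mul, Matrix.mul_add, dotMatrix_mul_saddleMatrix h, dotMatrix_mul_saddleMatrix h]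
  · rw [Matrix.one_mul, Matrix.mul_one]

lemma row_mul {l m n : Type*} [Fintype m] {A : Matrix l m ℤ} {A' : Matrix m m ℤ}
    {B : Matrix m n ℤ} {i : l} {i' : m} (h : A i = A' i') : (A * B) i = (A' * B) i' := by
  funext j
  simp only [Matrix.mul_apply, h]

-- Matrices act on row vectors, so the left factor is applied first. The image of `1` under two
-- saddles is the product of their two factors, both read on the final circles.
omit [Fintype C₀] in
open Classical in
lemma saddleMatrix_mul_true (h₁ : Function.Surjective π₁) (h₃ : Function.Surjective π₃)
    (h : Merges π₀ π₁ p q ∨ Merges π₁ π₀ p q) (h' : Merges π₁ π₃ r s ∨ Merges π₃ π₁ r s) :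
    (saddleMatrix π₀ π₁ p q * saddleMatrix π₁ π₃ r s) (fun _ => true) =
      (unitMatrix π₁ π₃ r s * unitMatrix π₀ π₃ p q) (fun _ => true) := by
  rw [row_mul (saddleMatrix_true h₁ h), unitMatrix_mul_saddleMatrix h',
    row_mul (saddleMatrix_true h₃ h')]

-- Points that are distinct after the first merge were distinct before it, which excludes a split at
-- `r`, `s`. Points once merged stay merged, which excludes a split at `p`, `q`.
omit [Fintype C₀] [Fintype C₁] [Fintype C₂] [Fintype C₃] in
lemma merges_of_merges_of_merges (ha : Merges π₀ π₁ p q) (hb' : Merges π₁ π₃ r s) 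
    (hb : Merges π₀ π₂ r s ∨ Merges π₂ π₀ r s) (ha' : Merges π₂ π₃ p q ∨ Merges π₃ π₂ p q) :
    Merges π₀ π₂ r s ∧ Merges π₂ π₃ p q :=
  ⟨hb.resolve_right fun h => hb'.ne (ha.eq_of_eq h.eq),
    ha'.resolve_right fun h => h.ne (hb'.eq_of_eq ha.eq)⟩

omit [Fintype C₀] [Fintype C₁] [Fintype C₂] [Fintype C₃] in
lemma merges_of_merges_of_merges' (ha : Merges π₁ π₀ p q) (hb' : Merges π₃ π₁ r s) 
    (hb : Merges π₀ π₂ r s ∨ Merges π₂ π₀ r s) (ha' : Merges π₂ π₃ p q ∨ Merges π₃ π₂ p q) :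
    Merges π₂ π₀ r s ∧ Merges π₃ π₂ p q :=
  ⟨hb.resolve_left fun h => h.ne (ha.eq_of_eq hb'.eq),
    ha'.resolve_left fun h => ha.ne (hb'.eq_of_eq h.eq)⟩

omit [Fintype C₀] [Fintype C₁] in
lemma unitMatrix_of_merges (h : Merges π₀ π₁ p q) : unitMatrix π₀ π₃ p q = 1 := if_neg h.ne

omit [Fintype C₀] [Fintype C₁] in
lemma unitMatrix_of_merges' (h : Merges π₁ π₀ p q) :
    unitMatrix π₀ π₃ p q = dotMatrix (π₃ p) + dotMatrix (π₃ q) := if_pos h.eq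

-- The types of the four saddles are constrained by which pairs of points lie on a common circle. In
-- every consistent pattern the two factors agree on the final circles.
omit [Fintype C₀] [Fintype C₁] [Fintype C₂] in
open Classical in
lemma unitMatrix_mul_unitMatrix
    (ha : Merges π₀ π₁ p q ∨ Merges π₁ π₀ p q) (hb' : Merges π₁ π₃ r s ∨ Merges π₃ π₁ r s)
    (hb : Merges π₀ π₂ r s ∨ Merges π₂ π₀ r s) (ha' : Merges π₂ π₃ p q ∨ Merges π₃ π₂ p q) :
    unitMatrix π₁ π₃ r s * unitMatrix π₀ π₃ p q =
      unitMatrix π₂ π₃ p q * unitMatrix π₀ π₃ r s := by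
  rcases ha with a | a <;> rcases hb' with b' | b'
  · obtain ⟨b, a'⟩ := merges_of_merges_of_merges a b' hb ha'
    rw [unitMatrix_of_merges a, unitMatrix_of_merges b', unitMatrix_of_merges b,
      unitMatrix_of_merges a']
  · rcases hb with b | b <;> rcases ha' with a' | a'
    · exact absurd (merges_of_merges_of_merges b a' (.inl a) (.inr b')).2.eq b'.ne
    · rw [unitMatrix_of_merges a, unitMatrix_of_merges' b', unitMatrix_of_merges b,
        unitMatrix_of_merges' a', Matrix.mul_one, Matrix.mul_one]
      -- Merge, then split, along both paths. The points `p` and `q` share a circle in `π₁` but not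
      -- in `π₃`, so the last split separates them. Hence `{p, q}` and `{r, s}` mark the same two
      -- circles of `π₃`.
      rcases (b'.eq_iff p q).1 a.eq with h | ⟨h1 | h1, h2 | h2⟩
      · exact absurd h a'.ne
      · exact absurd (h1.trans h2.symm) a'.ne
      · rw [h1, h2]
      · rw [h1, h2, add_comm]
      · exact absurd (h1.trans h2.symm) a'.ne
    · rw [unitMatrix_of_merges a, unitMatrix_of_merges' b', unitMatrix_of_merges' b,
        unitMatrix_of_merges a', Matrix.mul_one, Matrix.one_mul]
    · exact absurd (merges_of_merges_of_merges' b a' (.inl a) (.inr b')).1.eq a.ne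
  · rcases hb with b | b <;> rcases ha' with a' | a'
    · exact absurd (merges_of_merges_of_merges b a' (.inr a) (.inl b')).1.ne (not_not.2 a.eq)
    · rw [unitMatrix_of_merges' a, unitMatrix_of_merges b', unitMatrix_of_merges b,
        unitMatrix_of_merges' a', Matrix.mul_one, Matrix.one_mul]
    · rw [unitMatrix_of_merges' a, unitMatrix_of_merges b', unitMatrix_of_merges' b,
        unitMatrix_of_merges a', Matrix.one_mul, Matrix.one_mul]
      -- Split, then merge, along both paths. All four points end on one circle, and both sides are
      -- twice the multiplication by `v₋` there.
      have hr : π₃ r = π₃ p ∨ π₃ r = π₃ q := by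
        rcases (a.eq_iff r s).1 b.eq with h | ⟨h1 | h1, -⟩
        · exact absurd h b'.ne
        · exact Or.inl (b'.eq_of_eq h1)
        · exact Or.inr (b'.eq_of_eq h1)
      rw [← b'.eq, ← a'.eq]
      rw [← a'.eq, or_self] at hr
      rw [hr]
    · exact absurd (merges_of_merges_of_merges' b a' (.inr a) (.inl b')).2.ne (not_not.2 b'.eq)
  · obtain ⟨b, a'⟩ := merges_of_merges_of_merges' a b' hb ha'
    rw [unitMatrix_of_merges' a, unitMatrix_of_merges' b', unitMatrix_of_merges' b,
      unitMatrix_of_merges' a']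
    simp only [Matrix.add_mul, Matrix.mul_add, dotMatrix_comm (π₃ p)]
    simp only [dotMatrix_comm (π₃ q)]
    abel

-- Both composites intertwine the multiplications by `v₋`, so they are determined by the image of
-- `1`.
open Classical in
theorem saddleMatrix_mul_saddleMatrix (h₀ : Function.Surjective π₀) (h₁ : Function.Surjective π₁)
    (h₂ : Function.Surjective π₂) (h₃ : Function.Surjective π₃)
    (ha : Merges π₀ π₁ p q ∨ Merges π₁ π₀ p q) (hb' : Merges π₁ π₃ r s ∨ Merges π₃ π₁ r s)
    (hb : Merges π₀ π₂ r s ∨ Merges π₂ π₀ r s) (ha' : Merges π₂ π₃ p q ∨ Merges π₃ π₂ p q) :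
    saddleMatrix π₀ π₁ p q * saddleMatrix π₁ π₃ r s =
      saddleMatrix π₀ π₂ r s * saddleMatrix π₂ π₃ p q := by
  refine eq_of_dotMatrix_mul h₀ (fun y => dotMatrix (π₃ y)) (fun y => ?_) (fun y => ?_) ?_
  · rw [← Matrix.mul_assoc, dotMatrix_mul_saddleMatrix ha, Matrix.mul_assoc, dotMatrix_mul_saddleMatrix hb',
      Matrix.mul_assoc]
  · rw [← Matrix.mul_assoc, dotMatrix_mul_saddleMatrix hb, Matrix.mul_assoc, dotMatrix_mul_saddleMatrix ha',
      Matrix.mul_assoc]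
  · rw [saddleMatrix_mul_true h₁ h₃ ha hb', saddleMatrix_mul_true h₂ h₃ hb ha',
      unitMatrix_mul_unitMatrix ha hb' hb ha']

end Square

/-! ## The Khovanov cube -/

section Degree

variable {Y C C' : Type*} [Fintype C] [Fintype C'] {π : Y → C} {π' : Y → C'} {p q : Y}

-- The circles away from the saddle in the two smoothings correspond to each other, with equal
-- labels.
open Classical in
lemma sum_away_eq (h : ∀ y z, JoinRel π' p q y z ↔ JoinRel π p q y z)
    (hπ : Function.Surjective π) (hπ' : Function.Surjective π') {l : C → Bool} {m : C' → Bool}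
    (hlm : AgreeAway π π' p q l m) (w : Bool → ℤ) :
    ∑ γ with ¬ (γ = π p ∨ γ = π q), w (l γ) = ∑ γ with ¬ (γ = π' p ∨ γ = π' q), w (m γ) := by
  have hs : ∀ γ, π (Function.surjInv hπ γ) = γ := Function.surjInv_eq hπ
  refine Finset.sum_bij (fun γ _ => π' (Function.surjInv hπ γ)) ?_ ?_ ?_ ?_
  · intro γ hγ
    obtain ⟨y, hy⟩ : ∃ y, y = Function.surjInv hπ γ := ⟨_, rfl⟩
    have hyγ : π y = γ := by rw [hy, hs]
    rw [Finset.mem_filter] at hγ ⊢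
    rw [← hy, touch_iff h, hyγ]
    exact ⟨Finset.mem_univ _, hγ.2⟩
  · intro γ hγ δ _ e
    rw [Finset.mem_filter] at hγ
    rw [eq_iff_of_not_touch h] at e
    · rwa [hs, hs] at e
    · rw [hs]; exact hγ.2
  · intro γ hγ
    obtain ⟨y, rfl⟩ := hπ' γ
    rw [Finset.mem_filter, touch_iff h] at hγ
    refine ⟨π y, by simpa using hγ.2, ?_⟩
    rw [eq_comm, eq_iff_of_not_touch h hγ.2, hs]
  · intro γ hγ
    rw [Finset.mem_filter] at hγ
    have h1 := hlm (Function.surjInv hπ γ)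
    rw [hs] at h1
    rw [h1 (not_or.1 hγ.2).1 (not_or.1 hγ.2).2]

open Classical in
lemma sum_eq_sum_away_add_of_ne (h : π p ≠ π q) (f : C → ℤ) :
    ∑ γ, f γ = ∑ γ with ¬ (γ = π p ∨ γ = π q), f γ + (f (π p) + f (π q)) := by
  rw [← Finset.sum_filter_add_sum_filter_not Finset.univ (fun γ => γ = π p ∨ γ = π q), add_comm,
    ← Finset.sum_pair h]
  congr 2
  ext γ
  simp

open Classical in
lemma sum_eq_sum_away_add_of_eq (h : π p = π q) (f : C → ℤ) :
    ∑ γ, f γ = ∑ γ with ¬ (γ = π p ∨ γ = π q), f γ + f (π p) := by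
  rw [← Finset.sum_filter_add_sum_filter_not Finset.univ (fun γ => γ = π p ∨ γ = π q), add_comm,
    ← Finset.sum_singleton f (π p)]
  congr 2
  ext γ
  simp [h]

/-- Both `m` and `Δ` lower the degree by one, and the other circles contribute equally. -/
lemma sum_eq_of_saddleMatrix_ne_zero (hπ : Function.Surjective π) (hπ' : Function.Surjective π')
    (h : Merges π π' p q ∨ Merges π' π p q) {l : C → Bool} {m : C' → Bool}
    (hne : saddleMatrix π π' p q l m ≠ 0) :
    ∑ γ, (if m γ = true then (1 : ℤ) else -1) = ∑ γ, (if l γ = true then (1 : ℤ) else -1) - 1 := by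
  classical
  rcases h with h | h
  · rw [saddleMatrix_of_merges h] at hne
    have hlm : AgreeAway π π' p q l m := by_contra fun h' => hne (if_neg h')
    rw [if_pos hlm] at hne
    rw [sum_eq_sum_away_add_of_eq h.eq, sum_eq_sum_away_add_of_ne h.ne,
      sum_away_eq h.joinRel_iff hπ hπ' hlm (fun b => if b = true then 1 else -1)]
    revert hne
    cases l (π p) <;> cases l (π q) <;> cases m (π' p) <;> simp [mulCoeff] <;> ring
  · rw [saddleMatrix_of_merges' h] at hne
    have hlm : AgreeAway π π' p q l m := by_contra fun h' => hne (if_neg h')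
    rw [if_pos hlm] at hne
    rw [sum_eq_sum_away_add_of_eq h.eq, sum_eq_sum_away_add_of_ne h.ne,
      sum_away_eq (fun y z => (h.joinRel_iff y z).symm) hπ hπ' hlm
        (fun b => if b = true then 1 else -1)]
    revert hne
    cases l (π p) <;> cases m (π' q) <;> cases m (π' p) <;> simp [comulCoeff] <;> ring

end Degree

section MatrixMap

variable (R : Type u) [CommRing R]

lemma matrixMap_single_apply {A B : Type} [Finite B] (M : A → B → ℤ) (a : A) (r : R) (b : B) :
    matrixMap R M (Finsupp.single a r) b = r * M a b := by
  simp [matrixMap]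

lemma matrixMap_comp {A B C : Type} [Fintype B] [Finite C] (M : A → B → ℤ) (M' : B → C → ℤ) :
    matrixMap R M' ∘ₗ matrixMap R M = matrixMap R fun a c => ∑ b, M a b * M' b c := by
  ext a c
  simp only [LinearMap.comp_apply, Finsupp.lsingle_apply]
  rw [matrixMap_single_apply]
  have : matrixMap R M (Finsupp.single a 1) = ∑ b, Finsupp.single b (M a b : R) := by
    ext b
    classical
    rw [matrixMap_single_apply, Finsupp.finsetSum_apply]
    simp [Finsupp.single_apply]
  rw [this, map_sum, Finsupp.finsetSum_apply]
  simp only [matrixMap_single_apply]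
  push_cast
  simp

end MatrixMap

namespace LinkDiagram

noncomputable instance (D : LinkDiagram) (α : Finset (Fin D.N)) : Fintype (D.Circle α) :=
  Fintype.ofFinite _

noncomputable instance (D : LinkDiagram) : Fintype D.EnhancedState := Fintype.ofFinite _

noncomputable instance (D : LinkDiagram) (F x : Finset (Fin D.N)) (i j : ℤ) :
    Fintype (D.Gen F x i j) :=
  Fintype.ofFinite _

variable {D : LinkDiagram}

lemma EnhancedState.deg_eq_sum (S : D.EnhancedState) :
    S.deg = ∑ γ, if S.label γ = true then (1 : ℤ) else -1 := by
  classical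
  rw [EnhancedState.deg, Finset.sum_ite, Nat.card_eq_fintype_card, Nat.card_eq_fintype_card,
    Fintype.card_subtype, Fintype.card_subtype]
  simp [sub_eq_add_neg]

lemma circleOf_eq_circleAt (α : Finset (Fin D.N)) (d : Fin D.N × Fin 4) :
    D.circleOf α d = D.circleAt α (Sum.inl d) := rfl

/-- Counting the components without crossings as points merges the two agreement conditions into one
and makes the map to circles surjective. -/
lemma saddleCoeff_eq (c : Fin D.N) (S T : D.EnhancedState) :
    D.saddleCoeff c S T = saddleMatrix (D.circleAt S.ones) (D.circleAt T.ones)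
      (Sum.inl (c, 0)) (Sum.inl (c, 2)) S.label T.label := by
  classical
  have h : ((∀ d, D.circleOf S.ones d ≠ D.circleOf S.ones (c, 0) →
      D.circleOf S.ones d ≠ D.circleOf S.ones (c, 2) →
        S.label (D.circleOf S.ones d) = T.label (D.circleOf T.ones d)) ∧
      ∀ t : Fin D.loops, S.label (Sum.inr t) = T.label (Sum.inr t)) ↔
      AgreeAway (D.circleAt S.ones) (D.circleAt T.ones) (Sum.inl (c, 0)) (Sum.inl (c, 2))
        S.label T.label := by
    unfold AgreeAway
    rw [Sum.forall]
    refine and_congr Iff.rfl (forall_congr' fun t => ?_)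
    simp [circleAt]
  unfold saddleCoeff saddleMatrix
  simp only [circleOf_eq_circleAt] at h ⊢
  simp only [h]
  clear h
  by_cases h₁ : D.circleAt S.ones (Sum.inl (c, 0)) = D.circleAt S.ones (Sum.inl (c, 2)) <;>
    by_cases h₂ : D.circleAt T.ones (Sum.inl (c, 0)) = D.circleAt T.ones (Sum.inl (c, 2)) <;>
    simp [h₁, h₂]

lemma incidence_eq_saddleCoeff {S T : D.EnhancedState} {c : Fin D.N} (hc : c ∉ S.ones)
    (hT : T.ones = insert c S.ones) : D.incidence S T = D.saddleCoeff c S T := by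
  unfold incidence
  rw [Finset.sum_eq_single c, if_pos ⟨hc, hT⟩]
  · intro b _ hb
    rw [if_neg]
    rintro ⟨h1, h2⟩
    have h3 : b ∈ insert c S.ones := by rw [← hT, h2]; exact Finset.mem_insert_self _ _
    rcases Finset.mem_insert.1 h3 with h4 | h4
    · exact hb h4
    · exact h1 h4
  · simp

lemma merges_or_merges_of_eq {α β : Finset (Fin D.N)} {c : Fin D.N} (hc : c ∉ α)
    (hβ : β = insert c α) :
    Merges (D.circleAt α) (D.circleAt β) (Sum.inl (c, 0)) (Sum.inl (c, 2)) ∨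
      Merges (D.circleAt β) (D.circleAt α) (Sum.inl (c, 0)) (Sum.inl (c, 2)) := by
  subst hβ
  exact D.merges_or_merges hc

lemma deg_of_incidence_ne_zero {S T : D.EnhancedState} (h : D.incidence S T ≠ 0) :
    T.deg = S.deg - 1 := by
  obtain ⟨c, hc, hT⟩ := exists_of_incidence_ne_zero h
  rw [incidence_eq_saddleCoeff hc hT, saddleCoeff_eq] at h
  rw [EnhancedState.deg_eq_sum, EnhancedState.deg_eq_sum]
  exact sum_eq_of_saddleMatrix_ne_zero (D.circleAt_surjective _) (D.circleAt_surjective _)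
    (merges_or_merges_of_eq hc hT) h

open Classical in
/-- The sum over the paths from `S` to `U` through the smoothing `β`. -/
noncomputable def pathSum (D : LinkDiagram) (β : Finset (Fin D.N)) (S U : D.EnhancedState) : ℤ :=
  ∑ T : D.EnhancedState, if T.ones = β then D.incidence S T * D.incidence T U else 0

lemma exists_of_pathSum_ne_zero {β : Finset (Fin D.N)} {S U : D.EnhancedState}
    (h : D.pathSum β S U ≠ 0) :
    (∃ a b, a ∉ S.ones ∧ b ∉ S.ones ∧ a ≠ b ∧ β = insert a S.ones ∧
      U.ones = insert b (insert a S.ones)) ∧ U.deg = S.deg - 2 := by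
  obtain ⟨T, -, hT⟩ := Finset.exists_ne_zero_of_sum_ne_zero h
  obtain ⟨rfl, hT'⟩ := ite_ne_right_iff.1 hT
  have h1 := left_ne_zero_of_mul hT'
  have h2 := right_ne_zero_of_mul hT'
  obtain ⟨a, ha, hT⟩ := exists_of_incidence_ne_zero h1
  obtain ⟨b, hb, hU⟩ := exists_of_incidence_ne_zero h2
  rw [hT] at hb hU
  simp only [Finset.mem_insert, not_or] at hb
  refine ⟨⟨a, b, ha, hb.2, Ne.symm hb.1, hT, hU⟩, ?_⟩
  rw [deg_of_incidence_ne_zero h2, deg_of_incidence_ne_zero h1]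
  ring

-- The enhanced states on a fixed smoothing are its labellings, so the sum over paths is an entry of
-- a matrix product.
open Classical in
lemma pathSum_eq {S U : D.EnhancedState} {a b : Fin D.N} (ha : a ∉ S.ones) (hb : b ∉ S.ones)
    (hab : a ≠ b) (hU : U.ones = insert b (insert a S.ones)) :
    D.pathSum (insert a S.ones) S U =
      (saddleMatrix (D.circleAt S.ones) (D.circleAt (insert a S.ones)) (Sum.inl (a, 0))
          (Sum.inl (a, 2)) *
        saddleMatrix (D.circleAt (insert a S.ones)) (D.circleAt U.ones) (Sum.inl (b, 0))
          (Sum.inl (b, 2))) S.label U.label := by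
  classical
  have hb' : b ∉ insert a S.ones := by simp [hb, hab.symm]
  rw [pathSum, Matrix.mul_apply, ← Finset.sum_filter]
  symm
  refine Finset.sum_bij' (fun m _ => (⟨insert a S.ones, m⟩ : D.EnhancedState))
    (fun T hT => (Finset.mem_filter.1 hT).2 ▸ T.label) ?_ ?_ ?_ ?_ ?_
  · intro m _
    simp
  · intro T _
    simp
  · intro m _
    rfl
  · rintro ⟨β, m⟩ hT
    obtain rfl : β = insert a S.ones := (Finset.mem_filter.1 hT).2
    rfl
  · intro m _
    rw [incidence_eq_saddleCoeff ha rfl, incidence_eq_saddleCoeff (T := U) hb' hU, saddleCoeff_eq,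
      saddleCoeff_eq]

/-- The two paths around a square contribute equally. -/
theorem pathSum_comm {S U : D.EnhancedState} {a b : Fin D.N} (ha : a ∉ S.ones) (hb : b ∉ S.ones)
    (hab : a ≠ b) (hU : U.ones = insert b (insert a S.ones)) :
    D.pathSum (insert a S.ones) S U = D.pathSum (insert b S.ones) S U := by
  have hU' : U.ones = insert a (insert b S.ones) := by rw [hU, Finset.insert_comm]
  rw [pathSum_eq ha hb hab hU, pathSum_eq hb ha hab.symm hU']
  convert congrFun (congrFun (saddleMatrix_mul_saddleMatrix (D.circleAt_surjective _)
    (D.circleAt_surjective _) (D.circleAt_surjective _) (D.circleAt_surjective _)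
    (D.merges_or_merges ha)
    (merges_or_merges_of_eq (β := U.ones) (c := b) (by simp [hb, hab.symm]) hU)
    (D.merges_or_merges hb)
    (merges_or_merges_of_eq (c := a) (by simp [ha, hab]) hU')) S.label) U.label

/-- Only two intermediate smoothings lie between `S` and `U`, with equal path sums. This reduces the
identities of the cube to identities between the weights `g`. -/
lemma sum_mul_pathSum {S U : D.EnhancedState} {a b : Fin D.N} (ha : a ∉ S.ones) (hb : b ∉ S.ones)
    (hab : a ≠ b) (hU : U.ones = insert b (insert a S.ones)) (g : Finset (Fin D.N) → ℤ) :
    ∑ β, g β * D.pathSum β S U =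
      (g (insert a S.ones) + g (insert b S.ones)) * D.pathSum (insert a S.ones) S U := by
  have hne : insert a S.ones ≠ insert b S.ones := by
    intro e
    have : a ∈ insert b S.ones := e ▸ Finset.mem_insert_self a S.ones
    simp [ha, hab] at this
  rw [← Finset.sum_subset (Finset.subset_univ {insert a S.ones, insert b S.ones}),
    Finset.sum_pair hne, ← pathSum_comm ha hb hab hU, add_mul]
  intro β _ hβ
  by_contra h
  obtain ⟨⟨a', b', ha', hb', hab', rfl, hU'⟩, -⟩ :=
    exists_of_pathSum_ne_zero (right_ne_zero_of_mul h)
  have h1 : a' ∈ insert b (insert a S.ones) := by rw [← hU, hU']; simp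
  simp only [Finset.mem_insert] at h1
  rcases h1 with rfl | rfl | h1
  · simp at hβ
  · simp at hβ
  · exact ha' h1

-- An incidence lowers the degree by one, so the quantum degree condition on the middle state
-- depends only on `S` and can be taken out of the sum.
open Classical in
lemma sum_gen (F x : Finset (Fin D.N)) (i j : ℤ) (σ : Finset (Fin D.N) → ℤ)
    (S U : D.EnhancedState) :
    ∑ T : D.Gen F x i j, σ T.1.ones * (D.incidence S T.1 * D.incidence T.1 U) =
      if S.deg - 1 + (F.card - i) = j then
        ∑ β : Finset (Fin D.N),
          (if β \ F = x ∧ ((β ∩ F).card : ℤ) = F.card - i then σ β else 0) * D.pathSum β S U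
      else 0 := by
  have h1 : ∀ g : Finset (Fin D.N) → ℤ, ∑ β, g β * D.pathSum β S U =
      ∑ T : D.EnhancedState, g T.ones * (D.incidence S T * D.incidence T U) := by
    intro g
    simp only [pathSum, Finset.mul_sum]
    rw [Finset.sum_comm]
    refine Finset.sum_congr rfl fun T _ => ?_
    simp
  rw [h1, ← Finset.sum_subtype (Finset.univ.filter fun T : D.EnhancedState => T.ones \ F = x ∧
      ((T.ones ∩ F).card : ℤ) = F.card - i ∧ T.deg + (T.ones ∩ F).card = j) (by simp)
      (fun T => σ T.ones * (D.incidence S T * D.incidence T U)), Finset.sum_filter]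
  have h2 : ∀ T : D.EnhancedState, (if T.ones \ F = x ∧ ((T.ones ∩ F).card : ℤ) = F.card - i ∧
      T.deg + (T.ones ∩ F).card = j then σ T.ones * (D.incidence S T * D.incidence T U) else 0) =
      if S.deg - 1 + (F.card - i) = j then
        (if T.ones \ F = x ∧ ((T.ones ∩ F).card : ℤ) = F.card - i then σ T.ones else 0) *
          (D.incidence S T * D.incidence T U) else 0 := by
    intro T
    by_cases hT : D.incidence S T = 0
    · simp [hT]
    · rw [deg_of_incidence_ne_zero hT]
      by_cases hx : T.ones \ F = x <;> by_cases hi : ((T.ones ∩ F).card : ℤ) = F.card - i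
      · simp [hx, hi]
      all_goals simp [hx, hi]
  simp only [h2]
  split_ifs <;> simp

/-- In a square of smoothings with a change of rank by one on `F`, one of the two crossings is
in `F`. -/
lemma exists_mem_of_card {α F : Finset (Fin D.N)} {a b : Fin D.N} (ha : a ∉ α) (hb : b ∉ α)
    (hab : a ≠ b) :
    ((insert b (insert a α) ∩ F).card : ℤ) =
      (α ∩ F).card + (if a ∈ F then 1 else 0) + if b ∈ F then 1 else 0 := by
  have hbα : b ∉ insert a α := by simp [hb, hab.symm]
  have key : ∀ (β : Finset (Fin D.N)) c, c ∉ β → ((insert c β ∩ F).card : ℤ) =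
      (β ∩ F).card + if c ∈ F then 1 else 0 := by
    intro β c hc
    split_ifs with h
    · rw [Finset.insert_inter_of_mem h, Finset.card_insert_of_notMem (by simp [hc])]
      push_cast; rfl
    · rw [Finset.insert_inter_of_notMem h, add_zero]
  rw [key _ _ hbα, key _ _ ha]

variable (R : Type u) [CommRing R]

lemma khD_comp_khD (F x : Finset (Fin D.N)) (j i i' i'' : ℤ) :
    D.khD R F x j i' i'' ∘ₗ D.khD R F x j i i' = 0 := by
  by_cases hi : i' + 1 = i
  swap
  · rw [khD_eq_zero F x j i i' hi, LinearMap.comp_zero]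
  by_cases hi' : i'' + 1 = i'
  swap
  · rw [khD_eq_zero F x j i' i'' hi', LinearMap.zero_comp]
  unfold khD
  rw [matrixMap_comp]
  have h0 : ∀ (S : D.Gen F x i j) (U : D.Gen F x i'' j),
      ∑ T : D.Gen F x i' j, edgeSign (S.1.ones ∩ F) (T.1.ones ∩ F) * D.incidence S.1 T.1 *
        (edgeSign (T.1.ones ∩ F) (U.1.ones ∩ F) * D.incidence T.1 U.1) = 0 := by
    rintro ⟨S, hS1, hS2, hS3⟩ ⟨U, hU1, hU2, hU3⟩
    have h1 := sum_gen F x i' j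
      (fun β => edgeSign (S.ones ∩ F) (β ∩ F) * edgeSign (β ∩ F) (U.ones ∩ F)) S U
    refine (Finset.sum_congr rfl fun T _ => ?_).trans (h1.trans ?_)
    · dsimp only
      ring
    split_ifs
    swap
    · rfl
    by_cases h : ∀ β, D.pathSum β S U = 0
    · exact Finset.sum_eq_zero fun β _ => by rw [h, mul_zero]
    obtain ⟨β, hβ⟩ := not_forall.1 h
    obtain ⟨⟨a, b, ha, hb, hab, -, hU⟩, -⟩ := exists_of_pathSum_ne_zero hβ
    rw [sum_mul_pathSum ha hb hab hU]
    have hc := exists_mem_of_card (F := F) ha hb hab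
    rw [← hU, hU2, hS2] at hc
    -- The rank on `F` rises by two, so neither crossing can lie outside `F`. The two paths then
    -- form a square of the cube on `F`, whose signs cancel.
    have haF : a ∈ F := by
      by_contra haF; rw [if_neg haF] at hc; split_ifs at hc <;> omega
    have hbF : b ∈ F := by
      by_contra hbF; rw [if_neg hbF] at hc; split_ifs at hc <;> omega
    have hcard : ∀ c ∈ F, c ∉ S.ones → ((insert c S.ones ∩ F).card : ℤ) = F.card - i' := by
      intro c hcF hc
      rw [Finset.insert_inter_of_mem hcF, Finset.card_insert_of_notMem (by simp [hc])]
      push_cast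
      omega
    rw [if_pos ⟨by rw [Finset.insert_sdiff_of_mem _ haF, hS1], hcard a haF ha⟩,
      if_pos ⟨by rw [Finset.insert_sdiff_of_mem _ hbF, hS1], hcard b hbF hb⟩, hU,
      Finset.insert_inter_of_mem hbF, Finset.insert_inter_of_mem haF,
      Finset.insert_inter_of_mem hbF]
    have hsq := IsKhovanovCube.edgeSign_square (x := S.ones ∩ F) (a := a) (b := b)
      (by simp [ha]) (by simp [hb]) hab
    rw [Finset.insert_comm a b] at hsq
    rw [hsq, zero_mul]
  simp only [h0]
  ext a b
  simp [matrixMap]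

/-- On each side a single intermediate smoothing survives: first `a`, then `b` on the left, and the
opposite order on the right. The free crossing `b` does not affect the sign, which is computed
inside `F`. -/
lemma sum_saddle_khD_aux {F x y : Finset (Fin D.N)} {j i i' : ℤ} (hi : i' + 1 = i)
    {S U : D.EnhancedState} (hS1 : S.ones \ F = x) (hS2 : ((S.ones ∩ F).card : ℤ) = F.card - i)
    (hS3 : S.deg + (S.ones ∩ F).card = j) (hU1 : U.ones \ F = y)
    (hU2 : ((U.ones ∩ F).card : ℤ) = F.card - i') (hxy : x ⋖ y) {a b : Fin D.N}
    (ha : a ∉ S.ones) (hb : b ∉ S.ones) (hab : a ≠ b) (hU : U.ones = insert b (insert a S.ones))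
    (haF : a ∈ F) (hbF : b ∉ F) :
    ∑ T : D.Gen F x i' j, edgeSign (S.ones ∩ F) (T.1.ones ∩ F) *
        (D.incidence S T.1 * D.incidence T.1 U) =
      ∑ T : D.Gen F y i (j - 1), edgeSign (T.1.ones ∩ F) (U.ones ∩ F) *
        (D.incidence S T.1 * D.incidence T.1 U) := by
  rw [sum_gen F x i' j (fun β => edgeSign (S.ones ∩ F) (β ∩ F)),
    sum_gen F y i (j - 1) (fun β => edgeSign (β ∩ F) (U.ones ∩ F)), if_pos (by omega),
    if_pos (by omega), sum_mul_pathSum ha hb hab hU, sum_mul_pathSum ha hb hab hU]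
  have h1 : insert a S.ones \ F = x := by rw [Finset.insert_sdiff_of_mem _ haF, hS1]
  have h2 : insert b S.ones \ F = y := by
    rw [← hU1, hU, Finset.insert_sdiff_of_notMem _ hbF, Finset.insert_sdiff_of_notMem _ hbF,
      Finset.insert_sdiff_of_mem _ haF]
  have h3 : insert b S.ones ∩ F = S.ones ∩ F := Finset.insert_inter_of_notMem hbF
  have h4 : insert a S.ones ∩ F = U.ones ∩ F := by
    rw [hU, Finset.insert_inter_of_notMem hbF]
  rw [if_pos ⟨h1, by rw [h4, hU2]⟩, if_neg fun h => hxy.ne (h.1.symm.trans h2),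
    if_neg fun h => hxy.ne (h1.symm.trans h.1), if_pos ⟨h2, by rw [h3, hS2]⟩, h3, h4]
  ring

lemma saddle_comp_khD (F x y : Finset (Fin D.N)) (j j' i i' : ℤ) :
    D.saddle R F x y j j' i' ∘ₗ D.khD R F x j i i' =
      D.khD R F y j' i i' ∘ₗ D.saddle R F x y j j' i := by
  by_cases hi : i' + 1 = i
  swap
  · rw [khD_eq_zero F x j i i' hi, khD_eq_zero F y j' i i' hi, LinearMap.comp_zero,
      LinearMap.zero_comp]
  unfold khD saddle
  rw [matrixMap_comp, matrixMap_comp]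
  congr 1
  funext S U
  obtain ⟨S, hS1, hS2, hS3⟩ := S
  obtain ⟨U, hU1, hU2, hU3⟩ := U
  by_cases hxy : x ⋖ y
  swap
  · simp [hxy]
  simp only [hxy, if_true]
  have hL : ∀ T : D.Gen F x i' j, edgeSign (S.ones ∩ F) (T.1.ones ∩ F) * D.incidence S T.1 *
      D.incidence T.1 U = edgeSign (S.ones ∩ F) (T.1.ones ∩ F) *
        (D.incidence S T.1 * D.incidence T.1 U) := fun T => by ring
  have hR : ∀ T : D.Gen F y i j', D.incidence S T.1 * (edgeSign (T.1.ones ∩ F) (U.ones ∩ F) *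
      D.incidence T.1 U) = edgeSign (T.1.ones ∩ F) (U.ones ∩ F) *
        (D.incidence S T.1 * D.incidence T.1 U) := fun T => by ring
  simp only [hL, hR]
  by_cases h : ∀ β, D.pathSum β S U = 0
  · rw [sum_gen F x i' j (fun β => edgeSign (S.ones ∩ F) (β ∩ F)),
      sum_gen F y i j' (fun β => edgeSign (β ∩ F) (U.ones ∩ F))]
    simp [h]
  obtain ⟨β, hβ⟩ := not_forall.1 h
  obtain ⟨⟨a, b, ha, hb, hab, -, hU⟩, hUdeg⟩ := exists_of_pathSum_ne_zero hβ
  obtain rfl : j' = j - 1 := by omega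
  have hc := exists_mem_of_card (F := F) ha hb hab
  rw [← hU, hU2, hS2] at hc
  -- The rank on `F` rises by exactly one, so exactly one of the two crossings is in `F`.
  by_cases haF : a ∈ F
  · have hbF : b ∉ F := by
      intro hbF; rw [if_pos haF, if_pos hbF] at hc; omega
    exact sum_saddle_khD_aux hi hS1 hS2 hS3 hU1 hU2 hxy ha hb hab hU haF hbF
  · have hbF : b ∈ F := by
      by_contra hbF; rw [if_neg haF, if_neg hbF] at hc; omega
    exact sum_saddle_khD_aux hi hS1 hS2 hS3 hU1 hU2 hxy hb ha hab.symm
      (by rw [hU, Finset.insert_comm]) hbF haF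

/-- The vertex `y` is `insert a x` or `insert b x`, and only the corresponding path contributes. The
path sums are equal, so the value does not depend on which vertex it is. -/
lemma sum_saddle_saddle_aux {F x y z : Finset (Fin D.N)} {i j : ℤ} (h1 : x ⋖ y) (h2 : y ⋖ z)
    {S U : D.EnhancedState} (hS1 : S.ones \ F = x) (hS2 : ((S.ones ∩ F).card : ℤ) = F.card - i)
    (hU1 : U.ones \ F = z) {a b : Fin D.N}
    (ha : a ∉ S.ones) (hb : b ∉ S.ones) (hab : a ≠ b) (hU : U.ones = insert b (insert a S.ones))
    (haF : a ∉ F) (hbF : b ∉ F) :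
    ∑ T : D.Gen F y i j, D.incidence S T.1 * D.incidence T.1 U =
      if S.deg - 1 + (F.card - i) = j then D.pathSum (insert a S.ones) S U else 0 := by
  have h := sum_gen F y i j (fun _ => 1) S U
  simp only [one_mul] at h
  rw [h]
  refine if_congr Iff.rfl ?_ rfl
  rw [sum_mul_pathSum ha hb hab hU]
  have e1 : insert a S.ones \ F = insert a x := by
    rw [Finset.insert_sdiff_of_notMem _ haF, hS1]
  have e2 : insert b S.ones \ F = insert b x := by
    rw [Finset.insert_sdiff_of_notMem _ hbF, hS1]
  have e3 : z = insert b (insert a x) := by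
    rw [← hU1, hU, Finset.insert_sdiff_of_notMem _ hbF, e1]
  have hax : a ∉ x := fun h => ha (Finset.mem_sdiff.1 (hS1 ▸ h)).1
  have hbx : b ∉ x := fun h => hb (Finset.mem_sdiff.1 (hS1 ▸ h)).1
  have hne : insert a x ≠ insert b x := by
    intro e
    have : a ∈ insert b x := e ▸ Finset.mem_insert_self a x
    simp [hax, hab] at this
  obtain ⟨c, hc, rfl⟩ := Finset.covBy_iff_exists_insert.1 h1
  have hcz : c ∈ insert b (insert a x) := e3 ▸ h2.le (Finset.mem_insert_self c x)
  rw [e1, e2, Finset.insert_inter_of_notMem haF, Finset.insert_inter_of_notMem hbF]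
  simp only [hS2, and_true]
  simp only [Finset.mem_insert] at hcz
  rcases hcz with rfl | rfl | hcz
  · rw [if_neg hne, if_pos rfl, zero_add, one_mul]
  · rw [if_neg hne.symm, if_pos rfl, add_zero, one_mul]
  · exact absurd hcz hc

lemma saddle_comp_saddle (F x y y' z : Finset (Fin D.N)) (j j' j'' i : ℤ) (h1 : x ⋖ y)
    (h2 : y ⋖ z) (h3 : x ⋖ y') (h4 : y' ⋖ z) :
    D.saddle R F y z j' j'' i ∘ₗ D.saddle R F x y j j' i =
      D.saddle R F y' z j' j'' i ∘ₗ D.saddle R F x y' j j' i := by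
  unfold saddle
  rw [matrixMap_comp, matrixMap_comp]
  congr 1
  funext S U
  obtain ⟨S, hS1, hS2, hS3⟩ := S
  obtain ⟨U, hU1, hU2, hU3⟩ := U
  simp only [h1, h2, h3, h4, if_true]
  by_cases h : ∀ β, D.pathSum β S U = 0
  · have e1 := sum_gen F y i j' (fun _ => 1) S U
    have e2 := sum_gen F y' i j' (fun _ => 1) S U
    simp only [one_mul, h, mul_zero, Finset.sum_const_zero, ite_self] at e1 e2
    rw [e1, e2]
  obtain ⟨β, hβ⟩ := not_forall.1 h
  obtain ⟨⟨a, b, ha, hb, hab, -, hU⟩, -⟩ := exists_of_pathSum_ne_zero hβ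
  have hc := exists_mem_of_card (F := F) ha hb hab
  rw [← hU, hU2, hS2] at hc
  have haF : a ∉ F := by
    intro haF; rw [if_pos haF] at hc; split_ifs at hc <;> omega
  have hbF : b ∉ F := by
    intro hbF; rw [if_pos hbF] at hc; split_ifs at hc <;> omega
  rw [sum_saddle_saddle_aux h1 h2 hS1 hS2 hU1 ha hb hab hU haF hbF,
    sum_saddle_saddle_aux h3 h4 hS1 hS2 hU1 ha hb hab hU haF hbF]

theorem isKhovanovCube (D : LinkDiagram) : D.IsKhovanovCube R where
  d_comp_d := khD_comp_khD R
  saddle_comp_d := saddle_comp_khD R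
  saddle_comp_saddle := saddle_comp_saddle R

end LinkDiagram

/-! ## Homology classes in complexes of modules -/

lemma ModuleCat.hom_apply_hom_apply {R : Type u} [CommRing R] {X Y Z : ModuleCat.{u} R}
    (f : X ⟶ Y) (g : Y ⟶ Z) (x : X) : g.hom (f.hom x) = (f ≫ g).hom x := rfl

namespace HomologicalComplex

variable {R : Type u} [CommRing R] {ι : Type*} {c : ComplexShape ι}

lemma d_hom_d_hom (K : HomologicalComplex (ModuleCat.{u} R) c) (i j k : ι) (x : K.X i) :
    (K.d j k).hom ((K.d i j).hom x) = 0 := by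
  rw [ModuleCat.hom_apply_hom_apply, K.d_comp_d]
  rfl

lemma iCycles_injective (K : HomologicalComplex (ModuleCat.{u} R) c) (i : ι) :
    Function.Injective (K.iCycles i).hom :=
  (ModuleCat.mono_iff_injective _).1 inferInstance

/-- The submodule of cycles, as a map to the object of cycles. -/
noncomputable def kerToCycles (K : HomologicalComplex (ModuleCat.{u} R) c) {i j : ι}
    (hj : c.next i = j) : LinearMap.ker (K.d i j).hom →ₗ[R] K.cycles i :=
  (K.liftCycles (ModuleCat.ofHom (LinearMap.ker (K.d i j).hom).subtype) j hj
    (by ext x; exact x.2)).hom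

lemma iCycles_kerToCycles (K : HomologicalComplex (ModuleCat.{u} R) c) {i j : ι}
    (hj : c.next i = j) (x : LinearMap.ker (K.d i j).hom) :
    (K.iCycles i).hom (K.kerToCycles hj x) = x.1 := by
  unfold kerToCycles
  refine (ModuleCat.hom_apply_hom_apply _ _ _).trans ?_
  rw [K.liftCycles_i]
  rfl

/-- The homology class of a cycle. -/
noncomputable def cycleClass (K : HomologicalComplex (ModuleCat.{u} R) c) {i j : ι}
    (hj : c.next i = j) : LinearMap.ker (K.d i j).hom →ₗ[R] K.homology i :=
  (K.homologyπ i).hom ∘ₗ K.kerToCycles hj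

lemma cycleClass_surjective (K : HomologicalComplex (ModuleCat.{u} R) c) {i j : ι}
    (hj : c.next i = j) : Function.Surjective (K.cycleClass hj) := by
  intro h
  obtain ⟨z, rfl⟩ := (ModuleCat.epi_iff_surjective (K.homologyπ i)).1 inferInstance h
  have hz : (K.iCycles i).hom z ∈ LinearMap.ker (K.d i j).hom := by
    rw [LinearMap.mem_ker, ModuleCat.hom_apply_hom_apply, K.iCycles_d]
    rfl
  exact ⟨⟨_, hz⟩, congrArg (K.homologyπ i).hom
    (K.iCycles_injective i (K.iCycles_kerToCycles hj ⟨_, hz⟩))⟩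

/-- Homology is the cokernel of `toCycles`, and exactness of modules can be tested on elements. -/
lemma cycleClass_eq_zero_iff (K : HomologicalComplex (ModuleCat.{u} R) c) {i j k : ι}
    (hj : c.next i = j) (hk : c.prev i = k) (x : LinearMap.ker (K.d i j).hom) :
    K.cycleClass hj x = 0 ↔ ∃ y, (K.d k i).hom y = x.1 := by
  have hex : (ShortComplex.mk (K.toCycles k i) (K.homologyπ i) (by simp)).Exact :=
    ShortComplex.exact_of_g_is_cokernel _ (K.homologyIsCokernel k i hk)
  rw [ShortComplex.moduleCat_exact_iff] at hex
  have hti : ∀ y, (K.iCycles i).hom ((K.toCycles k i).hom y) = (K.d k i).hom y := by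
    intro y
    rw [ModuleCat.hom_apply_hom_apply, K.toCycles_i]
  constructor
  · intro h
    obtain ⟨y, hy⟩ := hex (K.kerToCycles hj x) h
    refine ⟨y, ?_⟩
    rw [← hti, ← K.iCycles_kerToCycles hj]
    exact congrArg _ hy
  · rintro ⟨y, hy⟩
    have : (K.toCycles k i).hom y = K.kerToCycles hj x :=
      K.iCycles_injective i (by rw [hti, iCycles_kerToCycles, hy])
    rw [cycleClass, LinearMap.comp_apply, ← this, ModuleCat.hom_apply_hom_apply,
      K.toCycles_comp_homologyπ]
    rfl

lemma cycleClass_eq_iff (K : HomologicalComplex (ModuleCat.{u} R) c) {i j k : ι}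
    (hj : c.next i = j) (hk : c.prev i = k) (x x' : LinearMap.ker (K.d i j).hom) :
    K.cycleClass hj x = K.cycleClass hj x' ↔ ∃ y, (K.d k i).hom y = x.1 - x'.1 := by
  rw [← sub_eq_zero, ← map_sub, K.cycleClass_eq_zero_iff hj hk]
  rfl

lemma homologyMap_cycleClass {K L : HomologicalComplex (ModuleCat.{u} R) c} (f : K ⟶ L) {i j : ι}
    (hj : c.next i = j) (x : LinearMap.ker (K.d i j).hom)
    (hx : (f.f i).hom x.1 ∈ LinearMap.ker (L.d i j).hom) :
    (homologyMap f i).hom (K.cycleClass hj x) = L.cycleClass hj ⟨(f.f i).hom x.1, hx⟩ := by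
  have h1 : (cyclesMap f i).hom (K.kerToCycles hj x) =
      L.kerToCycles hj ⟨(f.f i).hom x.1, hx⟩ := by
    refine L.iCycles_injective i ?_
    rw [iCycles_kerToCycles, ModuleCat.hom_apply_hom_apply, cyclesMap_i,
      ← ModuleCat.hom_apply_hom_apply, iCycles_kerToCycles]
  rw [cycleClass, cycleClass, LinearMap.comp_apply, LinearMap.comp_apply, ← h1,
    ModuleCat.hom_apply_hom_apply, homologyπ_naturality, ← ModuleCat.hom_apply_hom_apply]

end HomologicalComplex

/-! ## The spectral sequence of a filtered complex of modules -/

/-- An increasing filtration of a chain complex of modules, finite in each degree. -/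
structure ChainFiltration {R : Type u} [CommRing R] (K : ChainComplex (ModuleCat.{u} R) ℤ) where
  /-- the steps of the filtration -/
  F : ℤ → ∀ n, Submodule R (K.X n)
  mono : ∀ n, Monotone fun p => F p n
  d_mem : ∀ p n m x, x ∈ F p n → (K.d n m).hom x ∈ F p m
  exists_eq_bot : ∀ n, ∃ a, F a n = ⊥
  exists_eq_top : ∀ n, ∃ b, F b n = ⊤

namespace ChainFiltration

variable {R : Type u} [CommRing R] {K : ChainComplex (ModuleCat.{u} R) ℤ} (Φ : ChainFiltration K)

lemma mem_of_le {p p' n : ℤ} (h : p ≤ p') {x : K.X n} (hx : x ∈ Φ.F p n) : x ∈ Φ.F p' n :=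
  Φ.mono n h hx

/-- The chains in `F p` whose boundary is in `F (p - r)`. -/
def Z (r p n : ℤ) : Submodule R (K.X n) :=
  Φ.F p n ⊓ ⨅ m, (Φ.F (p - r) m).comap (K.d n m).hom

lemma mem_Z {r p n : ℤ} {x : K.X n} :
    x ∈ Φ.Z r p n ↔ x ∈ Φ.F p n ∧ ∀ m, (K.d n m).hom x ∈ Φ.F (p - r) m := by
  simp [Z]

/-- The submodule of `Z r p n` that vanishes on the page `r`. -/
def B (r p n : ℤ) : Submodule R (K.X n) :=
  Φ.Z (r - 1) (p - 1) n ⊔ (Φ.Z (r - 1) (p + r - 1) (n + 1)).map (K.d (n + 1) n).hom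

lemma mem_B {r p n : ℤ} {x : K.X n} :
    x ∈ Φ.B r p n ↔ ∃ w ∈ Φ.Z (r - 1) (p - 1) n, ∃ z ∈ Φ.Z (r - 1) (p + r - 1) (n + 1),
      w + (K.d (n + 1) n).hom z = x := by
  rw [B, Submodule.mem_sup]
  simp [Submodule.mem_map]

lemma d_mem_Z {r p n p' n' : ℤ} (hp : p' = p - r) {x : K.X n} (hx : x ∈ Φ.Z r p n) :
    (K.d n n').hom x ∈ Φ.Z r p' n' := by
  rw [mem_Z] at hx ⊢
  subst hp
  refine ⟨hx.2 n', fun m => ?_⟩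
  rw [K.d_hom_d_hom]
  exact Submodule.zero_mem _

/-- The boundary of the summand in `Z (r - 1) (p - 1)` is of the second type in `B` at the target,
because `(p - r) + r - 1 = p - 1`; the other summand is already a boundary. -/
lemma d_mem_B {r p n p' n' : ℤ} (hp : p' = p - r) (hn : n' + 1 = n) {x : K.X n}
    (hx : x ∈ Φ.B r p n) : (K.d n n').hom x ∈ Φ.B r p' n' := by
  subst hn hp
  obtain ⟨w, hw, z, -, rfl⟩ := Φ.mem_B.1 hx
  refine Φ.mem_B.2 ⟨0, Submodule.zero_mem _, w, ?_, ?_⟩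
  · rw [sub_add_cancel]; exact hw
  · rw [map_add, K.d_hom_d_hom, add_zero, zero_add]

/-- The term `E^r_{p,n-p}`. -/
abbrev E (r p n : ℤ) : Type u := Φ.Z r p n ⧸ (Φ.B r p n).submoduleOf (Φ.Z r p n)

/-- The class of a chain in `E^r_{p,n-p}`. -/
abbrev mkE (r p n : ℤ) : Φ.Z r p n →ₗ[R] Φ.E r p n := Submodule.mkQ _

lemma mkE_eq_zero_iff {r p n : ℤ} (x : Φ.Z r p n) : Φ.mkE r p n x = 0 ↔ x.1 ∈ Φ.B r p n := by
  rw [Submodule.mkQ_apply, Submodule.Quotient.mk_eq_zero]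
  rfl

lemma mkE_eq_iff {r p n : ℤ} (x y : Φ.Z r p n) :
    Φ.mkE r p n x = Φ.mkE r p n y ↔ x.1 - y.1 ∈ Φ.B r p n := by
  rw [← sub_eq_zero, ← map_sub, mkE_eq_zero_iff]
  rfl

lemma mkE_surjective (r p n : ℤ) : Function.Surjective (Φ.mkE r p n) := Submodule.mkQ_surjective _

/-- The differential of the page `r`. -/
def dE {r p n p' n' : ℤ} (hp : p' = p - r) (hn : n' + 1 = n) : Φ.E r p n →ₗ[R] Φ.E r p' n' :=
  Submodule.mapQ _ _ ((K.d n n').hom.restrict fun _ hx => Φ.d_mem_Z hp hx) fun _ hx => Φ.d_mem_B hp hn hx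

lemma dE_mkE {r p n p' n' : ℤ} (hp : p' = p - r) (hn : n' + 1 = n) (x : Φ.Z r p n) :
    Φ.dE hp hn (Φ.mkE r p n x) = Φ.mkE r p' n' ⟨(K.d n n').hom x.1, Φ.d_mem_Z hp x.2⟩ := rfl

lemma dE_dE {r p n p' n' p'' n'' : ℤ} (hp : p' = p - r) (hn : n' + 1 = n) (hp' : p'' = p' - r)
    (hn' : n'' + 1 = n') (e : Φ.E r p n) : Φ.dE hp' hn' (Φ.dE hp hn e) = 0 := by
  obtain ⟨x, rfl⟩ := Φ.mkE_surjective _ _ _ e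
  rw [dE_mkE, dE_mkE, mkE_eq_zero_iff]
  change (K.d n' n'').hom ((K.d n n').hom x.1) ∈ _
  rw [K.d_hom_d_hom]
  exact Submodule.zero_mem _

lemma rel_iff {r : ℤ} {s t : ℤ × ℤ} :
    (ComplexShape.up' ((-r, r - 1) : ℤ × ℤ)).Rel s t ↔ t.1 = s.1 - r ∧ t.2 = s.2 + r - 1 := by
  change s + (-r, r - 1) = t ↔ _
  rw [Prod.ext_iff]
  simp only [Prod.fst_add, Prod.snd_add]
  omega

open Classical in
/-- The page `r` of the spectral sequence. -/
noncomputable def page (r : ℤ) :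
    HomologicalComplex (ModuleCat.{u} R) (ComplexShape.up' ((-r, r - 1) : ℤ × ℤ)) where
  X s := ModuleCat.of R (Φ.E r s.1 (s.1 + s.2))
  d s t := if h : t.1 = s.1 - r ∧ t.2 = s.2 + r - 1 then
    ModuleCat.ofHom (Φ.dE h.1 (by omega)) else 0
  shape s t h := dif_neg fun h' => h (rel_iff.2 h')
  d_comp_d' s t v h h' := by
    rw [rel_iff] at h h'
    rw [dif_pos h, dif_pos h', ← ModuleCat.ofHom_comp]
    exact ModuleCat.hom_ext (LinearMap.ext fun e =>
      Φ.dE_dE h.1 (by omega) h'.1 (by omega) e)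

/-- The class of a chain in the page `r`. -/
noncomputable def pageMk (r : ℤ) (s : ℤ × ℤ) : Φ.Z r s.1 (s.1 + s.2) →ₗ[R] (Φ.page r).X s :=
  Φ.mkE r s.1 (s.1 + s.2)

lemma pageMk_surjective (r : ℤ) (s : ℤ × ℤ) : Function.Surjective (Φ.pageMk r s) :=
  Φ.mkE_surjective _ _ _

lemma pageMk_eq_zero_iff {r : ℤ} {s : ℤ × ℤ} (x : Φ.Z r s.1 (s.1 + s.2)) :
    Φ.pageMk r s x = 0 ↔ x.1 ∈ Φ.B r s.1 (s.1 + s.2) := Φ.mkE_eq_zero_iff x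

lemma pageMk_eq_iff {r : ℤ} {s : ℤ × ℤ} (x y : Φ.Z r s.1 (s.1 + s.2)) :
    Φ.pageMk r s x = Φ.pageMk r s y ↔ x.1 - y.1 ∈ Φ.B r s.1 (s.1 + s.2) := Φ.mkE_eq_iff x y

lemma page_d_pageMk {r : ℤ} {s t : ℤ × ℤ} (h : t.1 = s.1 - r ∧ t.2 = s.2 + r - 1)
    (x : Φ.Z r s.1 (s.1 + s.2)) :
    ((Φ.page r).d s t).hom (Φ.pageMk r s x) =
      Φ.pageMk r t ⟨(K.d _ _).hom x.1, Φ.d_mem_Z h.1 x.2⟩ := by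
  have h1 : (Φ.page r).d s t = ModuleCat.ofHom (Φ.dE h.1 (by omega)) := dif_pos h
  rw [h1]
  rfl

lemma next_eq {r : ℤ} (s : ℤ × ℤ) :
    (ComplexShape.up' ((-r, r - 1) : ℤ × ℤ)).next s = (s.1 - r, s.2 + r - 1) :=
  ComplexShape.next_eq' _ (rel_iff.2 ⟨rfl, rfl⟩)

lemma prev_eq {r : ℤ} (s : ℤ × ℤ) :
    (ComplexShape.up' ((-r, r - 1) : ℤ × ℤ)).prev s = (s.1 + r, s.2 - r + 1) :=
  ComplexShape.prev_eq' _ (rel_iff.2 ⟨by simp, by dsimp only; ring⟩)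

lemma Z_succ_le (r p n : ℤ) : Φ.Z (r + 1) p n ≤ Φ.Z r p n := by
  intro x hx
  rw [mem_Z] at hx ⊢
  exact ⟨hx.1, fun m => Φ.mem_of_le (by omega) (hx.2 m)⟩

/-- The boundary of `x` is a cycle one filtration step deeper than the target requires. -/
lemma d_mem_B_of_mem_Z_succ {r p n p' n' : ℤ} (hp : p' = p - r) {x : K.X n}
    (hx : x ∈ Φ.Z (r + 1) p n) : (K.d n n').hom x ∈ Φ.B r p' n' := by
  rw [mem_Z] at hx
  refine Φ.mem_B.2 ⟨_, Φ.mem_Z.2 ⟨?_, fun m => ?_⟩, 0, Submodule.zero_mem _,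
    by rw [map_zero, add_zero]⟩
  · rw [show p' - 1 = p - (r + 1) by omega]; exact hx.2 n'
  · rw [K.d_hom_d_hom]; exact Submodule.zero_mem _

lemma page_d_pageMk_eq_zero {r : ℤ} {s t : ℤ × ℤ} (h : t.1 = s.1 - r ∧ t.2 = s.2 + r - 1)
    (x : K.X (s.1 + s.2)) (hx : x ∈ Φ.Z (r + 1) s.1 (s.1 + s.2)) :
    ((Φ.page r).d s t).hom (Φ.pageMk r s ⟨x, Φ.Z_succ_le r _ _ hx⟩) = 0 := by
  rw [Φ.page_d_pageMk h, pageMk_eq_zero_iff]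
  exact Φ.d_mem_B_of_mem_Z_succ h.1 hx

/-- The classes on the page `r` of the elements of `Z (r + 1) p n`. -/
noncomputable def toPageCycles (r : ℤ) (s t : ℤ × ℤ) (h : t.1 = s.1 - r ∧ t.2 = s.2 + r - 1) :
    Φ.Z (r + 1) s.1 (s.1 + s.2) →ₗ[R] LinearMap.ker ((Φ.page r).d s t).hom :=
  (Φ.pageMk r s ∘ₗ Submodule.inclusion (Φ.Z_succ_le r s.1 (s.1 + s.2))).codRestrict _ fun x =>
    Φ.page_d_pageMk_eq_zero h x.1 x.2

lemma toPageCycles_coe {r : ℤ} {s t : ℤ × ℤ} (h : t.1 = s.1 - r ∧ t.2 = s.2 + r - 1)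
    (x : Φ.Z (r + 1) s.1 (s.1 + s.2)) :
    (Φ.toPageCycles r s t h x).1 = Φ.pageMk r s ⟨x.1, Φ.Z_succ_le r _ _ x.2⟩ := rfl

/-- The map from `Z (r + 1) p n` to the homology of the page `r`. -/
noncomputable def toPageHomology (r : ℤ) (s : ℤ × ℤ) :
    Φ.Z (r + 1) s.1 (s.1 + s.2) →ₗ[R] (Φ.page r).homology s :=
  (Φ.page r).cycleClass (next_eq s) ∘ₗ Φ.toPageCycles r s _ ⟨rfl, rfl⟩

/-- If `dx = w + dz` with `w` one step deeper, then `x - z` has boundary `w`. As `z` lies in `B r p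
n`, the class on page `r` is unchanged, so every cycle of that page has a representative in `Z (r +
1)`. -/
lemma exists_sub_mem_Z_succ {r p n p' n' : ℤ} (hp : p' = p - r) (hn : n' + 1 = n) {x : K.X n}
    (hx : x ∈ Φ.Z r p n) (hd : (K.d n n').hom x ∈ Φ.B r p' n') :
    ∃ z ∈ Φ.Z (r - 1) (p - 1) n, x - z ∈ Φ.Z (r + 1) p n := by
  subst hn hp
  obtain ⟨w, hw, z, hz, hwz⟩ := Φ.mem_B.1 hd
  rw [sub_add_cancel] at hz
  refine ⟨z, hz, Φ.mem_Z.2 ⟨?_, fun m => ?_⟩⟩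
  · exact Submodule.sub_mem _ (Φ.mem_Z.1 hx).1 (Φ.mem_of_le (by omega) (Φ.mem_Z.1 hz).1)
  · by_cases hm : m = n'
    · subst hm
      rw [map_sub, ← hwz, add_sub_cancel_right]
      exact Φ.mem_of_le (by omega) (Φ.mem_Z.1 hw).1
    · rw [K.shape _ _ (by simp only [ComplexShape.down_Rel]; omega)]
      exact Submodule.zero_mem _

lemma Z_pred_le_B (r p n : ℤ) : Φ.Z (r - 1) (p - 1) n ≤ Φ.B r p n := le_sup_left

lemma toPageCycles_mk_eq {r : ℤ} {s t : ℤ × ℤ} (h : t.1 = s.1 - r ∧ t.2 = s.2 + r - 1)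
    (e : LinearMap.ker ((Φ.page r).d s t).hom) : ∃ x, Φ.toPageCycles r s t h x = e := by
  obtain ⟨e, he⟩ := e
  obtain ⟨⟨x, hx⟩, rfl⟩ := Φ.pageMk_surjective _ _ e
  have hd := he
  rw [LinearMap.mem_ker, Φ.page_d_pageMk h, pageMk_eq_zero_iff] at hd
  obtain ⟨z, hz, hxz⟩ := Φ.exists_sub_mem_Z_succ h.1 (by omega) hx hd
  refine ⟨⟨x - z, hxz⟩, Subtype.ext ?_⟩
  rw [toPageCycles_coe, pageMk_eq_iff]
  change x - z - x ∈ _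
  rw [sub_sub_cancel_left]
  exact Submodule.neg_mem _ (Φ.Z_pred_le_B _ _ _ hz)

lemma toPageHomology_surjective (r : ℤ) (s : ℤ × ℤ) :
    Function.Surjective (Φ.toPageHomology r s) := by
  intro h
  obtain ⟨e, rfl⟩ := (Φ.page r).cycleClass_surjective (next_eq s) h
  obtain ⟨x, rfl⟩ := Φ.toPageCycles_mk_eq ⟨rfl, rfl⟩ e
  exact ⟨x, rfl⟩

lemma mem_B_succ_iff {r p n p' n' : ℤ} (hp : p' = p + r) (hn : n' = n + 1) {x : K.X n}
    (hx : x ∈ Φ.Z (r + 1) p n) :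
    x ∈ Φ.B (r + 1) p n ↔ ∃ y ∈ Φ.Z r p' n', (K.d n' n).hom y - x ∈ Φ.B r p n := by
  subst hp hn
  rw [mem_B, add_sub_cancel_right, ← add_assoc, add_sub_cancel_right]
  constructor
  · rintro ⟨w, hw, z, hz, rfl⟩
    refine ⟨z, hz, ?_⟩
    rw [sub_add_cancel_right]
    refine Submodule.neg_mem _ (Φ.Z_pred_le_B _ _ _ (Φ.Z_succ_le _ _ _ ?_))
    rwa [sub_add_cancel]
  · rintro ⟨y, hy, hyx⟩
    obtain ⟨w, hw, z, hz, hwz⟩ := Φ.mem_B.1 hyx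
    -- The two conditions on `z` hold with indices `p + r - 1` and `(p + r - 1) - (r - 1) = p`, so
    -- `z` may be subtracted from `y`.
    have hzy : y - z ∈ Φ.Z r (p + r) (n + 1) := by
      refine Submodule.sub_mem _ hy (Φ.mem_Z.2 ⟨Φ.mem_of_le (by omega) (Φ.mem_Z.1 hz).1, fun m => ?_⟩)
      exact Φ.mem_of_le (by omega) ((Φ.mem_Z.1 hz).2 m)
    have hxw : x = -w + (K.d (n + 1) n).hom (y - z) := by
      rw [map_sub, eq_sub_of_add_eq hwz]
      abel
    refine ⟨-w, Φ.mem_Z.2 ⟨Submodule.neg_mem _ (Φ.mem_Z.1 hw).1, fun m => ?_⟩, y - z, hzy, hxw.symm⟩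
    -- Since `x` and `-w` differ by a boundary they have the same differential, and the stronger
    -- bound for `x` passes to `-w`.
    have h1 := (Φ.mem_Z.1 hx).2 m
    rw [hxw, map_add, K.d_hom_d_hom, add_zero] at h1
    rwa [show p - 1 - r = p - (r + 1) by ring]

lemma exists_d_eq_pageMk_iff {r : ℤ} {s v : ℤ × ℤ} (h : s.1 = v.1 - r ∧ s.2 = v.2 + r - 1)
    (x : Φ.Z (r + 1) s.1 (s.1 + s.2)) :
    (∃ e, ((Φ.page r).d v s).hom e = Φ.pageMk r s ⟨x.1, Φ.Z_succ_le r _ _ x.2⟩) ↔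
      x.1 ∈ Φ.B (r + 1) s.1 (s.1 + s.2) := by
  rw [Φ.mem_B_succ_iff (p' := v.1) (n' := v.1 + v.2) (by omega) (by omega) x.2]
  constructor
  · rintro ⟨e, he⟩
    obtain ⟨y, rfl⟩ := Φ.pageMk_surjective _ _ e
    rw [Φ.page_d_pageMk h, pageMk_eq_iff] at he
    exact ⟨y.1, y.2, he⟩
  · rintro ⟨y, hy, hyx⟩
    refine ⟨Φ.pageMk r v ⟨y, hy⟩, ?_⟩
    rw [Φ.page_d_pageMk h, pageMk_eq_iff]
    exact hyx

lemma toPageHomology_eq_zero_iff (r : ℤ) (s : ℤ × ℤ) (x : Φ.Z (r + 1) s.1 (s.1 + s.2)) :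
    Φ.toPageHomology r s x = 0 ↔ x.1 ∈ Φ.B (r + 1) s.1 (s.1 + s.2) := by
  rw [toPageHomology, LinearMap.comp_apply,
    (Φ.page r).cycleClass_eq_zero_iff (next_eq s) (prev_eq s), toPageCycles_coe,
    Φ.exists_d_eq_pageMk_iff ⟨by dsimp only; ring, by dsimp only; ring⟩]

end ChainFiltration

/-! ### Successive pages and convergence. -/

namespace ChainFiltration

variable {R : Type u} [CommRing R] {K : ChainComplex (ModuleCat.{u} R) ℤ} (Φ : ChainFiltration K)

lemma ker_toPageHomology (r : ℤ) (s : ℤ × ℤ) :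
    (Φ.B (r + 1) s.1 (s.1 + s.2)).submoduleOf (Φ.Z (r + 1) s.1 (s.1 + s.2)) =
      LinearMap.ker (Φ.toPageHomology r s) := by
  ext x
  rw [LinearMap.mem_ker, toPageHomology_eq_zero_iff]
  rfl

/-- The next page is the homology of the page `r`. -/
noncomputable def pageSuccEquiv (r : ℤ) (s : ℤ × ℤ) :
    Φ.E (r + 1) s.1 (s.1 + s.2) ≃ₗ[R] (Φ.page r).homology s :=
  (Submodule.quotEquivOfEq _ _ (Φ.ker_toPageHomology r s)).trans
    ((Φ.toPageHomology r s).quotKerEquivOfSurjective (Φ.toPageHomology_surjective r s))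

/-- The isomorphism from the homology of the page `r` to the next page. -/
noncomputable def pageIso (r : ℤ) (s : ℤ × ℤ) :
    (Φ.page r).homology s ≅ (Φ.page (r + 1)).X s :=
  (Φ.pageSuccEquiv r s).symm.toModuleIso

/-- The spectral sequence of a filtered complex, from the second page on. -/
noncomputable def spectralSequence : HomologicalSpectralSequence R where
  page r _ := Φ.page r
  iso r r' s h _ := Φ.pageIso r s ≪≫ eqToIso (by rw [h])

/-- The image of the homology of `F p` in the homology of the filtered complex. -/
noncomputable def homologyFil (n p : ℤ) : Submodule R (K.homology n) :=
  ((Φ.F p n).comap (LinearMap.ker (K.d n (n - 1)).hom).subtype).map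
    (K.cycleClass (ChainComplex.next ℤ n))

lemma mem_homologyFil {n p : ℤ} {h : K.homology n} :
    h ∈ Φ.homologyFil n p ↔ ∃ x : LinearMap.ker (K.d n (n - 1)).hom, x.1 ∈ Φ.F p n ∧
      K.cycleClass (ChainComplex.next ℤ n) x = h := by
  simp only [homologyFil, Submodule.mem_map, Submodule.mem_comap, Submodule.subtype_apply]

lemma homologyFil_mono (n : ℤ) : Monotone (Φ.homologyFil n) := fun _ _ h =>
  Submodule.map_mono (Submodule.comap_mono (Φ.mono n h))

lemma exists_homologyFil_eq_bot (n : ℤ) : ∃ a, Φ.homologyFil n a = ⊥ := by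
  obtain ⟨a, ha⟩ := Φ.exists_eq_bot n
  refine ⟨a, eq_bot_iff.2 fun h hh => ?_⟩
  obtain ⟨x, hx, rfl⟩ := Φ.mem_homologyFil.1 hh
  rw [ha, Submodule.mem_bot] at hx
  rw [Submodule.mem_bot, show x = 0 from Subtype.ext hx, map_zero]

lemma exists_homologyFil_eq_top (n : ℤ) : ∃ b, Φ.homologyFil n b = ⊤ := by
  obtain ⟨b, hb⟩ := Φ.exists_eq_top n
  refine ⟨b, eq_top_iff.2 fun h _ => ?_⟩
  obtain ⟨x, rfl⟩ := K.cycleClass_surjective (ChainComplex.next ℤ n) h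
  exact Φ.mem_homologyFil.2 ⟨x, by rw [hb]; exact Submodule.mem_top, rfl⟩

lemma subsingleton_E_of_eq_bot {r p n : ℤ} (h : Φ.F p n = ⊥) : Subsingleton (Φ.E r p n) := by
  refine ⟨fun e e' => ?_⟩
  obtain ⟨x, rfl⟩ := Φ.mkE_surjective _ _ _ e
  obtain ⟨y, rfl⟩ := Φ.mkE_surjective _ _ _ e'
  rw [mkE_eq_iff]
  have h1 := Submodule.sub_mem _ (Φ.mem_Z.1 x.2).1 (Φ.mem_Z.1 y.2).1
  rw [h, Submodule.mem_bot] at h1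
  rw [h1]
  exact Submodule.zero_mem _

lemma subsingleton_E_of_eq_top {r p n : ℤ} (h : Φ.F (p - 1) n = ⊤) :
    Subsingleton (Φ.E r p n) := by
  refine ⟨fun e e' => ?_⟩
  obtain ⟨x, rfl⟩ := Φ.mkE_surjective _ _ _ e
  obtain ⟨y, rfl⟩ := Φ.mkE_surjective _ _ _ e'
  rw [mkE_eq_iff]
  refine Φ.Z_pred_le_B _ _ _ (Φ.mem_Z.2 ⟨by rw [h]; exact Submodule.mem_top, fun m => ?_⟩)
  rw [sub_sub_sub_cancel_right]
  exact (Φ.mem_Z.1 (Submodule.sub_mem _ x.2 y.2)).2 m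

lemma Z_le_ker {r p n : ℤ} (h : Φ.F (p - r) (n - 1) = ⊥) :
    Φ.Z r p n ≤ LinearMap.ker (K.d n (n - 1)).hom := by
  intro x hx
  have := (Φ.mem_Z.1 hx).2 (n - 1)
  rwa [h, Submodule.mem_bot] at this

lemma mem_Z_of_mem_ker {r p n : ℤ} {x : K.X n} (hx : x ∈ Φ.F p n)
    (hd : (K.d n (n - 1)).hom x = 0) : x ∈ Φ.Z r p n := by
  refine Φ.mem_Z.2 ⟨hx, fun m => ?_⟩
  by_cases hm : m = n - 1
  · rw [hm, hd]; exact Submodule.zero_mem _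
  · rw [K.shape _ _ (by simp only [ComplexShape.down_Rel]; omega)]
    exact Submodule.zero_mem _

/-- The map from the permanent cycles to the graded pieces of the homology. -/
noncomputable def toGraded {r p n : ℤ} (h : Φ.F (p - r) (n - 1) = ⊥) :
    Φ.Z r p n →ₗ[R] Φ.homologyFil n p ⧸ (Φ.homologyFil n (p - 1)).submoduleOf (Φ.homologyFil n p) :=
  Submodule.mkQ _ ∘ₗ (K.cycleClass (ChainComplex.next ℤ n) ∘ₗ
    Submodule.inclusion (Φ.Z_le_ker h)).codRestrict _ fun x =>
      Φ.mem_homologyFil.2 ⟨_, (Φ.mem_Z.1 x.2).1, rfl⟩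

lemma toGraded_surjective {r p n : ℤ} (h : Φ.F (p - r) (n - 1) = ⊥) :
    Function.Surjective (Φ.toGraded h) := by
  intro e
  obtain ⟨⟨e, he⟩, rfl⟩ := Submodule.mkQ_surjective _ e
  obtain ⟨x, hx, rfl⟩ := Φ.mem_homologyFil.1 he
  exact ⟨⟨x.1, Φ.mem_Z_of_mem_ker hx x.2⟩, rfl⟩

/-- The class of `x` lies in the smaller step when `x = w + dy` with `w` a cycle in `F (p - 1)`. The
bounds demanded by `B r p n` are then automatic: `y` lies in `F (p + r - 1)`, which is everything,
and `dy = x - w` lies in `F p`. -/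
lemma toGraded_eq_zero_iff {r p n : ℤ} (h : Φ.F (p - r) (n - 1) = ⊥)
    (h' : Φ.F (p + r - 1) (n + 1) = ⊤) (x : Φ.Z r p n) :
    Φ.toGraded h x = 0 ↔ x.1 ∈ Φ.B r p n := by
  have h0 : Φ.toGraded h x = 0 ↔ K.cycleClass (ChainComplex.next ℤ n) ⟨x.1, Φ.Z_le_ker h x.2⟩ ∈
      Φ.homologyFil n (p - 1) := by
    unfold toGraded
    rw [LinearMap.comp_apply, Submodule.mkQ_apply, Submodule.Quotient.mk_eq_zero]
    rfl
  rw [h0, mem_homologyFil, mem_B]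
  have hx := Φ.Z_le_ker h x.2
  constructor
  · rintro ⟨w, hw, hwx⟩
    obtain ⟨y, hy⟩ := (K.cycleClass_eq_iff _ (ChainComplex.prev ℤ n) _ _).1 hwx.symm
    refine ⟨w.1, Φ.mem_Z_of_mem_ker hw w.2, y, Φ.mem_Z.2 ⟨by rw [h']; exact Submodule.mem_top,
      fun m => ?_⟩, ?_⟩
    · by_cases hm : m = n
      · subst hm
        rw [hy]
        exact Submodule.sub_mem _ (Φ.mem_of_le (by omega) (Φ.mem_Z.1 x.2).1)
          (Φ.mem_of_le (by omega) hw)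
      · rw [K.shape _ _ (by simp only [ComplexShape.down_Rel]; omega)]
        exact Submodule.zero_mem _
    · rw [hy]
      exact add_sub_cancel _ _
  · rintro ⟨w, hw, z, hz, hwz⟩
    have hdw : w ∈ LinearMap.ker (K.d n (n - 1)).hom := by
      rw [LinearMap.mem_ker] at hx ⊢
      rwa [← hwz, map_add, K.d_hom_d_hom, add_zero] at hx
    refine ⟨⟨w, hdw⟩, (Φ.mem_Z.1 hw).1, ?_⟩
    refine ((K.cycleClass_eq_iff _ (ChainComplex.prev ℤ n) _ _).2 ⟨z, ?_⟩).symm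
    rw [← hwz, add_sub_cancel_left]

lemma nonempty_equiv_graded {r p n : ℤ} (h : Φ.F (p - r) (n - 1) = ⊥)
    (h' : Φ.F (p + r - 1) (n + 1) = ⊤) :
    Nonempty (Φ.E r p n ≃ₗ[R] Φ.homologyFil n p ⧸
      (Φ.homologyFil n (p - 1)).submoduleOf (Φ.homologyFil n p)) := by
  have hker : (Φ.B r p n).submoduleOf (Φ.Z r p n) = LinearMap.ker (Φ.toGraded h) := by
    ext x
    rw [LinearMap.mem_ker, Φ.toGraded_eq_zero_iff h h']
    rfl
  exact ⟨(Submodule.quotEquivOfEq _ _ hker).trans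
    ((Φ.toGraded h).quotKerEquivOfSurjective (Φ.toGraded_surjective h))⟩

/-- The spectral sequence of a filtered complex converges to the homology of the complex. -/
theorem spectralSequence_convergesTo :
    Φ.spectralSequence.ConvergesTo (fun n => K.homology n) := by
  refine ⟨Φ.homologyFil, Φ.homologyFil_mono, Φ.exists_homologyFil_eq_bot,
    Φ.exists_homologyFil_eq_top, fun p q => ?_⟩
  obtain ⟨a, ha⟩ := Φ.exists_eq_bot (p + q - 1)
  obtain ⟨b, hb⟩ := Φ.exists_eq_top (p + q + 1)
  -- From this page on `p - r ≤ a` and `b ≤ p + r - 1`, so one step of the filtration is zero and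
  -- the other is everything in the adjacent total degrees.
  refine ⟨max 2 (max (p - a) (b - p + 1)), le_max_left _ _, fun r hr hr₀ => ?_⟩
  have hra : p - a ≤ r := (le_max_left _ _).trans ((le_max_right _ _).trans hr₀)
  have hrb : b - p + 1 ≤ r := (le_max_right _ _).trans ((le_max_right _ _).trans hr₀)
  have hbot : Φ.F (p - r) (p + q - 1) = ⊥ :=
    eq_bot_iff.2 (ha ▸ Φ.mono (p + q - 1) (by omega))
  have htop : Φ.F (p + r - 1) (p + q + 1) = ⊤ :=
    eq_top_iff.2 (hb ▸ Φ.mono (p + q + 1) (by omega))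
  refine ⟨fun s => ?_, fun s => ?_, Φ.nonempty_equiv_graded hbot htop⟩
  -- An incoming differential starts at filtration index `p + r`, where the preceding step is
  -- already everything. An outgoing one ends at index `p - r`, where the step is zero.
  · by_cases hs : (p, q).1 = s.1 - r ∧ (p, q).2 = s.2 + r - 1
    · have h1 : s.1 - 1 = p + r - 1 := by dsimp only at hs; omega
      have h2 : s.1 + s.2 = p + q + 1 := by dsimp only at hs; omega
      have : Subsingleton (Φ.E r s.1 (s.1 + s.2)) :=
        Φ.subsingleton_E_of_eq_top (by rw [h1, h2]; exact htop)
      exact ModuleCat.hom_ext (LinearMap.ext fun e => by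
        rw [show e = 0 from Subsingleton.elim (α := Φ.E r s.1 (s.1 + s.2)) _ _, map_zero, map_zero])
    · exact (Φ.page r).shape _ _ fun h => hs (rel_iff.1 h)
  · by_cases hs : s.1 = (p, q).1 - r ∧ s.2 = (p, q).2 + r - 1
    · have h1 : s.1 = p - r := hs.1
      have h2 : s.1 + s.2 = p + q - 1 := by dsimp only at hs; omega
      have : Subsingleton (Φ.E r s.1 (s.1 + s.2)) :=
        Φ.subsingleton_E_of_eq_bot (by rw [h2, h1]; exact hbot)
      exact ModuleCat.hom_ext (LinearMap.ext fun e =>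
        Subsingleton.elim (α := Φ.E r s.1 (s.1 + s.2)) _ _)
    · exact (Φ.page r).shape _ _ fun h => hs (rel_iff.1 h)

end ChainFiltration

/-! ### The second page from a model of the first page. -/

namespace ChainFiltration

variable {R : Type u} [CommRing R] {K : ChainComplex (ModuleCat.{u} R) ℤ} (Φ : ChainFiltration K)

section SecondPage

variable {q : ℤ} {L : ChainComplex (ModuleCat.{u} R) ℤ} (T : ∀ p, Φ.Z 1 p (p + q) →ₗ[R] L.X p)
  {ε : ℤˣ}

lemma d_eq_zero_of_mem_Z_two (hT : ∀ p x, T p x = 0 ↔ x.1 ∈ Φ.B 1 p (p + q))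
    (hd : ∀ p p' (hp : p' = p - 1) x, (L.d p p').hom (T p x) =
      ε • T p' ⟨(K.d (p + q) (p' + q)).hom x.1, Φ.d_mem_Z hp x.2⟩) {p : ℤ} (x : K.X (p + q))
    (hx : x ∈ Φ.Z 2 p (p + q)) :
    (L.d p (p - 1)).hom (T p ⟨x, Φ.Z_succ_le 1 _ _ hx⟩) = 0 := by
  rw [hd p _ rfl, (hT _ _).2, smul_zero]
  exact Φ.d_mem_B_of_mem_Z_succ rfl hx

/-- The map from `Z 2 p (p + q)` to the homology of a complex that describes the first page. -/
noncomputable def toFirstPageHomology (hT : ∀ p x, T p x = 0 ↔ x.1 ∈ Φ.B 1 p (p + q))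
    (hd : ∀ p p' (hp : p' = p - 1) x, (L.d p p').hom (T p x) =
      ε • T p' ⟨(K.d (p + q) (p' + q)).hom x.1, Φ.d_mem_Z hp x.2⟩) (p : ℤ) :
    Φ.Z 2 p (p + q) →ₗ[R] L.homology p :=
  L.cycleClass (ChainComplex.next ℤ p) ∘ₗ
    (T p ∘ₗ Submodule.inclusion (Φ.Z_succ_le 1 p (p + q))).codRestrict _ fun x =>
      Φ.d_eq_zero_of_mem_Z_two T hT hd x.1 x.2

lemma toFirstPageHomology_surjective (hT : ∀ p x, T p x = 0 ↔ x.1 ∈ Φ.B 1 p (p + q))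
    (hd : ∀ p p' (hp : p' = p - 1) x, (L.d p p').hom (T p x) =
      ε • T p' ⟨(K.d (p + q) (p' + q)).hom x.1, Φ.d_mem_Z hp x.2⟩)
    (hs : ∀ p, Function.Surjective (T p)) (p : ℤ) :
    Function.Surjective (Φ.toFirstPageHomology T hT hd p) := by
  intro e
  obtain ⟨⟨w, hw⟩, rfl⟩ := L.cycleClass_surjective (ChainComplex.next ℤ p) e
  obtain ⟨⟨x, hx⟩, rfl⟩ := hs p w
  rw [LinearMap.mem_ker, hd p _ rfl, smul_eq_zero_iff_eq, hT] at hw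
  obtain ⟨z, hz, hxz⟩ := Φ.exists_sub_mem_Z_succ (p' := p - 1) (n' := p - 1 + q) rfl (by omega) hx hw
  refine ⟨⟨x - z, hxz⟩, congrArg (L.cycleClass (ChainComplex.next ℤ p)) (Subtype.ext ?_)⟩
  change T p ⟨x - z, _⟩ = T p ⟨x, hx⟩
  rw [← sub_eq_zero, ← map_sub, hT]
  change x - z - x ∈ _
  rw [sub_sub_cancel_left]
  exact Submodule.neg_mem _ (Φ.Z_pred_le_B _ _ _ hz)

lemma toFirstPageHomology_eq_zero_iff (hT : ∀ p x, T p x = 0 ↔ x.1 ∈ Φ.B 1 p (p + q))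
    (hd : ∀ p p' (hp : p' = p - 1) x, (L.d p p').hom (T p x) =
      ε • T p' ⟨(K.d (p + q) (p' + q)).hom x.1, Φ.d_mem_Z hp x.2⟩)
    (hs : ∀ p, Function.Surjective (T p)) (p : ℤ) (x : Φ.Z 2 p (p + q)) :
    Φ.toFirstPageHomology T hT hd p x = 0 ↔ x.1 ∈ Φ.B 2 p (p + q) := by
  have h1 : Φ.toFirstPageHomology T hT hd p x = 0 ↔
      ∃ y, (L.d (p + 1) p).hom y = T p ⟨x.1, Φ.Z_succ_le 1 _ _ x.2⟩ := by
    rw [toFirstPageHomology, LinearMap.comp_apply,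
      L.cycleClass_eq_zero_iff (ChainComplex.next ℤ p) (ChainComplex.prev ℤ p)]
    rfl
  have h2 := Φ.mem_B_succ_iff (r := 1) (p' := p + 1) (n' := p + 1 + q) rfl (by omega) x.2
  have h3 : ∀ y : Φ.Z 1 (p + 1) (p + 1 + q),
      (L.d (p + 1) p).hom (T (p + 1) y) = ε • T p ⟨x.1, Φ.Z_succ_le 1 _ _ x.2⟩ ↔
        (K.d (p + 1 + q) (p + q)).hom y.1 - x.1 ∈ Φ.B 1 p (p + q) := by
    intro y
    rw [hd (p + 1) p (by omega), smul_left_cancel_iff, ← sub_eq_zero, ← map_sub, hT]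
    rfl
  refine h1.trans (Iff.trans ?_ h2.symm)
  constructor
  · rintro ⟨w, hw⟩
    -- Lifting `ε • w` instead of `w` absorbs the sign by which `T` fails to commute with the
    -- differentials.
    obtain ⟨y, hy⟩ := hs (p + 1) (ε • w)
    refine ⟨y.1, y.2, (h3 y).1 ?_⟩
    rw [hy, Units.smul_def, map_zsmul, hw, ← Units.smul_def]
  · rintro ⟨y, hy, hyx⟩
    refine ⟨ε⁻¹ • T (p + 1) ⟨y, hy⟩, ?_⟩
    rw [Units.smul_def, map_zsmul, (h3 ⟨y, hy⟩).2 hyx, ← Units.smul_def, inv_smul_smul]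

/-- If the first page is isomorphic to a complex, up to a sign, then the second page is isomorphic
to its homology. -/
lemma nonempty_equiv_homology (hT : ∀ p x, T p x = 0 ↔ x.1 ∈ Φ.B 1 p (p + q))
    (hd : ∀ p p' (hp : p' = p - 1) x, (L.d p p').hom (T p x) =
      ε • T p' ⟨(K.d (p + q) (p' + q)).hom x.1, Φ.d_mem_Z hp x.2⟩)
    (hs : ∀ p, Function.Surjective (T p)) (p : ℤ) :
    Nonempty (Φ.E 2 p (p + q) ≃ₗ[R] L.homology p) := by
  have hker : (Φ.B 2 p (p + q)).submoduleOf (Φ.Z 2 p (p + q)) =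
      LinearMap.ker (Φ.toFirstPageHomology T hT hd p) := by
    ext x
    rw [LinearMap.mem_ker, Φ.toFirstPageHomology_eq_zero_iff T hT hd hs]
    rfl
  exact ⟨(Submodule.quotEquivOfEq _ _ hker).trans ((Φ.toFirstPageHomology T hT hd p).quotKerEquivOfSurjective
    (Φ.toFirstPageHomology_surjective T hT hd hs p))⟩

end SecondPage

end ChainFiltration

/-! ### Comparison of the edge signs of the full cube with those of the fixed and free cubes. -/

section Gauge

variable {N : ℕ}

/-- The sign of the permutation that moves the elements of `α ∩ F` in front of those of `α \ F`. -/
def shuffleSign (F α : Finset (Fin N)) : ℤ :=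
  ∏ f ∈ α ∩ F, (-1) ^ ((α \ F).filter (· < f)).card

lemma shuffleSign_mul_self (F α : Finset (Fin N)) : shuffleSign F α * shuffleSign F α = 1 := by
  rw [shuffleSign, ← Finset.prod_mul_distrib]
  exact Finset.prod_eq_one fun f _ => by rw [← mul_pow, neg_one_mul, neg_neg, one_pow]

lemma neg_one_pow_card_filter_lt (F α : Finset (Fin N)) (c : Fin N) :
    (-1 : ℤ) ^ (α.filter (· < c)).card =
      (-1) ^ ((α ∩ F).filter (· < c)).card * (-1) ^ ((α \ F).filter (· < c)).card := by
  rw [← pow_add, ← Finset.card_union_of_disjoint, ← Finset.filter_union, Finset.union_comm, Finset.sdiff_union_inter]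
  exact Finset.disjoint_filter_filter (Finset.disjoint_sdiff_inter α F).symm

/-- The new factor of `shuffleSign` counts the elements of `α \ F` before `c`, which is exactly the
excess of the edge sign of the full cube over that of the cube on `F`. -/
lemma edgeSign_mul_shuffleSign_of_mem {F α : Finset (Fin N)} {c : Fin N} (hc : c ∉ α) (hF : c ∈ F) :
    edgeSign α (insert c α) * shuffleSign F (insert c α) =
      shuffleSign F α * edgeSign (α ∩ F) (insert c α ∩ F) := by
  rw [Finset.insert_inter_of_mem hF, LinkDiagram.IsKhovanovCube.edgeSign_insert hc,
    LinkDiagram.IsKhovanovCube.edgeSign_insert (by simp [hc]), neg_one_pow_card_filter_lt F]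
  have h1 : shuffleSign F (insert c α) =
      (-1) ^ ((α \ F).filter (· < c)).card * shuffleSign F α := by
    rw [shuffleSign, Finset.insert_inter_of_mem hF, Finset.insert_sdiff_of_mem _ hF,
      Finset.prod_insert (by simp [hc]), shuffleSign]
  have h2 : ∀ n : ℕ, (-1 : ℤ) ^ n * (-1) ^ n = 1 := fun n => by
    rw [← mul_pow, neg_one_mul, neg_neg, one_pow]
  rw [h1]
  linear_combination (-1 : ℤ) ^ ((α ∩ F).filter (· < c)).card * shuffleSign F α * h2 ((α \ F).filter (· < c)).card

/-- The edge sign of the full cube counts the elements of `α ∩ F` before `c`, and the change of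
`shuffleSign` counts those after `c`. Together they count all of `α ∩ F`, whatever `c` is. -/
lemma edgeSign_mul_shuffleSign_of_notMem {F α : Finset (Fin N)} {c : Fin N} (hc : c ∉ α)
    (hF : c ∉ F) :
    edgeSign α (insert c α) * shuffleSign F (insert c α) =
      (-1) ^ (α ∩ F).card * (shuffleSign F α * edgeSign (α \ F) (insert c α \ F)) := by
  have hcd : c ∉ α \ F := by simp [hc]
  have h1 : shuffleSign F (insert c α) =
      shuffleSign F α * (-1) ^ ((α ∩ F).filter (c < ·)).card := by
    rw [shuffleSign, Finset.insert_inter_of_notMem hF, Finset.insert_sdiff_of_notMem _ hF, shuffleSign,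
      Finset.card_filter, ← Finset.prod_pow_eq_pow_sum, ← Finset.prod_mul_distrib]
    refine Finset.prod_congr rfl fun f _ => ?_
    rw [Finset.filter_insert, ← pow_add]
    split_ifs with h
    · rw [Finset.card_insert_of_notMem (by simp [hc])]
    · rfl
  have h2 : (-1 : ℤ) ^ (α ∩ F).card =
      (-1) ^ ((α ∩ F).filter (· < c)).card * (-1) ^ ((α ∩ F).filter (c < ·)).card := by
    rw [← pow_add, ← Finset.card_filter_add_card_filter_not (s := α ∩ F) (· < c)]
    congr 3
    refine Finset.filter_congr fun f hf => ?_
    have : f ≠ c := by rintro rfl; exact hc (Finset.mem_inter.1 hf).1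
    rw [not_lt]
    exact ⟨fun h => lt_of_le_of_ne h this.symm, le_of_lt⟩
  rw [Finset.insert_sdiff_of_notMem _ hF, LinkDiagram.IsKhovanovCube.edgeSign_insert hc,
    LinkDiagram.IsKhovanovCube.edgeSign_insert hcd, neg_one_pow_card_filter_lt F, h1, h2]
  ring

end Gauge

/-! ### Projection of the Khovanov complex to the vertices of the free cube. -/

namespace LinkDiagram

open Classical in
/-- The projection of the Khovanov complex of `D` to that of `D_{F,x}`, with the signs that make
the differentials compatible. -/
noncomputable def toVertex (R : Type u) [CommRing R] (D : LinkDiagram) (F x : Finset (Fin D.N))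
    (i j n q : ℤ) : (D.Gen Finset.univ ∅ n i →₀ R) →ₗ[R] (D.Gen F x q j →₀ R) :=
  matrixMap R fun S T => if S.1 = T.1 then shuffleSign F S.1.ones else 0

variable (R : Type u) [CommRing R] {D : LinkDiagram}

open Classical in
lemma sum_gen_eq_left (F x : Finset (Fin D.N)) (j q : ℤ) (S : D.EnhancedState)
    (f : D.EnhancedState → ℤ) (a : ℤ) :
    ∑ T : D.Gen F x q j, (if S = T.1 then a else 0) * f T.1 =
      if S.ones \ F = x ∧ ((S.ones ∩ F).card : ℤ) = F.card - q ∧ S.deg + (S.ones ∩ F).card = j then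
        a * f S else 0 := by
  split_ifs with h
  · rw [Finset.sum_eq_single ⟨S, h⟩, if_pos rfl]
    · intro T _ hT
      rw [if_neg (fun e => hT (Subtype.ext e.symm)), zero_mul]
    · simp
  · refine Finset.sum_eq_zero fun T _ => ?_
    rw [if_neg, zero_mul]
    rintro rfl
    exact h T.2

open Classical in
lemma sum_gen_eq_right (F x : Finset (Fin D.N)) (j q : ℤ) (U : D.EnhancedState)
    (f g : D.EnhancedState → ℤ) :
    ∑ T : D.Gen F x q j, f T.1 * (if T.1 = U then g T.1 else 0) =
      if U.ones \ F = x ∧ ((U.ones ∩ F).card : ℤ) = F.card - q ∧ U.deg + (U.ones ∩ F).card = j then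
        f U * g U else 0 := by
  split_ifs with h
  · rw [Finset.sum_eq_single ⟨U, h⟩, if_pos rfl]
    · intro T _ hT
      rw [if_neg (fun e => hT (Subtype.ext e)), mul_zero]
    · simp
  · refine Finset.sum_eq_zero fun T _ => ?_
    rw [if_neg, mul_zero]
    rintro rfl
    exact h T.2

lemma card_sdiff_add (F α : Finset (Fin D.N)) :
    ((α \ F).card : ℤ) + ((α ∩ F).card : ℤ) = α.card := by
  exact_mod_cast Finset.card_sdiff_add_card_inter α F

/-- The differential changes one crossing: a fixed one gives the differential at the vertex `y`, a
free one gives a saddle into `y`. The two lemmas on `shuffleSign` match the signs. -/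
lemma toVertex_comp_khD {F : Finset (Fin D.N)} {p p' q q' n n' i : ℤ} (hp : p' + 1 = p)
    (hq : q' = q + 1) (hn : n = p + q) (hn' : n' = p' + q) (y : IsKhovanovCube.Vertex F p') :
    D.toVertex R F y.1 i (i - y.1.card) n' q ∘ₗ D.khD R Finset.univ ∅ i n n' =
      D.khD R F y.1 (i - y.1.card) q' q ∘ₗ D.toVertex R F y.1 i (i - y.1.card) n q' +
        (Int.negOnePow (F.card - q)) • ∑ x : IsKhovanovCube.Vertex F p, edgeSign x.1 y.1 •
          (D.saddle R F x.1 y.1 (i - x.1.card) (i - y.1.card) q ∘ₗ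
            D.toVertex R F x.1 i (i - x.1.card) n q) := by
  classical
  unfold toVertex khD saddle
  simp only [matrixMap_comp]
  ext ⟨S, hS1, hS2, hS3⟩ ⟨U, hU1, hU2, hU3⟩
  obtain ⟨y, hyF, hy⟩ := y
  dsimp only at hU1 hU2 hU3
  simp only [LinearMap.comp_apply, Finsupp.lsingle_apply, LinearMap.add_apply, Finsupp.add_apply,
    Units.smul_def, LinearMap.smul_apply, Finsupp.smul_apply, LinearMap.sum_apply, Finsupp.finsetSum_apply,
    matrixMap_single_apply, one_mul, zsmul_eq_mul, Finset.inter_univ]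
  have e1 := sum_gen_eq_right Finset.univ ∅ i n' U
    (fun T => edgeSign (S.ones ∩ Finset.univ) (T.ones ∩ Finset.univ) * D.incidence S T)
    (fun T => shuffleSign F T.ones)
  have e2 := sum_gen_eq_left F y (i - y.card) q' S
    (fun T => edgeSign (T.ones ∩ F) (U.ones ∩ F) * D.incidence T U) (shuffleSign F S.ones)
  have e3 := fun x : IsKhovanovCube.Vertex F p => sum_gen_eq_left F x.1 (i - x.1.card) q S
    (fun T => if x.1 ⋖ y then D.incidence T U else 0) (shuffleSign F S.ones)
  simp only [Finset.inter_univ] at e1 hS2 hS3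
  rw [e1, e2]
  simp only [e3]
  norm_cast
  congr 1
  clear e1 e2 e3
  have hScard := card_sdiff_add F S.ones
  have hUcard := card_sdiff_add F U.ones
  rw [hU1] at hUcard
  rw [Finset.card_univ, Fintype.card_fin] at hS2
  have hFcard : (F.card : ℤ) + (Fᶜ.card : ℤ) = D.N := by
    have := Finset.card_add_card_compl F
    rw [Fintype.card_fin] at this
    exact_mod_cast this
  by_cases hinc : D.incidence S U = 0
  · simp [hinc]
  have hdeg := deg_of_incidence_ne_zero hinc
  obtain ⟨c, hc, hU⟩ := exists_of_incidence_ne_zero hinc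
  have hcard : ((S.ones.card : ℤ)) + 1 = U.ones.card := by
    rw [hU, Finset.card_insert_of_notMem hc]; push_cast; rfl
  rw [if_pos ⟨by simp, by rw [Finset.card_univ, Fintype.card_fin]; omega, by omega⟩]
  by_cases hF : c ∈ F
  · have hSd : S.ones \ F = y := by rw [← hU1, hU, Finset.insert_sdiff_of_mem _ hF]
    rw [hSd] at hScard
    rw [if_pos ⟨hSd, by omega, by omega⟩, Finset.sum_eq_zero, mul_zero, add_zero, hU]
    · linear_combination D.incidence S U * edgeSign_mul_shuffleSign_of_mem hc hF
    · intro x _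
      by_cases hx : S.ones \ F = x.1 ∧ ((S.ones ∩ F).card : ℤ) = F.card - q ∧
          S.deg + (S.ones ∩ F).card = i - x.1.card
      · rw [if_neg (c := x.1 ⋖ y) (by rw [← hx.1, hSd]; exact lt_irrefl _ ∘ CovBy.lt)]
        simp
      · rw [if_neg hx, mul_zero]
  -- The only vertex that contributes is `S.ones \ F`. The leftover sign `(-1) ^ #(S.ones ∩ F)`
  -- depends only on `q`, because this cardinality is `#F - q`.
  · have hUd : y = insert c (S.ones \ F) := by rw [← hU1, hU, Finset.insert_sdiff_of_notMem _ hF]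
    have hUi : U.ones ∩ F = S.ones ∩ F := by rw [hU, Finset.insert_inter_of_notMem hF]
    have hycard : (y.card : ℤ) = (S.ones \ F).card + 1 := by
      rw [hUd, Finset.card_insert_of_notMem (by simp [hc])]; push_cast; rfl
    rw [hUi] at hU2 hU3 hUcard
    have hcov : S.ones \ F ⋖ y := Finset.covBy_iff_exists_insert.2 ⟨c, by simp [hc], hUd.symm⟩
    have hx0 : Disjoint (S.ones \ F) F := Finset.sdiff_disjoint
    rw [if_neg (fun h => hcov.ne h.1), zero_add,
      Finset.sum_eq_single (⟨S.ones \ F, hx0, by omega⟩ : IsKhovanovCube.Vertex F p), if_pos ⟨rfl, hU2, by dsimp only; omega⟩, if_pos hcov, ← hU2]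
    · have key := edgeSign_mul_shuffleSign_of_notMem hc hF
      rw [← hU, hU1] at key
      have hε : (((S.ones ∩ F).card : ℤ).negOnePow : ℤ) = (-1) ^ (S.ones ∩ F).card := by
        rw [Int.negOnePow_def]; simp
      rw [hε]
      linear_combination D.incidence S U * key
    · intro x _ hx
      rw [if_neg, mul_zero]
      rintro ⟨h, -⟩
      exact hx (Subtype.ext h.symm)
    · simp

end LinkDiagram

lemma ModuleCat.biproduct_ext {R : Type u} [CommRing R] {J : Type} [Finite J] (f : J → ModuleCat.{u} R)
    {w w' : (⨁ f : ModuleCat.{u} R)} (h : ∀ x, (biproduct.π f x).hom w = (biproduct.π f x).hom w') :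
    w = w' := by
  have := Fintype.ofFinite J
  have key : ∀ w : (⨁ f : ModuleCat.{u} R),
      w = ∑ x, (biproduct.ι f x).hom ((biproduct.π f x).hom w) := by
    intro w
    have := congrArg (fun g => g.hom w) (biproduct.total (f := f))
    simp only [ModuleCat.hom_sum, LinearMap.sum_apply] at this
    exact this.symm
  rw [key w, key w']
  simp only [h]

lemma matrixMap_apply {R : Type u} [CommRing R] {A B : Type} [Fintype A] [Finite B] (M : A → B → ℤ)
    (v : A →₀ R) (b : B) : matrixMap R M v b = ∑ a, v a * M a b := by
  rw [matrixMap, Finsupp.linearCombination_apply, Finsupp.sum_fintype _ _ (by simp),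
    Finsupp.finsetSum_apply]
  simp

/-! ### The filtration by free 0-smoothings and its graded pieces. -/

namespace LinkDiagram

variable {R : Type u} [CommRing R] {D : LinkDiagram} {F : Finset (Fin D.N)} {p q n i : ℤ}

lemma gen_univ_of_gen (hn : n = p + q) (x : IsKhovanovCube.Vertex F p) {S : D.EnhancedState}
    (hS : S.ones \ F = x.1 ∧ ((S.ones ∩ F).card : ℤ) = F.card - q ∧
      S.deg + (S.ones ∩ F).card = i - x.1.card) :
    S.ones \ Finset.univ = ∅ ∧ ((S.ones ∩ Finset.univ).card : ℤ) = (Finset.univ : Finset (Fin D.N)).card - n ∧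
      S.deg + (S.ones ∩ Finset.univ).card = i := by
  have h1 := card_sdiff_add F S.ones
  have h2 : (F.card : ℤ) + (Fᶜ.card : ℤ) = (Finset.univ : Finset (Fin D.N)).card := by
    exact_mod_cast Finset.card_add_card_compl F
  have h3 := x.2.2
  rw [hS.1] at h1
  rw [Finset.inter_univ]
  exact ⟨by simp, by omega, by omega⟩

lemma gen_of_gen_univ (hn : n = p + q) {S : D.EnhancedState}
    (hS : S.ones \ Finset.univ = ∅ ∧ ((S.ones ∩ Finset.univ).card : ℤ) = (Finset.univ : Finset (Fin D.N)).card - n ∧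
      S.deg + (S.ones ∩ Finset.univ).card = i) (hx : ((S.ones \ F).card : ℤ) = Fᶜ.card - p) :
    S.ones \ F = S.ones \ F ∧ ((S.ones ∩ F).card : ℤ) = F.card - q ∧
      S.deg + (S.ones ∩ F).card = i - (S.ones \ F).card := by
  have h1 := card_sdiff_add F S.ones
  have h2 : (F.card : ℤ) + (Fᶜ.card : ℤ) = (Finset.univ : Finset (Fin D.N)).card := by
    exact_mod_cast Finset.card_add_card_compl F
  rw [Finset.inter_univ] at hS
  exact ⟨rfl, by omega, by omega⟩

/-- A generator at the vertex `x` is also a generator for `D`, in degree `n = p + q`. The projection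
is therefore restriction of coefficients followed by a sign. -/
lemma toVertex_apply (hn : n = p + q) (x : IsKhovanovCube.Vertex F p)
    (v : D.Gen Finset.univ ∅ n i →₀ R) (T : D.Gen F x.1 q (i - x.1.card)) :
    D.toVertex R F x.1 i (i - x.1.card) n q v T =
      v ⟨T.1, gen_univ_of_gen hn x T.2⟩ * shuffleSign F T.1.ones := by
  rw [toVertex, matrixMap_apply, Finset.sum_eq_single ⟨T.1, gen_univ_of_gen hn x T.2⟩, if_pos rfl]
  · intro S _ hS
    rw [if_neg fun e => hS (Subtype.ext e), Int.cast_zero, mul_zero]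
  · exact fun h => absurd (Finset.mem_univ _) h

/-- The chains of the Khovanov complex of `D` in the smoothings with at most `p` free crossings that
are 0-smoothed. -/
def chainFil (R : Type u) [CommRing R] (F : Finset (Fin D.N)) (i p n : ℤ) :
    Submodule R (D.Gen Finset.univ ∅ n i →₀ R) :=
  Finsupp.supported R R {S | (Fᶜ.card : ℤ) - (S.1.ones \ F).card ≤ p}

lemma mem_chainFil {v : D.Gen Finset.univ ∅ n i →₀ R} : v ∈ chainFil R F i p n ↔
    ∀ S, p < (Fᶜ.card : ℤ) - (S.1.ones \ F).card → v S = 0 := by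
  rw [chainFil, Finsupp.mem_supported']
  simp only [Set.mem_ofPred_eq, not_le]

lemma chainFil_mono (F : Finset (Fin D.N)) (i n : ℤ) : Monotone fun p => chainFil R F i p n :=
  fun _ _ hp => Finsupp.supported_mono fun _ hS => le_trans hS hp

lemma chainFil_eq_bot (F : Finset (Fin D.N)) (i n : ℤ) : chainFil R F i (-1) n = ⊥ := by
  refine eq_bot_iff.2 fun v hv => Finsupp.ext fun S => mem_chainFil.1 hv S ?_
  have : (S.1.ones \ F).card ≤ Fᶜ.card :=
    Finset.card_le_card fun c hc => by simpa using (Finset.mem_sdiff.1 hc).2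
  omega

lemma chainFil_eq_top (F : Finset (Fin D.N)) (i n : ℤ) : chainFil R F i Fᶜ.card n = ⊤ :=
  eq_top_iff.2 fun v _ => mem_chainFil.2 fun S hS => absurd hS (by omega)

/-- The generators of filtration degree exactly `p` are partitioned by their vertices of rank `ℓ -
p`, so prescribed components can be glued. The sign is its own inverse. -/
lemma exists_toVertex_eq (hn : n = p + q)
    (u : ∀ x : IsKhovanovCube.Vertex F p, D.Gen F x.1 q (i - x.1.card) →₀ R) :
    ∃ v ∈ chainFil R F i p n,
      ∀ x : IsKhovanovCube.Vertex F p, D.toVertex R F x.1 i (i - x.1.card) n q v = u x := by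
  classical
  refine ⟨Finsupp.equivFunOnFinite.symm fun S =>
    if hx : ((S.1.ones \ F).card : ℤ) = Fᶜ.card - p then
      u ⟨S.1.ones \ F, Finset.sdiff_disjoint, hx⟩ ⟨S.1, gen_of_gen_univ hn S.2 hx⟩ *
        shuffleSign F S.1.ones else 0, ?_, fun x => ?_⟩
  · rw [mem_chainFil]
    intro S hS
    rw [Finsupp.equivFunOnFinite_symm_apply_apply, dif_neg (by omega)]
  · ext T
    rw [toVertex_apply hn]
    obtain ⟨x, hxF, hx⟩ := x
    obtain ⟨T, hT, hT2, hT3⟩ := T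
    dsimp only at hT
    subst hT
    rw [Finsupp.equivFunOnFinite_symm_apply_apply, dif_pos hx, mul_assoc, ← Int.cast_mul,
      shuffleSign_mul_self, Int.cast_one, mul_one]

lemma toVertex_eq_zero (hn : n = p + q) {v : D.Gen Finset.univ ∅ n i →₀ R} {p' : ℤ} (hp : p' < p)
    (hv : v ∈ chainFil R F i p' n)
    (x : IsKhovanovCube.Vertex F p) : D.toVertex R F x.1 i (i - x.1.card) n q v = 0 := by
  ext T
  rw [toVertex_apply hn, mem_chainFil.1 hv, zero_mul, Finsupp.zero_apply]
  have h1 := T.2.1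
  have h2 := x.2.2
  rw [h1]
  omega

/-- With `toVertex_eq_zero` and `exists_toVertex_eq`, this identifies the `p`-th graded piece with
the sum over the vertices of rank `ℓ - p`. -/
lemma mem_chainFil_of_toVertex_eq_zero (hn : n = p + q) {v : D.Gen Finset.univ ∅ n i →₀ R}
    (hv : v ∈ chainFil R F i p n)
    (h : ∀ x : IsKhovanovCube.Vertex F p, D.toVertex R F x.1 i (i - x.1.card) n q v = 0) :
    v ∈ chainFil R F i (p - 1) n := by
  rw [mem_chainFil] at hv ⊢
  intro S hS
  by_cases hS' : p < (Fᶜ.card : ℤ) - (S.1.ones \ F).card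
  · exact hv S hS'
  have hx : ((S.1.ones \ F).card : ℤ) = Fᶜ.card - p := by omega
  have h1 := DFunLike.congr_fun (h ⟨S.1.ones \ F, Finset.sdiff_disjoint, hx⟩)
    ⟨S.1, gen_of_gen_univ hn S.2 hx⟩
  rw [toVertex_apply hn, Finsupp.zero_apply] at h1
  have h2 := congrArg (· * (shuffleSign F S.1.ones : R)) h1
  dsimp only at h2
  rwa [mul_assoc, ← Int.cast_mul, shuffleSign_mul_self, Int.cast_one, mul_one, zero_mul] at h2

/-- The differential never creates a 0-smoothing. -/
lemma khD_mem_chainFil (F : Finset (Fin D.N)) (p i n m : ℤ) {v : D.Gen Finset.univ ∅ n i →₀ R}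
    (hv : v ∈ chainFil R F i p n) :
    D.khD R Finset.univ ∅ i n m v ∈ chainFil R F i p m := by
  rw [mem_chainFil] at hv ⊢
  intro T hT
  rw [khD, matrixMap_apply]
  refine Finset.sum_eq_zero fun S _ => ?_
  by_cases hS : p < (Fᶜ.card : ℤ) - (S.1.ones \ F).card
  · rw [hv S hS, zero_mul]
  by_cases hinc : D.incidence S.1 T.1 = 0
  · rw [hinc, mul_zero, Int.cast_zero, mul_zero]
  obtain ⟨c, -, hc⟩ := exists_of_incidence_ne_zero hinc
  have := Finset.card_le_card (Finset.sdiff_subset_sdiff (Finset.subset_insert c S.1.ones) (le_refl F))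
  rw [← hc] at this
  omega

namespace IsKhovanovCube

variable (h : D.IsKhovanovCube R)

/-- The filtration of the Khovanov complex by the number of 0-smoothings of the free crossings. -/
def freeFiltration (F : Finset (Fin D.N)) (i : ℤ) : ChainFiltration (h.complex Finset.univ ∅ i) where
  F p n := chainFil R F i p n
  mono n := chainFil_mono F i n
  d_mem p n m _ hv := khD_mem_chainFil F p i n m hv
  exists_eq_bot n := ⟨-1, chainFil_eq_bot F i n⟩
  exists_eq_top n := ⟨Fᶜ.card, chainFil_eq_top F i n⟩

end IsKhovanovCube

end LinkDiagram

/-! ### The first page, its differential, and the second page. -/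

namespace LinkDiagram

variable {R : Type u} [CommRing R] {D : LinkDiagram} {F : Finset (Fin D.N)} {p q n i : ℤ}

lemma toVertex_khD {p' q' n' : ℤ} (hp : p' + 1 = p)
    (hq : q' = q + 1) (hn : n = p + q) (hn' : n' = p' + q) (y : IsKhovanovCube.Vertex F p')
    (v : D.Gen Finset.univ ∅ n i →₀ R) :
    D.toVertex R F y.1 i (i - y.1.card) n' q (D.khD R Finset.univ ∅ i n n' v) =
      D.khD R F y.1 (i - y.1.card) q' q (D.toVertex R F y.1 i (i - y.1.card) n q' v) +
        (Int.negOnePow (F.card - q)) • ∑ x : IsKhovanovCube.Vertex F p, edgeSign x.1 y.1 •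
          D.saddle R F x.1 y.1 (i - x.1.card) (i - y.1.card) q
            (D.toVertex R F x.1 i (i - x.1.card) n q v) := by
  have := LinearMap.congr_fun (toVertex_comp_khD (R := R) (i := i) hp hq hn hn' y) v
  simpa only [LinearMap.comp_apply, LinearMap.add_apply, Units.smul_def, LinearMap.smul_apply,
    LinearMap.sum_apply] using this

/-- The saddle terms read the components of `v` at filtration degree `p + 1`, which vanish. -/
lemma toVertex_khD_of_mem {q' n' : ℤ} (hq : q' = q + 1) (hn : n = p + q') (hn' : n' = p + q)
    {v : D.Gen Finset.univ ∅ n i →₀ R} (hv : v ∈ chainFil R F i p n)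
    (x : IsKhovanovCube.Vertex F p) :
    D.toVertex R F x.1 i (i - x.1.card) n' q (D.khD R Finset.univ ∅ i n n' v) =
      D.khD R F x.1 (i - x.1.card) q' q (D.toVertex R F x.1 i (i - x.1.card) n q' v) := by
  rw [toVertex_khD rfl hq (show n = p + 1 + q by omega) hn' x, Finset.sum_eq_zero, smul_zero, add_zero]
  intro y _
  rw [toVertex_eq_zero (show n = p + 1 + q by omega) (lt_add_one p) hv, map_zero, smul_zero]

namespace IsKhovanovCube

variable (h : D.IsKhovanovCube R)

lemma mem_freeFiltration_Z {r : ℤ} {v : D.Gen Finset.univ ∅ n i →₀ R} :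
    v ∈ (h.freeFiltration F i).Z r p n ↔ v ∈ chainFil R F i p n ∧
      ∀ m, D.khD R Finset.univ ∅ i n m v ∈ chainFil R F i (p - r) m :=
  (h.freeFiltration F i).mem_Z

/-- For `Z 0` the condition on the boundary is automatic, since the differential preserves the
filtration. -/
lemma mem_freeFiltration_B_one {v : D.Gen Finset.univ ∅ n i →₀ R} :
    v ∈ (h.freeFiltration F i).B 1 p n ↔ ∃ w ∈ chainFil R F i (p - 1) n,
      ∃ z ∈ chainFil R F i p (n + 1), w + D.khD R Finset.univ ∅ i (n + 1) n z = v := by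
  have hZ : ∀ (p n : ℤ) (w : D.Gen Finset.univ ∅ n i →₀ R),
      w ∈ (h.freeFiltration F i).Z (1 - 1) p n ↔ w ∈ chainFil R F i p n := by
    intro p n w
    rw [mem_freeFiltration_Z, sub_self, sub_zero]
    exact and_iff_left_of_imp fun hw m => khD_mem_chainFil F p i n m hw
  refine (h.freeFiltration F i).mem_B.trans ?_
  rw [add_sub_cancel_right]
  exact exists_congr fun w => and_congr (hZ _ _ w)
    (exists_congr fun z => and_congr (hZ _ _ z) Iff.rfl)

lemma toVertex_mem_ker {v : D.Gen Finset.univ ∅ (p + q) i →₀ R}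
    (hv : v ∈ (h.freeFiltration F i).Z 1 p (p + q)) (x : Vertex F p) :
    D.toVertex R F x.1 i (i - x.1.card) (p + q) q v ∈
      LinearMap.ker ((h.complex F x.1 (i - x.1.card)).d q (q - 1)).hom := by
  rw [mem_freeFiltration_Z] at hv
  change D.khD R F x.1 (i - x.1.card) q (q - 1) _ = 0
  rw [← toVertex_khD_of_mem (n' := p + (q - 1)) (by omega) rfl rfl hv.1,
    toVertex_eq_zero rfl (sub_one_lt p) (hv.2 _)]

/-- The homology class at a vertex of a chain on the first page. -/
noncomputable def vertexClass (F : Finset (Fin D.N)) (i p q : ℤ) (x : Vertex F p) :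
    (h.freeFiltration F i).Z 1 p (p + q) →ₗ[R] h.vertex F x.1 q i :=
  (h.complex F x.1 (i - x.1.card)).cycleClass (ChainComplex.next ℤ q) ∘ₗ
    (D.toVertex R F x.1 i (i - x.1.card) (p + q) q ∘ₗ
      ((h.freeFiltration F i).Z 1 p (p + q)).subtype).codRestrict _ fun v =>
        h.toVertex_mem_ker v.2 x

lemma vertexClass_mk (v : D.Gen Finset.univ ∅ (p + q) i →₀ R)
    (hv : v ∈ (h.freeFiltration F i).Z 1 p (p + q)) (x : Vertex F p) :
    h.vertexClass F i p q x ⟨v, hv⟩ =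
      (h.complex F x.1 (i - x.1.card)).cycleClass (ChainComplex.next ℤ q)
        ⟨D.toVertex R F x.1 i (i - x.1.card) (p + q) q v, h.toVertex_mem_ker hv x⟩ := rfl

/-- The map that identifies the first page with the complex of the `V_{q,i}(x)`. -/
noncomputable def toKbar (F : Finset (Fin D.N)) (i q p : ℤ) :
    (h.freeFiltration F i).Z 1 p (p + q) →ₗ[R] (h.kbar F q i).X p :=
  (biproduct.lift fun x : Vertex F p => ModuleCat.ofHom (h.vertexClass F i p q x)).hom

lemma π_toKbar (v : (h.freeFiltration F i).Z 1 p (p + q)) (x : Vertex F p) :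
    (biproduct.π (fun x : Vertex F p => h.vertex F x.1 q i) x).hom (h.toKbar F i q p v) =
      h.vertexClass F i p q x v := by
  have := biproduct.lift_π (fun x : Vertex F p => ModuleCat.ofHom (h.vertexClass F i p q x)) x
  exact congrArg (fun g => g.hom v) this

lemma toKbar_eq_iff (v : (h.freeFiltration F i).Z 1 p (p + q)) (w : (h.kbar F q i).X p) :
    h.toKbar F i q p v = w ↔ ∀ x : Vertex F p, h.vertexClass F i p q x v =
      (biproduct.π (fun x : Vertex F p => h.vertex F x.1 q i) x).hom w := by
  constructor
  · rintro rfl x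
    exact (h.π_toKbar v x).symm
  · intro hv
    exact ModuleCat.biproduct_ext _ fun x => (h.π_toKbar v x).trans (hv x)

lemma vertexClass_eq_zero_iff (v : D.Gen Finset.univ ∅ (p + q) i →₀ R)
    (hv : v ∈ (h.freeFiltration F i).Z 1 p (p + q)) (x : Vertex F p) :
    h.vertexClass F i p q x ⟨v, hv⟩ = 0 ↔ ∃ u, D.khD R F x.1 (i - x.1.card) (q + 1) q u =
      D.toVertex R F x.1 i (i - x.1.card) (p + q) q v :=
  (h.complex F x.1 (i - x.1.card)).cycleClass_eq_zero_iff (ChainComplex.next ℤ q)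
    (ChainComplex.prev ℤ q) ⟨_, h.toVertex_mem_ker hv x⟩

/-- All components of `v` bound at their vertices exactly when `v` differs from the boundary of a
chain in filtration degree `p` by a chain in degree `p - 1`. -/
lemma toKbar_eq_zero_iff (v : D.Gen Finset.univ ∅ (p + q) i →₀ R)
    (hv : v ∈ (h.freeFiltration F i).Z 1 p (p + q)) :
    h.toKbar F i q p ⟨v, hv⟩ = 0 ↔ v ∈ (h.freeFiltration F i).B 1 p (p + q) := by
  have hv' := (h.mem_freeFiltration_Z.1 hv).1
  refine (h.toKbar_eq_iff _ _).trans (Iff.trans (forall_congr' fun x => (iff_of_eq (congrArg (_ = ·)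
    (LinearMap.map_zero (biproduct.π (fun x : Vertex F p => h.vertex F x.1 q i) x).hom))).trans
      (h.vertexClass_eq_zero_iff v hv x)) (Iff.trans ?_ h.mem_freeFiltration_B_one.symm))
  constructor
  · intro hu
    choose u hu using hu
    obtain ⟨z, hz, hzu⟩ := exists_toVertex_eq (show p + q + 1 = p + (q + 1) by ring) u
    have hd := khD_mem_chainFil F p i (p + q + 1) (p + q) hz
    refine ⟨v - D.khD R Finset.univ ∅ i (p + q + 1) (p + q) z,
      mem_chainFil_of_toVertex_eq_zero rfl (Submodule.sub_mem _ hv' hd) fun x => ?_, z, hz,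
      sub_add_cancel _ _⟩
    rw [map_sub, toVertex_khD_of_mem rfl (by ring) rfl hz, hzu, hu, sub_self]
  · rintro ⟨w, hw, z, hz, rfl⟩ x
    refine ⟨D.toVertex R F x.1 i (i - x.1.card) (p + q + 1) (q + 1) z, ?_⟩
    rw [map_add, toVertex_eq_zero rfl (sub_one_lt p) hw, zero_add,
      toVertex_khD_of_mem rfl (by ring) rfl hz]

lemma toKbar_surjective (F : Finset (Fin D.N)) (i q p : ℤ) :
    Function.Surjective (h.toKbar F i q p) := by
  intro w
  have hc := fun x : Vertex F p => (h.complex F x.1 (i - x.1.card)).cycleClass_surjective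
    (ChainComplex.next ℤ q) ((biproduct.π (fun x : Vertex F p => h.vertex F x.1 q i) x).hom w)
  choose u hu using hc
  -- Glue cycles representing the components of `w`. The components of the boundary at filtration
  -- degree `p` vanish, so the glued chain lies in `Z 1`.
  obtain ⟨v, hv, hvu⟩ := exists_toVertex_eq (n := p + q) rfl fun x => (u x).1
  have hvZ : v ∈ (h.freeFiltration F i).Z 1 p (p + q) := by
    refine h.mem_freeFiltration_Z.2 ⟨hv, fun m => ?_⟩
    by_cases hm : m + 1 = p + q
    · refine mem_chainFil_of_toVertex_eq_zero (show m = p + (q - 1) by omega)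
        (khD_mem_chainFil F p i _ m hv) fun x => ?_
      rw [toVertex_khD_of_mem (by ring) rfl (by omega) hv, hvu]
      exact (u x).2
    · rw [khD_eq_zero _ _ _ _ _ hm]
      exact Submodule.zero_mem _
  refine ⟨⟨v, hvZ⟩, (h.toKbar_eq_iff _ _).2 fun x => (Eq.trans ?_ (hu x))⟩
  rw [vertexClass_mk]
  exact congrArg _ (Subtype.ext (hvu x))

lemma π_kbarD {p' : ℤ} (w : (⨁ fun x : Vertex F p => h.vertex F x.1 q i : ModuleCat.{u} R))
    (y : Vertex F p') :
    (biproduct.π (fun x : Vertex F p' => h.vertex F x.1 q i) y).hom ((h.kbarD F q i p p').hom w) =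
      ∑ x : Vertex F p, edgeSign x.1 y.1 • (h.edge F x.1 y.1 q i).hom
        ((biproduct.π (fun x : Vertex F p => h.vertex F x.1 q i) x).hom w) := by
  have h1 : h.kbarD F q i p p' ≫ biproduct.π (fun x : Vertex F p' => h.vertex F x.1 q i) y =
      ∑ x : Vertex F p, biproduct.π (fun x : Vertex F p => h.vertex F x.1 q i) x ≫
        (edgeSign x.1 y.1 • h.edge F x.1 y.1 q i) := by
    rw [kbarD, biproduct.matrix_π, biproduct.desc_eq]
  have h2 := congrArg (fun g => g.hom w) h1
  simp only [ModuleCat.hom_sum, LinearMap.sum_apply] at h2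
  exact h2

lemma saddle_toVertex_mem_ker {v : D.Gen Finset.univ ∅ (p + q) i →₀ R}
    (hv : v ∈ (h.freeFiltration F i).Z 1 p (p + q)) (x : Vertex F p) (y : Finset (Fin D.N)) :
    D.saddle R F x.1 y (i - x.1.card) (i - y.card) q
      (D.toVertex R F x.1 i (i - x.1.card) (p + q) q v) ∈
        LinearMap.ker ((h.complex F y (i - y.card)).d q (q - 1)).hom := by
  have h1 := LinearMap.congr_fun (h.saddle_comp_d F x.1 y (i - x.1.card) (i - y.card) q (q - 1))
    (D.toVertex R F x.1 i (i - x.1.card) (p + q) q v)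
  have h2 : D.khD R F x.1 (i - x.1.card) q (q - 1)
      (D.toVertex R F x.1 i (i - x.1.card) (p + q) q v) = 0 := h.toVertex_mem_ker hv x
  rw [LinearMap.comp_apply, h2, map_zero] at h1
  exact h1.symm

lemma edge_vertexClass (v : D.Gen Finset.univ ∅ (p + q) i →₀ R)
    (hv : v ∈ (h.freeFiltration F i).Z 1 p (p + q)) (x : Vertex F p) (y : Finset (Fin D.N)) :
    (h.edge F x.1 y q i).hom (h.vertexClass F i p q x ⟨v, hv⟩) =
      (h.complex F y (i - y.card)).cycleClass (ChainComplex.next ℤ q)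
        ⟨_, h.saddle_toVertex_mem_ker hv x y⟩ :=
  HomologicalComplex.homologyMap_cycleClass (h.saddleHom F x.1 y (i - x.1.card) (i - y.card))
    (ChainComplex.next ℤ q) ⟨_, h.toVertex_mem_ker hv x⟩ (h.saddle_toVertex_mem_ker hv x y)

/-- In `toVertex_khD` the first term is a boundary at the vertex `y`, so only the saddle terms
survive in homology. Their common sign is the same for all `p`, as `nonempty_equiv_homology`
requires. -/
lemma kbarD_toKbar {p' : ℤ} (hp : p' = p - 1) (v : D.Gen Finset.univ ∅ (p + q) i →₀ R)
    (hv : v ∈ (h.freeFiltration F i).Z 1 p (p + q))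
    (hdv : D.khD R Finset.univ ∅ i (p + q) (p' + q) v ∈ (h.freeFiltration F i).Z 1 p' (p' + q)) :
    (h.kbarD F q i p p').hom (h.toKbar F i q p ⟨v, hv⟩) =
      Int.negOnePow (F.card - q) • h.toKbar F i q p' ⟨_, hdv⟩ := by
  refine ModuleCat.biproduct_ext _ fun y => ?_
  have h1 := toVertex_khD (q := q) (show p' + 1 = p by omega) rfl rfl rfl y v
  set s : LinearMap.ker ((h.complex F y.1 (i - y.1.card)).d q (q - 1)).hom :=
    ∑ x : Vertex F p, edgeSign x.1 y.1 • ⟨_, h.saddle_toVertex_mem_ker hv x y.1⟩ with hs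
  have h2 : (biproduct.π (fun x : Vertex F p' => h.vertex F x.1 q i) y).hom
      ((h.kbarD F q i p p').hom (h.toKbar F i q p ⟨v, hv⟩)) =
      (h.complex F y.1 (i - y.1.card)).cycleClass (ChainComplex.next ℤ q) s := by
    rw [hs, map_sum]
    refine (h.π_kbarD _ y).trans (Finset.sum_congr rfl fun x _ => ?_)
    rw [map_zsmul]
    refine congrArg (_ • ·) ?_
    exact (congrArg _ (h.π_toKbar _ x)).trans (h.edge_vertexClass v hv x y.1)
  have hs' : (LinearMap.ker ((h.complex F y.1 (i - y.1.card)).d q (q - 1)).hom).subtype s =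
      ∑ x : Vertex F p, edgeSign x.1 y.1 • D.saddle R F x.1 y.1 (i - x.1.card) (i - y.1.card) q
        (D.toVertex R F x.1 i (i - x.1.card) (p + q) q v) := by
    rw [hs]
    exact (map_sum _ _ _).trans (Finset.sum_congr rfl fun x _ => rfl)
  have h3 : (h.complex F y.1 (i - y.1.card)).cycleClass (ChainComplex.next ℤ q)
      ⟨_, h.toVertex_mem_ker hdv y⟩ = (Int.negOnePow (F.card - q) : ℤ) •
      (h.complex F y.1 (i - y.1.card)).cycleClass (ChainComplex.next ℤ q) s := by
    rw [← map_zsmul, HomologicalComplex.cycleClass_eq_iff _ _ (ChainComplex.prev ℤ q)]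
    refine ⟨D.toVertex R F y.1 i (i - y.1.card) (p + q) (q + 1) v, ?_⟩
    rw [Units.smul_def, ← hs'] at h1
    exact eq_sub_of_add_eq h1.symm
  have h4 : (biproduct.π (fun x : Vertex F p' => h.vertex F x.1 q i) y).hom
      (Int.negOnePow (F.card - q) • h.toKbar F i q p' ⟨_, hdv⟩) =
      (Int.negOnePow (F.card - q) : ℤ) • (h.complex F y.1 (i - y.1.card)).cycleClass
        (ChainComplex.next ℤ q) ⟨_, h.toVertex_mem_ker hdv y⟩ :=
    (map_zsmul (biproduct.π (fun x : Vertex F p' => h.vertex F x.1 q i) y).hom _ _).trans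
      (congrArg (_ • ·) (h.π_toKbar _ y))
  rw [h2]
  refine Eq.trans ?_ h4.symm
  rw [h3, smul_smul, ← Units.val_mul, Int.units_mul_self, Units.val_one, one_smul]

lemma nonempty_iso_fixedKH (F : Finset (Fin D.N)) (i p q : ℤ) :
    Nonempty (((h.freeFiltration F i).page 2).X (p, q) ≅ h.fixedKH F p q i) := by
  obtain ⟨e⟩ := (h.freeFiltration F i).nonempty_equiv_homology (h.toKbar F i q)
    (fun p x => h.toKbar_eq_zero_iff x.1 x.2)
    (fun p p' hp x => h.kbarD_toKbar hp x.1 x.2 ((h.freeFiltration F i).d_mem_Z hp x.2))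
    (h.toKbar_surjective F i q) p
  exact ⟨e.toModuleIso⟩

end IsKhovanovCube

end LinkDiagram

theorem theorem2 {R : Type u} [CommRing R] (D : LinkDiagram) :
    ∃ h : D.IsKhovanovCube R, ∀ (F : Finset (Fin D.N)) (i : ℤ),
      ∃ E : HomologicalSpectralSequence R,
        (∀ p q : ℤ, Nonempty ((E.page 2).X (p, q) ≅ h.fixedKH F p q i)) ∧
        E.ConvergesTo (fun n => h.KH n i) := by
  have h := D.isKhovanovCube R
  exact ⟨h, fun F i => ⟨(h.freeFiltration F i).spectralSequence, h.nonempty_iso_fixedKH F i,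
    (h.freeFiltration F i).spectralSequence_convergesTo⟩⟩
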